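/- Let $\xi_1,\dots,\xi_n$ be independent, non-degenerate real random variables with $\mathbf E\xi_i=0$; put $S_n=\sum_{i=1}^n\xi_i$ and $\sigma^2=\sum_{i=1}^n\mathbf E\xi_i^2$ ($\sigma>0$). Let $\Phi$ be the standard normal distribution function, $\Theta(x)=(1-\Phi(x))e^{x^2/2}$, and $$H_n(x,\sigma)=\left\{\Big(\frac{\sigma}{x+\sigma}\Big)^{x\sigma+\sigma^2}\Big(\frac{n}{n-x\sigma}\Big)^{n-x\sigma}\right\}^{\frac{n}{n+\sigma^2}}\mathbf 1_{\{x\le n/\sigma\}},$$ where the second factor is $1$ when $x\sigma=n$. Condition (A), with constants $\delta\in(0,1]$ and $B>0$, says that $$\mathbf E|\xi_i|^{2+\delta}\le B^{2+\delta}\ (1\le i\le n)\quad\text{and}\quad \sum_{i=1}^n\mathbf E\xi_i^2e^{\lambda\xi_i}\ge(1-B\lambda)\sum_{i=1}^n\mathbf E\xi_i^2\ \text{ for all }\lambda\ge0 .$$ Let $C_{2+\delta}$ be the least constant $C$ such that $\sup_{x\in\mathbf R}|\mathbf P(T_m\le xs)-\Phi(x)|\le C\,s^{-(2+\delta)}\sum_{i=1}^m\mathbf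 E|\zeta_i|^{2+\delta}$ for all $m\ge1$ and all independent, non-degenerate, centered $\zeta_1,\dots,\zeta_m$ with finite $(2+\delta)$-th moments, where $T_m=\sum_{i=1}^m\zeta_i$ and $s^2=\sum_{i=1}^m\mathbf E\zeta_i^2$, $s>0$. **Theorem 2.1.** (a) Assume condition (A) with constants $\delta$ and $B$, and that $\xi_i\le1$ and $\xi_i\le B$ almost surely for all $1\le i\le n$ (the latter follows from the former if $B\ge1$). Then, for all $0\le x<0.25\,\sigma/B$, there is a real $\theta$ with $|\theta|\le1$ such that $$\mathbf P(S_n>x\sigma)=\big(\Theta(x)+\theta\varepsilon_x\big)\inf_{\lambda\ge0}\mathbf E e^{\lambda(S_n-x\sigma)},$$ and $$\mathbf P(S_n>x\sigma)\le\big((\Theta(x)+\varepsilon_x)\wedge1\big)H_n(x,\sigma),$$ where $$\varepsilon_x=\frac{e^t}{1-2t}\left(\frac{1.58}{\sqrt\pi}\frac B\sigma+\frac{2^{3+\delta}C_{2+\delta}}{(1-2t)^{\delta/2}}\,\frac{\sum_{i=1}^n\mathbf E|\xi_i|^{2+\delta}}{\sigma^{2+\delta}}\right),\qquad t=\frac{2xB/\sigma}{1+\sqrt{1-4xB/\sigma}}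 .$$ (b) Let $\xi_1,\xi_2,\dots$ be an i.i.d. sequence of non-degenerate centered random variables with $\xi_i\le1$ almost surely, satisfying condition (A) with constants $\delta\in(0,1]$ and $B>0$, and let $S_n$ and $\sigma=\sigma_n=(n\mathbf E\xi_1^2)^{1/2}$ be formed from $\xi_1,\dots,\xi_n$. Then, for every sequence $x=x_n\ge0$ with $x_n=o(n^{\delta/2})$, $$\frac{\mathbf P(S_n\ge x\sigma)}{\Theta(x)\inf_{\lambda\ge0}\mathbf E e^{\lambda(S_n-x\sigma)}}=1+o(1)\qquad(n\to\infty);$$ and there is a constant $K$, not depending on the sequence $(x_n)$, such that for every such sequence and all sufficiently large $n$ (how large may depend on the sequence), $$\Big|\mathbf P(S_n>x\sigma)-\Theta(x)\inf_{\lambda\ge0}\mathbf E e^{\lambda(S_n-x\sigma)}\Big|\le \frac{K}{n^{\delta/2}}H_n(x,\sigma).$$ -/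

import Mathlib

open MeasureTheory ProbabilityTheory Filter Asymptotics
open scoped NNReal

namespace SharpTail

noncomputable section

/-- The standing assumptions on `ξ₁, …, ξₙ`: independent, non-degenerate (not almost surely
constant) real random variables with `E ξᵢ = 0`. -/
structure CenteredIndep {Ω : Type*} [MeasurableSpace Ω] (P : Measure Ω) {n : ℕ}
    (ξ : Fin n → Ω → ℝ) : Prop where
  measurable : ∀ i, Measurable (ξ i)
  indep : iIndepFun ξ P
  integrable : ∀ i, Integrable (ξ i) P
  mean_zero : ∀ i, ∫ ω, ξ i ω ∂P = 0
  nondegenerate : ∀ i, ¬ ∃ c : ℝ, ∀ᵐ ω ∂P, ξ i ω = c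

/-- `Sₙ = ξ₁ + ⋯ + ξₙ`. -/
def partialSum {Ω : Type*} {n : ℕ} (ξ : Fin n → Ω → ℝ) (ω : Ω) : ℝ := ∑ i, ξ i ω

/-- `σ`, the nonnegative square root of `σ² = ∑ E ξᵢ²`. -/
def sigma {Ω : Type*} [MeasurableSpace Ω] (P : Measure Ω) {n : ℕ} (ξ : Fin n → Ω → ℝ) : ℝ :=
  √(∑ i, ∫ ω, ξ i ω ^ 2 ∂P)

/-- `(∑ E|ξᵢ|^{2+δ}) / σ^{2+δ}`, the Lyapunov ratio. -/
def lyapunovRatio {Ω : Type*} [MeasurableSpace Ω] (P : Measure Ω) {n : ℕ} (ξ : Fin n → Ω → ℝ)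
    (δ : ℝ) : ℝ :=
  (∑ i, ∫ ω, |ξ i ω| ^ (2 + δ) ∂P) / sigma P ξ ^ (2 + δ)

/-- Condition (A) with constants `δ` and `B`. It is used together with an upper bound
`ξᵢ ≤ 1`, so that, the second moments being finite, all `E ξᵢ² e^{λξᵢ}` with `λ ≥ 0`
are finite. -/
structure ConditionA {Ω : Type*} [MeasurableSpace Ω] (P : Measure Ω) {n : ℕ}
    (ξ : Fin n → Ω → ℝ) (δ B : ℝ) : Prop where
  delta_pos : 0 < δ
  delta_le_one : δ ≤ 1
  B_pos : 0 < B
  integrable_moment : ∀ i, Integrable (fun ω => |ξ i ω| ^ (2 + δ)) P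
  moment_le : ∀ i, ∫ ω, |ξ i ω| ^ (2 + δ) ∂P ≤ B ^ (2 + δ)
  le_tilted : ∀ l : ℝ, 0 ≤ l →
    (1 - B * l) * ∑ i, ∫ ω, ξ i ω ^ 2 ∂P ≤ ∑ i, ∫ ω, ξ i ω ^ 2 * Real.exp (l * ξ i ω) ∂P

/-- The standard normal distribution function. -/
def Phi (x : ℝ) : ℝ := cdf (gaussianReal 0 1) x

/-- `Θ(x) = (1 - Φ(x)) exp(x²/2)`. -/
def Theta (x : ℝ) : ℝ := (1 - Phi x) * Real.exp (x ^ 2 / 2)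

/-- `C` is an admissible constant in the Berry–Esseen inequality with `(2+δ)`-th moments, for all
`n ≥ 1` and all independent, centered, non-degenerate `ξ₁, …, ξₙ` with finite `(2+δ)`-th moments.
As the inequality only depends on the joint law of the `ξᵢ` on `ℝⁿ`, letting the probability
space range over `Type` covers all probability spaces. -/
def IsBerryEsseenBound (δ C : ℝ) : Prop :=
  ∀ (Ω : Type) (_ : MeasurableSpace Ω) (P : Measure Ω), IsProbabilityMeasure P →
    ∀ (n : ℕ) (ξ : Fin n → Ω → ℝ), 1 ≤ n → CenteredIndep P ξ →
      (∀ i, Integrable (fun ω => |ξ i ω| ^ (2 + δ)) P) →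
      ∀ x : ℝ, |P.real {ω | partialSum ξ ω ≤ x * sigma P ξ} - Phi x| ≤ C * lyapunovRatio P ξ δ

/-- The Lyapunov constant `C_{2+δ}`: the least admissible constant in the Berry–Esseen
inequality. -/
def lyapunovConst (δ : ℝ) : ℝ := sInf {C : ℝ | IsBerryEsseenBound δ C}

/-- `inf_{λ ≥ 0} E e^{λ(Sₙ - xσ)}`. -/
def expInf {Ω : Type*} [MeasurableSpace Ω] (P : Measure Ω) {n : ℕ} (ξ : Fin n → Ω → ℝ)
    (x : ℝ) : ℝ :=
  ⨅ l : ℝ≥0, ∫ ω, Real.exp ((l : ℝ) * (partialSum ξ ω - x * sigma P ξ)) ∂P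

/-- Hoeffding's bound `Hₙ(x, σ)`. When `xσ = n` the second factor is `0 ^ 0 = 1`, which is the
usual convention. -/
def hoeffdingH (n : ℕ) (x s : ℝ) : ℝ :=
  if x ≤ n / s then
    ((s / (x + s)) ^ (x * s + s ^ 2) * ((n : ℝ) / (n - x * s)) ^ ((n : ℝ) - x * s))
      ^ ((n : ℝ) / (n + s ^ 2))
  else 0

/-- `t = (2xB/σ) / (1 + √(1 - 4xB/σ))`. -/
def tParam (x B s : ℝ) : ℝ := (2 * x * B / s) / (1 + √(1 - 4 * x * B / s))

/-- The error term `ε_x`. -/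
def epsilonX {Ω : Type*} [MeasurableSpace Ω] (P : Measure Ω) {n : ℕ} (ξ : Fin n → Ω → ℝ)
    (δ B x : ℝ) : ℝ :=
  let t := tParam x B (sigma P ξ)
  Real.exp t / (1 - 2 * t) *
    (1.58 / √Real.pi * (B / sigma P ξ) +
      2 ^ (3 + δ) * lyapunovConst δ / (1 - 2 * t) ^ (δ / 2) * lyapunovRatio P ξ δ)

end

end SharpTail

open SharpTail

/-!
The upper tail of `S = ξ₁ + ⋯ + ξₙ` is computed by a change of measure. Let `l` solve the saddle
point equation `E_l S = xσ`, where `E_l` is the expectation under the measure with density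
proportional to `e^{lS}`; that measure is again a product measure. By convexity `l` minimises
`E e^{λ(S - xσ)}`, and `P(S > xσ) = E_l [e^{-l(S - xσ)}; S > xσ] · inf_λ E e^{λ(S - xσ)}`. Under
the tilted measure the centred sum is approximately normal, and the restricted Laplace transform of
a standard normal law is `Θ`.

Condition (A), integrated in `l`, bounds the tilted mean and variance from below
(`le_sum_tiltMean`, `le_sum_tiltVar`). Hence `lB ≤ t`, where `t` is the smaller root of
`t (1 - t) = xB/σ`, and the error has two parts. The Berry–Esseen inequality for the tilted
summands, whose Lyapunov ratio exceeds the original one by a factor controlled by `t` only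
(`lyapunovRatio_tilted_le`), gives the term with `C_{2+δ}`. The replacement of `l` times the tilted
standard deviation by `x` in the argument of `Θ` gives the term with `B/σ`
(`abs_Theta_tilt_sub_le`); it rests on the decay of the derivative of `Θ` (`abs_Theta_sub_le`).

The constant `C_{2+δ}` is an infimum, so it bounds anything only because the set of admissible
constants is not empty. This is the Berry–Esseen inequality itself (`exists_isBerryEsseenBound`),
with an unspecified constant, proved by Esseen's smoothing inequality with the Fejér kernel.

The infimum of the exponential moments is compared with `Hₙ` by Hoeffding's argument
(`le_hoeffdingH`): among centred laws on `(-∞, 1]` of given variance a two-point law has the largest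
moment generating function; in terms of the variance it is an affine decreasing image of the convex
function `c ↦ (1 - e^{-c}) / c`, so that by the arithmetic-geometric mean inequality and Jensen's
inequality the variances may be replaced by their mean; what remains is minimised explicitly.

For an i.i.d. sequence `σ` is of order `√n`, and all terms of the error are of order at most
`n^{-δ/2}`. As `Θ(x)` decays only like `1/x`, the relative error is `O((1 + x) n^{-δ/2})`.
-/

open MeasureTheory ProbabilityTheory Filter Asymptotics
open scoped NNReal

namespace SharpTail

/-! ### Characteristic functions of sums under a Lyapunov condition -/

lemma norm_cexp_sub_taylor_two_le {δ : ℝ} (h0 : 0 ≤ δ) (h1 : δ ≤ 1) (y : ℝ) :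
    ‖Complex.exp (y * Complex.I) - 1 - y * Complex.I + (y : ℂ) ^ 2 / 2‖ ≤ 4 * |y| ^ (2 + δ) := by
  rcases le_total |y| 1 with hy | hy
  · have h := Complex.exp_bound (x := y * Complex.I) (by simpa using hy) (n := 3) (by norm_num)
    have e : Complex.exp (y * Complex.I) - ∑ m ∈ Finset.range 3, (y * Complex.I) ^ m / m.factorial
        = Complex.exp (y * Complex.I) - 1 - y * Complex.I + (y : ℂ) ^ 2 / 2 := by
      simp [Finset.sum_range_succ, mul_pow]
      ring
    rw [e] at h
    refine h.trans ?_
    have h3 : |y| ^ (3 : ℕ) ≤ |y| ^ (2 + δ) := by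
      rw [← Real.rpow_natCast]
      rcases eq_or_lt_of_le (abs_nonneg y) with h' | h'
      · rw [← h', Real.zero_rpow (by norm_num), Real.zero_rpow (by linarith)]
      · exact Real.rpow_le_rpow_of_exponent_ge h' hy (by norm_num; linarith)
    have : (0 : ℝ) ≤ |y| ^ 3 := by positivity
    simp [Nat.factorial]
    nlinarith
  · have h2 : |y| ^ (2 : ℕ) ≤ |y| ^ (2 + δ) := by
      rw [← Real.rpow_natCast]
      exact Real.rpow_le_rpow_of_exponent_le hy (by norm_num; linarith)
    calc _ ≤ ‖Complex.exp (y * Complex.I)‖ + ‖(1 : ℂ)‖ + ‖y * Complex.I‖ + ‖(y : ℂ) ^ 2 / 2‖ :=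
          (norm_add_le _ _).trans (add_le_add_left ((norm_sub_le _ _).trans
            (add_le_add_left (norm_sub_le _ _) _)) _)
      _ = 1 + 1 + |y| + |y| ^ 2 / 2 := by
          simp [Complex.norm_exp_ofReal_mul_I]
      _ ≤ 4 * |y| ^ (2 + δ) := by nlinarith

lemma integrable_pow_of_integrable_rpow {μ : Measure ℝ} [IsFiniteMeasure μ] {δ : ℝ} (h0 : 0 ≤ δ)
    (hp : Integrable (fun y => |y| ^ (2 + δ)) μ) {k : ℕ} (hk : k ≤ 2) :
    Integrable (fun y : ℝ => y ^ k) μ := by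
  refine (hp.add (integrable_const 1)).mono' (by fun_prop) (ae_of_all _ fun y => ?_)
  rw [Real.norm_eq_abs, abs_pow]
  simp only [Pi.add_apply]
  rcases le_total |y| 1 with hy | hy
  · have : |y| ^ k ≤ 1 := pow_le_one₀ (abs_nonneg _) hy
    have : 0 ≤ |y| ^ (2 + δ) := by positivity
    linarith
  · have : |y| ^ k ≤ |y| ^ (2 + δ) := by
      rw [← Real.rpow_natCast]
      refine Real.rpow_le_rpow_of_exponent_le hy ?_
      have : (k : ℝ) ≤ 2 := by exact_mod_cast hk
      linarith
    linarith

/-- Lyapunov's inequality between the second and the `(2 + δ)`-th moment. -/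
lemma integral_sq_rpow_le {μ : Measure ℝ} [IsProbabilityMeasure μ] {δ : ℝ} (h0 : 0 < δ)
    (hp : Integrable (fun y => |y| ^ (2 + δ)) μ) :
    (∫ y, y ^ 2 ∂μ) ^ ((2 + δ) / 2) ≤ ∫ y, |y| ^ (2 + δ) ∂μ := by
  have h2 := integrable_pow_of_integrable_rpow h0.le hp le_rfl
  have e : ∀ y : ℝ, (y ^ 2) ^ ((2 + δ) / 2) = |y| ^ (2 + δ) := fun y => by
    rw [← sq_abs, ← Real.rpow_natCast, ← Real.rpow_mul (abs_nonneg _)]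
    congr 1
    push_cast
    ring
  have := (convexOn_rpow (p := (2 + δ) / 2) (by linarith)).map_integral_le (μ := μ)
    (f := fun y : ℝ => y ^ 2)
    (Real.continuous_rpow_const (by linarith)).continuousOn isClosed_Ici
    (ae_of_all _ fun y => by simp [sq_nonneg]) h2 (by simpa [Function.comp_def, e] using hp)
  simpa [e] using this

lemma norm_charFun_sub_taylor_le {μ : Measure ℝ} [IsProbabilityMeasure μ] {δ : ℝ} (h0 : 0 < δ)
    (h1 : δ ≤ 1) (hp : Integrable (fun y => |y| ^ (2 + δ)) μ) (hm : ∫ y, y ∂μ = 0) (t : ℝ) :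
    ‖charFun μ t - ((1 - (∫ y, y ^ 2 ∂μ) * t ^ 2 / 2 : ℝ) : ℂ)‖
      ≤ 4 * (∫ y, |y| ^ (2 + δ) ∂μ) * |t| ^ (2 + δ) := by
  have i2 := integrable_pow_of_integrable_rpow h0.le hp (k := 2) le_rfl
  have i1 := integrable_pow_of_integrable_rpow h0.le hp (k := 1) (by norm_num)
  simp only [pow_one] at i1
  have ie : Integrable (fun y : ℝ => Complex.exp (t * y * Complex.I)) μ := by
    refine (integrable_const (1 : ℝ)).mono' (by fun_prop) (ae_of_all _ fun y => ?_)
    have := Complex.norm_exp_ofReal_mul_I (t * y)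
    push_cast at this
    rw [this]
  have e : charFun μ t - ((1 - (∫ y, y ^ 2 ∂μ) * t ^ 2 / 2 : ℝ) : ℂ)
      = ∫ y : ℝ, (Complex.exp (((t * y : ℝ) : ℂ) * Complex.I) - 1 - ((t * y : ℝ) : ℂ) * Complex.I
          + ((t * y : ℝ) : ℂ) ^ 2 / 2) ∂μ := by
    have i1' : Integrable (fun y : ℝ => (y : ℂ)) μ := i1.ofReal
    have i2' : Integrable (fun y : ℝ => ((y ^ 2 : ℝ) : ℂ)) μ := i2.ofReal
    have r : ∀ y : ℝ, (Complex.exp (((t * y : ℝ) : ℂ) * Complex.I) - 1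
        - ((t * y : ℝ) : ℂ) * Complex.I + ((t * y : ℝ) : ℂ) ^ 2 / 2)
        = (Complex.exp (t * y * Complex.I) - 1 - (t * Complex.I) * (y : ℂ))
          + (t : ℂ) ^ 2 / 2 * ((y ^ 2 : ℝ) : ℂ) := fun y => by push_cast; ring
    simp_rw [r]
    have ia : Integrable (fun y : ℝ => Complex.exp (t * y * Complex.I) - 1) μ :=
      ie.sub (integrable_const _)
    have ib : Integrable (fun y : ℝ => Complex.exp (t * y * Complex.I) - 1
        - (t * Complex.I) * (y : ℂ)) μ := ia.sub (i1'.const_mul _)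
    rw [integral_add ib (i2'.const_mul _), integral_sub ia (i1'.const_mul _),
      integral_sub ie (integrable_const _), integral_const_mul, integral_const_mul,
      integral_complex_ofReal, integral_complex_ofReal, hm, charFun_apply_real]
    simp
    ring
  rw [e]
  refine (norm_integral_le_integral_norm _).trans ?_
  rw [mul_assoc, ← integral_mul_const, ← integral_const_mul]
  refine integral_mono_of_nonneg (ae_of_all _ fun y => norm_nonneg _)
    ((hp.mul_const _).const_mul _) (ae_of_all _ fun y => ?_)
  refine (norm_cexp_sub_taylor_two_le h0.le h1 (t * y)).trans (le_of_eq ?_)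
  rw [abs_mul, Real.mul_rpow (abs_nonneg _) (abs_nonneg _)]
  ring

lemma abs_exp_neg_sub_taylor_le {w q : ℝ} (hw : 0 ≤ w) (hq : 1 ≤ q) (hq2 : q ≤ 2) :
    |Real.exp (-w) - (1 - w)| ≤ w ^ q := by
  have h1 : 0 ≤ Real.exp (-w) - (1 - w) := by linarith [Real.add_one_le_exp (-w)]
  rw [abs_of_nonneg h1]
  rcases le_total w 1 with h | h
  · have : Real.exp (-w) - (1 - w) ≤ w ^ 2 := by
      have := Real.exp_bound' (x := w) hw h (n := 2) (by norm_num)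
      have h3 := Real.abs_exp_sub_one_sub_id_le (x := -w) (by rwa [abs_neg, abs_of_nonneg hw])
      have := (abs_le.1 h3).2
      nlinarith
    refine this.trans ?_
    rcases eq_or_lt_of_le hw with h' | h'
    · rw [← h', Real.zero_rpow (by linarith)]; norm_num
    · rw [← Real.rpow_natCast]
      exact Real.rpow_le_rpow_of_exponent_ge h' h (by simpa using hq2)
  · have : w ^ (1 : ℝ) ≤ w ^ q := Real.rpow_le_rpow_of_exponent_le h hq
    rw [Real.rpow_one] at this
    have : Real.exp (-w) ≤ 1 := Real.exp_le_one_iff.2 (by linarith)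
    linarith

/-- Applied to the value `φ` of the characteristic function of one summand, with `w = v t² / 2` and
`r = β |t|^{2+δ}`, where `v` and `β` are its second and absolute `(2+δ)`-th moments. For `w ≥ 1` the
exponent on the right is nonnegative, so that `‖φ‖ ≤ 1` suffices. -/
lemma norm_le_exp_of_taylor {φ : ℂ} {w r q : ℝ} (hq : 1 ≤ q)
    (hφ : ‖φ‖ ≤ 1) (ht : ‖φ - ((1 - w : ℝ) : ℂ)‖ ≤ 4 * r) (hwr : w ^ q ≤ r) :
    ‖φ‖ ≤ Real.exp (-w + 4 * r) := by
  rcases le_total w 1 with h | h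
  · have h1 : ‖φ‖ ≤ (1 - w) + 4 * r := by
      calc ‖φ‖ ≤ ‖φ - ((1 - w : ℝ) : ℂ)‖ + ‖((1 - w : ℝ) : ℂ)‖ := norm_le_norm_sub_add _ _
        _ ≤ 4 * r + (1 - w) := by
            rw [Complex.norm_real, Real.norm_of_nonneg (by linarith)]; gcongr
        _ = _ := by ring
    linarith [Real.add_one_le_exp (-w + 4 * r)]
  · have : w ^ (1 : ℝ) ≤ w ^ q := Real.rpow_le_rpow_of_exponent_le h hq
    rw [Real.rpow_one] at this
    exact hφ.trans (Real.one_le_exp (by linarith))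

/-- Telescoping of a difference of products; unlike the usual form, it keeps the decay of the
factors through the common bounds `c i`. -/
lemma norm_prod_sub_prod_le {ι : Type*} (s : Finset ι) (a b : ι → ℂ) (c : ι → ℝ)
    (hc : ∀ i, 0 < c i) (ha : ∀ i, ‖a i‖ ≤ c i) (hb : ∀ i, ‖b i‖ ≤ c i) :
    ‖∏ i ∈ s, a i - ∏ i ∈ s, b i‖ ≤ (∏ i ∈ s, c i) * ∑ i ∈ s, ‖a i - b i‖ / c i := by
  classical
  induction s using Finset.induction_on with
  | empty => simp
  | insert j s hj ih =>
    rw [Finset.prod_insert hj, Finset.prod_insert hj, Finset.prod_insert hj, Finset.sum_insert hj]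
    have hA : ‖∏ i ∈ s, a i‖ ≤ ∏ i ∈ s, c i := by
      rw [norm_prod]; exact Finset.prod_le_prod (fun _ _ => norm_nonneg _) fun i _ => ha i
    calc ‖a j * ∏ i ∈ s, a i - b j * ∏ i ∈ s, b i‖
        = ‖(a j - b j) * ∏ i ∈ s, a i + b j * (∏ i ∈ s, a i - ∏ i ∈ s, b i)‖ := by ring_nf
      _ ≤ ‖a j - b j‖ * ∏ i ∈ s, c i + c j * ((∏ i ∈ s, c i) * ∑ i ∈ s, ‖a i - b i‖ / c i) := by
          refine (norm_add_le _ _).trans ?_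
          rw [norm_mul, norm_mul]
          exact add_le_add (mul_le_mul_of_nonneg_left hA (norm_nonneg _))
            (mul_le_mul (hb j) ih (norm_nonneg _) (hc j).le)
      _ = c j * (∏ i ∈ s, c i) * (‖a j - b j‖ / c j + ∑ i ∈ s, ‖a i - b i‖ / c i) := by
          have := (hc j).ne'
          field_simp

/-- The characteristic function of a normalised sum of independent centred variables is close to
the Gaussian one on a range of frequencies governed by the Lyapunov ratio
`L = (∑ β i) / s ^ (2 + δ)`. -/
lemma norm_prod_charFun_sub_le {n : ℕ} (μ : Fin n → Measure ℝ) [∀ i, IsProbabilityMeasure (μ i)]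
    {δ : ℝ} (h0 : 0 < δ) (h1 : δ ≤ 1) (hp : ∀ i, Integrable (fun y => |y| ^ (2 + δ)) (μ i))
    (hm : ∀ i, ∫ y, y ∂(μ i) = 0) {s L : ℝ} (hs : 0 < s) (hs2 : ∑ i, ∫ y, y ^ 2 ∂(μ i) = s ^ 2)
    (hL : (∑ i, ∫ y, |y| ^ (2 + δ) ∂(μ i)) / s ^ (2 + δ) = L) (hL32 : L ≤ 1 / 32) {t : ℝ}
    (ht : L * |t| ^ δ ≤ 1 / 32) :
    ‖∏ i, charFun (μ i) (t / s) - Complex.exp (-(t : ℂ) ^ 2 / 2)‖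
      ≤ 5 * L * |t| ^ (2 + δ) * Real.exp (-t ^ 2 / 4) := by
  set v : Fin n → ℝ := fun i => ∫ y, y ^ 2 ∂(μ i) with hv
  set β : Fin n → ℝ := fun i => ∫ y, |y| ^ (2 + δ) ∂(μ i) with hβ
  have hv0 : ∀ i, 0 ≤ v i := fun i => integral_nonneg fun y => sq_nonneg y
  have hβ0 : ∀ i, 0 ≤ β i := fun i => integral_nonneg fun y => by positivity
  have hsp : 0 < s ^ (2 + δ) := by positivity
  have hLs : ∑ i, β i = L * s ^ (2 + δ) := by rw [← hL]; field_simp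
  have hvβ : ∀ i, v i ^ ((2 + δ) / 2) ≤ β i := fun i => integral_sq_rpow_le h0 (hp i)
  set w : Fin n → ℝ := fun i => v i * (t / s) ^ 2 / 2 with hw
  set r : Fin n → ℝ := fun i => β i * |t / s| ^ (2 + δ) with hr
  have hw0 : ∀ i, 0 ≤ w i := fun i => by have := hv0 i; positivity
  have hr0 : ∀ i, 0 ≤ r i := fun i => by have := hβ0 i; positivity
  have hsw : ∑ i, w i = t ^ 2 / 2 := by
    rw [hw]
    simp_rw [mul_div_assoc]
    rw [← Finset.sum_mul, hs2]; field_simp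
  have hsr : ∑ i, r i = L * |t| ^ (2 + δ) := by
    rw [hr, ← Finset.sum_mul, hLs, abs_div, abs_of_pos hs,
      Real.div_rpow (abs_nonneg _) hs.le]
    field_simp
  have hwr : ∀ i, w i ^ ((2 + δ) / 2) ≤ r i := fun i => by
    have h2 : w i ≤ v i * (t / s) ^ 2 := by
      have := hv0 i
      simp only [hw]; have : 0 ≤ v i * (t / s) ^ 2 := by positivity
      linarith
    calc w i ^ ((2 + δ) / 2) ≤ (v i * (t / s) ^ 2) ^ ((2 + δ) / 2) :=
          Real.rpow_le_rpow (hw0 i) h2 (by linarith)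
      _ = v i ^ ((2 + δ) / 2) * |t / s| ^ (2 + δ) := by
          rw [Real.mul_rpow (hv0 i) (sq_nonneg _), ← sq_abs, ← Real.rpow_natCast |t / s|,
            ← Real.rpow_mul (abs_nonneg _)]
          congr 2
          push_cast; ring
      _ ≤ r i := by simp only [hr]; gcongr; exact hvβ i
  have htay : ∀ i, ‖charFun (μ i) (t / s) - ((1 - w i : ℝ) : ℂ)‖ ≤ 4 * r i := fun i => by
    have := norm_charFun_sub_taylor_le h0 h1 (hp i) (hm i) (t / s)
    simpa only [hw, hr, hv, hβ, mul_assoc, mul_div_assoc] using this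
  have hgau : ∀ i, |Real.exp (-w i) - (1 - w i)| ≤ r i := fun i =>
    (abs_exp_neg_sub_taylor_le (hw0 i) (by linarith) (by linarith)).trans (hwr i)
  have hprodexp : Complex.exp (-(t : ℂ) ^ 2 / 2) = ∏ i, ((Real.exp (-w i) : ℝ) : ℂ) := by
    rw [← Complex.ofReal_prod, ← Real.exp_sum, Finset.sum_neg_distrib, hsw]
    push_cast; ring_nf
  rw [hprodexp]
  have key := norm_prod_sub_prod_le Finset.univ (fun i => charFun (μ i) (t / s))
    (fun i => ((Real.exp (-w i) : ℝ) : ℂ)) (fun i => Real.exp (-w i + 4 * r i))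
    (fun i => Real.exp_pos _)
    (fun i => norm_le_exp_of_taylor (by linarith) (norm_charFun_le_one _) (htay i) (hwr i))
    (fun i => by
      rw [Complex.norm_real, Real.norm_of_nonneg (Real.exp_pos _).le]
      exact Real.exp_le_exp.2 (by linarith [hr0 i]))
  refine key.trans ?_
  have hrt : L * |t| ^ (2 + δ) ≤ t ^ 2 / 32 := by
    rcases eq_or_ne t 0 with rfl | h'
    · simp [Real.zero_rpow (show 2 + δ ≠ 0 by linarith)]
    · rw [Real.rpow_add (abs_pos.2 h'), Real.rpow_two, sq_abs]
      nlinarith [sq_nonneg t]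
  -- no single summand carries more than a quarter of the variance
  have hw4 : ∀ i, w i ≤ t ^ 2 / 8 := fun i => by
    have hvi : v i ≤ s ^ 2 / 4 := by
      by_contra! hcon
      have h3 : (s ^ 2 / 4) ^ ((2 + δ) / 2) < v i ^ ((2 + δ) / 2) :=
        Real.rpow_lt_rpow (by positivity) hcon (by linarith)
      have h4 : v i ^ ((2 + δ) / 2) ≤ L * s ^ (2 + δ) := by
        rw [← hLs]
        exact (hvβ i).trans (Finset.single_le_sum (fun j _ => hβ0 j) (Finset.mem_univ i))
      have h5 : (s ^ 2 / 4) ^ ((2 + δ) / 2) = s ^ (2 + δ) * (1 / 2) ^ (2 + δ) := by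
        rw [show s ^ 2 / 4 = (s * (1 / 2)) ^ 2 by ring, ← Real.rpow_natCast,
          ← Real.rpow_mul (by positivity), ← Real.mul_rpow hs.le (by norm_num)]
        congr 1; push_cast; ring
      have h6 : (1 / 2 : ℝ) ^ (3 : ℝ) ≤ (1 / 2) ^ (2 + δ) :=
        Real.rpow_le_rpow_of_exponent_ge (by norm_num) (by norm_num) (by linarith)
      have h7 : (1 / 2 : ℝ) ^ (3 : ℝ) = 1 / 8 := by
        rw [show (3 : ℝ) = ((3 : ℕ) : ℝ) by norm_num, Real.rpow_natCast]; norm_num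
      rw [h5] at h3
      nlinarith
    have : w i = v i * t ^ 2 / (2 * s ^ 2) := by simp only [hw]; field_simp
    rw [this, div_le_iff₀ (by positivity)]
    nlinarith [sq_nonneg t]
  have hterm : ∀ i, ‖charFun (μ i) (t / s) - ((Real.exp (-w i) : ℝ) : ℂ)‖
      / Real.exp (-w i + 4 * r i) ≤ 5 * r i * Real.exp (t ^ 2 / 8) := fun i => by
    have hd : ‖charFun (μ i) (t / s) - ((Real.exp (-w i) : ℝ) : ℂ)‖ ≤ 5 * r i := by
      calc _ ≤ ‖charFun (μ i) (t / s) - ((1 - w i : ℝ) : ℂ)‖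
            + ‖((1 - w i : ℝ) : ℂ) - ((Real.exp (-w i) : ℝ) : ℂ)‖ :=
              norm_sub_le_norm_sub_add_norm_sub _ _ _
        _ ≤ 4 * r i + r i := by
            refine add_le_add (htay i) ?_
            rw [← Complex.ofReal_sub, Complex.norm_real, Real.norm_eq_abs, abs_sub_comm]
            exact hgau i
        _ = 5 * r i := by ring
    rw [div_eq_mul_inv, ← Real.exp_neg]
    have := hr0 i
    refine mul_le_mul hd (Real.exp_le_exp.2 ?_) (Real.exp_pos _).le (by positivity)
    linarith [hw4 i]
  calc _ ≤ (∏ i, Real.exp (-w i + 4 * r i)) * ∑ i, 5 * r i * Real.exp (t ^ 2 / 8) := by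
        refine mul_le_mul_of_nonneg_left (Finset.sum_le_sum fun i _ => hterm i) ?_
        exact Finset.prod_nonneg fun i _ => (Real.exp_pos _).le
    _ = 5 * (L * |t| ^ (2 + δ))
          * Real.exp (-(t ^ 2 / 2) + 4 * (L * |t| ^ (2 + δ)) + t ^ 2 / 8) := by
        rw [← Real.exp_sum, Finset.sum_add_distrib, Finset.sum_neg_distrib, ← Finset.mul_sum,
          hsw, hsr, ← Finset.sum_mul, ← Finset.mul_sum, hsr, Real.exp_add _ (t ^ 2 / 8)]
        ring
    _ ≤ _ := by
        have hL0 : 0 ≤ L * |t| ^ (2 + δ) := hsr ▸ Finset.sum_nonneg fun i _ => hr0 i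
        rw [show 5 * L * |t| ^ (2 + δ) = 5 * (L * |t| ^ (2 + δ)) by ring]
        refine mul_le_mul_of_nonneg_left (Real.exp_le_exp.2 ?_) (by positivity)
        linarith

/-! ### Esseen's smoothing inequality -/

/-- The Fejér kernel `2 (1 - cos u) / u²`, defined through its Fourier transform, the triangle
function. It is not normalised: only the positivity of its integral is ever needed. -/
noncomputable def fejer (u : ℝ) : ℝ := 2 * ∫ t in (0 : ℝ)..1, (1 - t) * Real.cos (t * u)

lemma fejer_eq {u : ℝ} (hu : u ≠ 0) : fejer u = 2 * (1 - Real.cos u) / u ^ 2 := by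
  have h : ∀ t ∈ Set.uIcc (0 : ℝ) 1,
      HasDerivAt (fun t => (1 - t) * (Real.sin (t * u) / u) - Real.cos (t * u) / u ^ 2)
        ((1 - t) * Real.cos (t * u)) t := fun t _ => by
    have h1 : HasDerivAt (fun t : ℝ => t * u) u t := by simpa using (hasDerivAt_id t).mul_const u
    have h2 := ((hasDerivAt_id t).const_sub 1).mul (h1.sin.div_const u)
    have h3 := h2.sub (h1.cos.div_const (u ^ 2))
    convert! h3 using 1
    simp
    field_simp
    ring
  rw [fejer, intervalIntegral.integral_eq_sub_of_hasDerivAt h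
    (Continuous.intervalIntegrable (by fun_prop) _ _)]
  simp
  ring

lemma continuous_fejer : Continuous fejer := by
  unfold fejer
  refine continuous_const.mul ?_
  exact intervalIntegral.continuous_parametric_intervalIntegral_of_continuous' (by fun_prop) 0 1

lemma fejer_zero : fejer 0 = 1 := by
  have : ∀ t ∈ Set.uIcc (0 : ℝ) 1, HasDerivAt (fun t : ℝ => t - t ^ 2 / 2) (1 - t) t :=
    fun t _ => by
      convert! (hasDerivAt_id t).sub (((hasDerivAt_id t).pow 2).div_const 2) using 1
      simp
  simp only [fejer, mul_zero, Real.cos_zero, mul_one]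
  rw [intervalIntegral.integral_eq_sub_of_hasDerivAt this
    (Continuous.intervalIntegrable (by fun_prop) _ _)]
  norm_num

lemma fejer_nonneg (u : ℝ) : 0 ≤ fejer u := by
  rcases eq_or_ne u 0 with rfl | hu
  · rw [fejer_zero]; norm_num
  · rw [fejer_eq hu]
    have := Real.cos_le_one u
    exact div_nonneg (by linarith) (sq_nonneg _)

lemma fejer_le_one (u : ℝ) : fejer u ≤ 1 := by
  rcases eq_or_ne u 0 with rfl | hu
  · rw [fejer_zero]
  · rw [fejer_eq hu, div_le_one (by positivity)]
    have := Real.one_sub_sq_div_two_le_cos (x := u)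
    linarith

lemma fejer_mul_sq_le (u : ℝ) : fejer u * u ^ 2 ≤ 4 := by
  rcases eq_or_ne u 0 with rfl | hu
  · norm_num
  · rw [fejer_eq hu, div_mul_cancel₀ _ (by positivity)]
    linarith [Real.neg_one_le_cos u]

lemma integrable_fejer : Integrable fejer := by
  refine (integrable_inv_one_add_sq.const_mul 5).mono' continuous_fejer.aestronglyMeasurable
    (ae_of_all _ fun u => ?_)
  rw [Real.norm_of_nonneg (fejer_nonneg u), ← div_eq_mul_inv, le_div_iff₀ (by positivity)]
  linarith [fejer_le_one u, fejer_mul_sq_le u]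

lemma integral_fejer_pos : 0 < ∫ u, fejer u := by
  rw [integral_pos_iff_support_of_nonneg fejer_nonneg integrable_fejer]
  exact (continuous_fejer.isOpen_support).measure_pos _ ⟨0, by simp [fejer_zero]⟩

lemma integral_intervalIntegral_swap (μ : Measure ℝ) [IsFiniteMeasure μ] {F : ℝ → ℝ → ℝ}
    (hF : Continuous (Function.uncurry F)) {a b C : ℝ} (hab : a ≤ b)
    (hC : ∀ w, ∀ t ∈ Set.Ioc a b, |F w t| ≤ C) :
    ∫ w, (∫ t in a..b, F w t) ∂μ = ∫ t in a..b, ∫ w, F w t ∂μ := by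
  simp only [intervalIntegral.integral_of_le hab]
  refine integral_integral_swap (μ := μ) (ν := volume.restrict (Set.Ioc a b)) ?_
  refine (integrable_const C).mono' hF.aestronglyMeasurable ?_
  have : μ.prod (volume.restrict (Set.Ioc a b))
      = (μ.prod volume).restrict (Set.univ ×ˢ Set.Ioc a b) := by
    rw [← Measure.prod_restrict, Measure.restrict_univ]
  rw [this]
  filter_upwards [ae_restrict_mem (MeasurableSet.univ.prod measurableSet_Ioc)] with p hp
  exact hC _ _ hp.2

lemma re_charFun_neg_mul (μ : Measure ℝ) [IsProbabilityMeasure μ] (t v : ℝ) :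
    ∫ w, Real.cos (t * (v - w)) ∂μ = (charFun μ (-t) * Complex.exp (t * v * Complex.I)).re := by
  rw [charFun_apply_real, ← integral_mul_const]
  have hi : Integrable (fun w : ℝ => Complex.exp (((-t : ℝ) : ℂ) * w * Complex.I)
      * Complex.exp (t * v * Complex.I)) μ := by
    refine (integrable_const (1 : ℝ)).mono' (by fun_prop) (ae_of_all _ fun w => ?_)
    have h1 := Complex.norm_exp_ofReal_mul_I (-t * w)
    have h2 := Complex.norm_exp_ofReal_mul_I (t * v)
    push_cast at h1 h2 ⊢
    rw [norm_mul, h1, h2, mul_one]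
  have := integral_re hi
  simp only [RCLike.re_to_complex] at this
  rw [← this]
  refine integral_congr_ae (ae_of_all _ fun w => ?_)
  simp only
  rw [← Complex.exp_add, ← Complex.exp_ofReal_mul_I_re]
  congr 2
  push_cast
  ring

/-- The Fejér kernel cuts the characteristic function off outside `[-1, 1]`. -/
lemma integral_fejer_sub_eq (μ : Measure ℝ) [IsProbabilityMeasure μ] (v : ℝ) :
    ∫ w, fejer (v - w) ∂μ
      = 2 * ∫ t in (0 : ℝ)..1,
          (1 - t) * (charFun μ (-t) * Complex.exp (t * v * Complex.I)).re := by
  simp only [fejer]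
  rw [integral_const_mul, integral_intervalIntegral_swap μ (C := 1)
    (F := fun w t => (1 - t) * Real.cos (t * (v - w))) (by fun_prop) zero_le_one]
  · congr 1
    refine intervalIntegral.integral_congr fun t _ => ?_
    rw [integral_const_mul, re_charFun_neg_mul]
  · intro w t ht
    rw [abs_mul]
    have h1 := Real.abs_cos_le_one (t * (v - w))
    have h2 : |1 - t| ≤ 1 := by rw [abs_le]; constructor <;> linarith [ht.1, ht.2]
    nlinarith [abs_nonneg (1 - t), abs_nonneg (Real.cos (t * (v - w)))]

lemma norm_intervalIntegral_cexp_le {t : ℝ} (ht : 0 < t) (z x : ℝ) :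
    ‖∫ v in z..x, Complex.exp (t * v * Complex.I)‖ ≤ 2 / t := by
  have hc : (t * Complex.I : ℂ) ≠ 0 := by simp [ht.ne']
  have h := integral_exp_mul_complex (a := z) (b := x) hc
  have e : ∀ v : ℝ, Complex.exp (t * v * Complex.I) = Complex.exp (t * Complex.I * v) :=
    fun v => by ring_nf
  simp_rw [e, h]
  rw [norm_div]
  have hn : ‖(t * Complex.I : ℂ)‖ = t := by simp [abs_of_pos ht]
  rw [hn]
  gcongr
  have h1 : ∀ y : ℝ, ‖Complex.exp (t * Complex.I * y)‖ = 1 := fun y => by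
    rw [← e, ← Complex.ofReal_mul, Complex.norm_exp_ofReal_mul_I]
  calc _ ≤ ‖Complex.exp (t * Complex.I * x)‖ + ‖Complex.exp (t * Complex.I * z)‖ := norm_sub_le _ _
    _ = 2 := by rw [h1, h1]; norm_num

lemma integral_integral_fejer_sub_eq (μ : Measure ℝ) [IsProbabilityMeasure μ] {z x : ℝ}
    (hzx : z ≤ x) :
    ∫ v in z..x, ∫ w, fejer (v - w) ∂μ
      = 2 * ∫ t in (0 : ℝ)..1, (1 - t) *
          (charFun μ (-t) * ∫ v in z..x, Complex.exp (t * v * Complex.I)).re := by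
  simp_rw [integral_fejer_sub_eq]
  rw [intervalIntegral.integral_const_mul]
  congr 1
  have hφ : Continuous (charFun μ) := continuous_charFun
  rw [intervalIntegral_intervalIntegral_swap]
  · refine intervalIntegral.integral_congr fun t _ => ?_
    have hi : IntervalIntegrable (fun v : ℝ => charFun μ (-t) * Complex.exp (t * v * Complex.I))
        volume z x := Continuous.intervalIntegrable (by fun_prop) _ _
    have := intervalIntegral.intervalIntegral_re hi
    rw [intervalIntegral.integral_const_mul] at this
    simp only [RCLike.re_to_complex] at this
    rw [intervalIntegral.integral_const_mul, this]
  · rw [Set.uIoc_of_le hzx, Set.uIoc_of_le zero_le_one]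
    have hc : Continuous (Function.uncurry fun v t : ℝ =>
        (1 - t) * (charFun μ (-t) * Complex.exp (t * v * Complex.I)).re) := by
      unfold Function.uncurry
      fun_prop
    have := hc.continuousOn (s := Set.Icc z x ×ˢ Set.Icc 0 1)
    have := (this.integrableOn_compact (μ := volume.prod volume) (isCompact_Icc.prod isCompact_Icc))
    rw [← Measure.volume_eq_prod] at this
    exact this.mono_set (Set.prod_mono Set.Ioc_subset_Icc_self Set.Ioc_subset_Icc_self)

lemma measureReal_Ioc_eq_cdf_sub (μ : Measure ℝ) [IsProbabilityMeasure μ] {a b : ℝ} (hab : a ≤ b) :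
    μ.real (Set.Ioc a b) = cdf μ b - cdf μ a := by
  rw [cdf_eq_real, cdf_eq_real, ← Set.Iic_union_Ioc_eq_Iic hab,
    measureReal_union (Set.Iic_disjoint_Ioc le_rfl) measurableSet_Ioc]
  ring

lemma integral_fejer_mul_cdf_sub (μ : Measure ℝ) [IsProbabilityMeasure μ] {z x : ℝ}
    (hzx : z ≤ x) :
    ∫ u, fejer u * (cdf μ (x - u) - cdf μ (z - u)) = ∫ v in z..x, ∫ w, fejer (v - w) ∂μ := by
  have hind : ∀ u : ℝ, cdf μ (x - u) - cdf μ (z - u)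
      = ∫ w, (Set.Ioc z x).indicator (fun _ => (1 : ℝ)) (w + u) ∂μ := fun u => by
    rw [← measureReal_Ioc_eq_cdf_sub μ (by linarith), ← integral_indicator_one measurableSet_Ioc]
    refine integral_congr_ae (ae_of_all _ fun w => ?_)
    simp only [Set.indicator_apply, Set.mem_Ioc, Pi.one_apply, sub_lt_iff_lt_add, le_sub_iff_add_le]
  simp_rw [hind, ← integral_const_mul]
  have hmeas : Measurable (Function.uncurry fun u w : ℝ =>
      (Set.Ioc z x).indicator (fun _ => (1 : ℝ)) (w + u)) :=
    (measurable_const.indicator measurableSet_Ioc).comp (measurable_snd.add measurable_fst)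
  rw [integral_integral_swap]
  · rw [← integral_intervalIntegral_swap μ (C := 1)
      (F := fun w v => fejer (v - w)) (continuous_fejer.comp (by fun_prop)) hzx]
    · refine integral_congr_ae (ae_of_all _ fun w => ?_)
      simp only
      rw [← integral_sub_right_eq_self (fun u => fejer u *
        (Set.Ioc z x).indicator (fun _ => (1 : ℝ)) (w + u)) w, intervalIntegral.integral_of_le hzx,
        ← integral_indicator measurableSet_Ioc]
      refine integral_congr_ae (ae_of_all _ fun v => ?_)
      simp only [Set.indicator_apply, add_sub_cancel, mul_ite, mul_one, mul_zero]
    · intro w t _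
      rw [abs_of_nonneg (fejer_nonneg _)]
      exact fejer_le_one _
  · have h1 : Integrable (fun p : ℝ × ℝ => fejer p.1) (volume.prod μ) :=
      integrable_fejer.comp_fst μ
    refine h1.mono' ?_ (ae_of_all _ fun p => ?_)
    · exact (continuous_fejer.measurable.comp measurable_fst).aestronglyMeasurable.mul
        hmeas.aestronglyMeasurable
    · simp only [Function.uncurry, Set.indicator_apply]
      split_ifs <;> simp [abs_of_nonneg (fejer_nonneg p.1), fejer_nonneg]

lemma measurable_cdf (μ : Measure ℝ) : Measurable (cdf μ) := (monotone_cdf μ).measurable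

lemma abs_cdf_sub_le_one (μ ν : Measure ℝ) (x : ℝ) : |cdf μ x - cdf ν x| ≤ 1 := by
  rw [abs_le]
  constructor <;> linarith [cdf_nonneg μ x, cdf_nonneg ν x, cdf_le_one μ x, cdf_le_one ν x]

lemma integrable_fejer_mul {f : ℝ → ℝ} (hf : Measurable f) {C : ℝ} (hC : ∀ x, |f x| ≤ C) :
    Integrable fun u => fejer u * f u :=
  integrable_fejer.mul_bdd (c := C) hf.aestronglyMeasurable (ae_of_all _ hC)

/-- The Fejér-smoothed difference of two distribution functions is controlled by the
difference of the characteristic functions on `(0, 1]`. -/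
lemma abs_integral_fejer_mul_cdf_sub_le (μ ν : Measure ℝ) [IsProbabilityMeasure μ]
    [IsProbabilityMeasure ν] {b : ℝ → ℝ} (hb : IntervalIntegrable b volume 0 1)
    (hφ : ∀ t ∈ Set.Ioc (0 : ℝ) 1, ‖charFun μ t - charFun ν t‖ ≤ t * b t) (x : ℝ) :
    |∫ u, fejer u * (cdf μ (x - u) - cdf ν (x - u))| ≤ 4 * ∫ t in (0 : ℝ)..1, b t := by
  have hmD : Measurable fun x => cdf μ x - cdf ν x := (measurable_cdf μ).sub (measurable_cdf ν)
  have hiD : ∀ y, Integrable fun u => fejer u * (cdf μ (y - u) - cdf ν (y - u)) := fun y =>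
    integrable_fejer_mul (hmD.comp (measurable_const.sub measurable_id))
      (fun u => abs_cdf_sub_le_one μ ν (y - u))
  have hfin : ∀ z, z ≤ x → |(∫ u, fejer u * (cdf μ (x - u) - cdf ν (x - u)))
      - ∫ u, fejer u * (cdf μ (z - u) - cdf ν (z - u))| ≤ 4 * ∫ t in (0 : ℝ)..1, b t := by
    intro z hz
    have hcdf : ∀ (ρ : Measure ℝ) (y : ℝ), Integrable fun u => fejer u * cdf ρ (y - u) :=
      fun ρ y => integrable_fejer_mul (C := 1)
        ((measurable_cdf ρ).comp (measurable_const.sub measurable_id)) (fun u => by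
          rw [abs_of_nonneg (cdf_nonneg _ _)]; exact cdf_le_one _ _)
    have hE : Continuous fun t : ℝ => ∫ v in z..x, Complex.exp (t * v * Complex.I) :=
      intervalIntegral.continuous_parametric_intervalIntegral_of_continuous' (by fun_prop) z x
    have hc : ∀ ρ : Measure ℝ, IsProbabilityMeasure ρ → IntervalIntegrable (fun t : ℝ => (1 - t) *
        (charFun ρ (-t) * ∫ v in z..x, Complex.exp (t * v * Complex.I)).re) volume 0 1 :=
      fun ρ _ => Continuous.intervalIntegrable (by
        have : Continuous (charFun ρ) := continuous_charFun
        fun_prop) _ _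
    have e1 : (∫ u, fejer u * (cdf μ (x - u) - cdf ν (x - u)))
        - ∫ u, fejer u * (cdf μ (z - u) - cdf ν (z - u))
        = (∫ u, fejer u * (cdf μ (x - u) - cdf μ (z - u)))
          - ∫ u, fejer u * (cdf ν (x - u) - cdf ν (z - u)) := by
      simp_rw [mul_sub]
      rw [integral_sub (hcdf _ _) (hcdf _ _), integral_sub (hcdf _ _) (hcdf _ _),
        integral_sub (hcdf _ _) (hcdf _ _), integral_sub (hcdf _ _) (hcdf _ _)]
      ring
    rw [e1, integral_fejer_mul_cdf_sub μ hz, integral_fejer_mul_cdf_sub ν hz,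
      integral_integral_fejer_sub_eq μ hz, integral_integral_fejer_sub_eq ν hz, ← mul_sub,
      ← intervalIntegral.integral_sub (hc μ inferInstance) (hc ν inferInstance), abs_mul,
      abs_of_pos (two_pos), show (4 : ℝ) * ∫ t in (0 : ℝ)..1, b t
        = 2 * ∫ t in (0 : ℝ)..1, 2 * b t by rw [intervalIntegral.integral_const_mul]; ring]
    gcongr
    rw [← Real.norm_eq_abs]
    refine intervalIntegral.norm_integral_le_of_norm_le zero_le_one
      (ae_of_all _ fun t ht => ?_) (hb.const_mul 2)
    have hψ : ‖charFun μ (-t) - charFun ν (-t)‖ ≤ t * b t := by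
      rw [charFun_neg, charFun_neg, ← map_sub, Complex.norm_conj]
      exact hφ t ht
    have h1 : |1 - t| ≤ 1 := by rw [abs_le]; constructor <;> linarith [ht.1, ht.2]
    rw [← mul_sub, ← Complex.sub_re, ← sub_mul, norm_mul, Real.norm_eq_abs, Real.norm_eq_abs]
    have h2 : |((charFun μ (-t) - charFun ν (-t))
        * ∫ v in z..x, Complex.exp (t * v * Complex.I)).re| ≤ t * b t * (2 / t) := by
      refine (Complex.abs_re_le_norm _).trans ?_
      rw [norm_mul]
      exact mul_le_mul hψ (norm_intervalIntegral_cexp_le ht.1 z x) (norm_nonneg _)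
        ((norm_nonneg _).trans hψ)
    have h3 : t * b t * (2 / t) = 2 * b t := by have := ht.1.ne'; field_simp
    rw [h3] at h2
    calc _ ≤ 1 * (2 * b t) := mul_le_mul h1 h2 (abs_nonneg _) zero_le_one
      _ = _ := one_mul _
  have hlim : Tendsto (fun z => ∫ u, fejer u * (cdf μ (z - u) - cdf ν (z - u))) atBot
      (nhds (∫ u, fejer u * ((0 : ℝ) - 0))) := by
    refine tendsto_integral_filter_of_dominated_convergence (fun u => fejer u * 1)
      (Eventually.of_forall fun z => (hiD z).aestronglyMeasurable)
      (Eventually.of_forall fun z => ae_of_all _ fun u => ?_) (integrable_fejer.mul_const 1)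
      (ae_of_all _ fun u => ?_)
    · rw [norm_mul, Real.norm_of_nonneg (fejer_nonneg u)]
      exact mul_le_mul_of_nonneg_left (abs_cdf_sub_le_one μ ν _) (fejer_nonneg u)
    · have hz : Tendsto (fun z : ℝ => z - u) atBot atBot := tendsto_atBot_add_const_right _ _
        tendsto_id
      exact (((tendsto_cdf_atBot μ).comp hz).sub ((tendsto_cdf_atBot ν).comp hz)).const_mul _
  simp only [sub_self, mul_zero, integral_zero] at hlim
  have h4 := (tendsto_const_nhds (x := ∫ u, fejer u * (cdf μ (x - u) - cdf ν (x - u)))).sub hlim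
  rw [sub_zero] at h4
  exact le_of_tendsto h4.abs ((eventually_le_atBot x).mono hfin)

lemma integral_inv_sq_add_sq {a : ℝ} (ha : 0 < a) :
    Integrable (fun u : ℝ => (a ^ 2 + u ^ 2)⁻¹) ∧ ∫ u : ℝ, (a ^ 2 + u ^ 2)⁻¹ = Real.pi / a := by
  have e : ∀ u : ℝ, (a ^ 2 + u ^ 2)⁻¹ = (a ^ 2)⁻¹ * (1 + (u / a) ^ 2)⁻¹ := fun u => by
    rw [← mul_inv]; congr 1; field_simp
  simp_rw [e]
  refine ⟨(integrable_inv_one_add_sq.comp_div ha.ne').const_mul _, ?_⟩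
  rw [integral_const_mul, Measure.integral_comp_div (fun u => (1 + u ^ 2)⁻¹),
    integral_univ_inv_one_add_sq, smul_eq_mul, abs_of_pos ha]
  field_simp

/-- If `|D| ≤ Δ` everywhere and `D ≥ Δ/2` on a window of radius `a`, then smoothing at the
centre of the window keeps a fixed proportion of `Δ`, up to the tail of the kernel. -/
lemma le_integral_fejer_mul {D : ℝ → ℝ} (hD : Measurable D) {Δ a : ℝ} (ha : 0 < a)
    (hb : ∀ x, |D x| ≤ Δ) (hw : ∀ u, |u| ≤ a → Δ / 2 ≤ D u) :
    Δ / 2 * (∫ u, fejer u) - 12 * Δ * (Real.pi / a) ≤ ∫ u, fejer u * D u := by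
  obtain ⟨hi, he⟩ := integral_inv_sq_add_sq ha
  have hΔ : 0 ≤ Δ := (abs_nonneg _).trans (hb 0)
  rw [← he, ← integral_const_mul, ← integral_const_mul,
    ← integral_sub (integrable_fejer.const_mul _) (hi.const_mul _)]
  refine integral_mono ((integrable_fejer.const_mul _).sub (hi.const_mul _))
    (integrable_fejer_mul hD hb) fun u => ?_
  have hf := fejer_nonneg u
  have hpos : 0 < (a ^ 2 + u ^ 2)⁻¹ := by positivity
  simp only
  rcases le_or_gt |u| a with h | h
  · have := mul_le_mul_of_nonneg_left (hw u h) hf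
    have : 0 ≤ 12 * Δ * (a ^ 2 + u ^ 2)⁻¹ := by positivity
    linarith
  · have h1 : -Δ ≤ D u := (abs_le.1 (hb u)).1
    have h2 : fejer u ≤ 8 * (a ^ 2 + u ^ 2)⁻¹ := by
      rw [← div_eq_mul_inv, le_div_iff₀ (by positivity)]
      have h3 : a ^ 2 ≤ u ^ 2 := by rw [← sq_abs u]; exact pow_le_pow_left₀ ha.le h.le 2
      have := fejer_mul_sq_le u
      nlinarith
    have h4 := mul_le_mul_of_nonneg_left h1 hf
    have h5 := mul_le_mul_of_nonneg_left h2 hΔ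
    nlinarith

/-- **Esseen's smoothing inequality**, with an unspecified constant. -/
theorem exists_smoothing_bound : ∃ C : ℝ, 0 < C ∧ ∀ (μ ν : Measure ℝ),
    IsProbabilityMeasure μ → IsProbabilityMeasure ν → ∀ (m : ℝ), 0 < m →
    (∀ x y, x ≤ y → cdf ν y - cdf ν x ≤ m * (y - x)) →
    ∀ b : ℝ → ℝ, IntervalIntegrable b volume 0 1 →
    (∀ t ∈ Set.Ioc (0 : ℝ) 1, ‖charFun μ t - charFun ν t‖ ≤ t * b t) →
    ∀ x, |cdf μ x - cdf ν x| ≤ C * ((∫ t in (0 : ℝ)..1, b t) + m) := by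
  set c := ∫ u, fejer u with hc
  have hc0 : 0 < c := integral_fejer_pos
  refine ⟨2 / c * 400, by positivity, fun μ ν _ _ m hm hlip b hb hφ x => ?_⟩
  set D : ℝ → ℝ := fun x => cdf μ x - cdf ν x with hDdef
  have hDm : Measurable D := (measurable_cdf μ).sub (measurable_cdf ν)
  have hbdd : BddAbove (Set.range fun x => |D x|) :=
    ⟨1, by rintro _ ⟨y, rfl⟩; exact abs_cdf_sub_le_one μ ν y⟩
  set Δ := ⨆ x, |D x| with hΔ
  have hle : ∀ y, |D y| ≤ Δ := fun y => le_ciSup hbdd y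
  have hη : 0 ≤ ∫ t in (0 : ℝ)..1, b t := by
    have := (abs_nonneg _).trans (abs_integral_fejer_mul_cdf_sub_le μ ν hb hφ 0)
    linarith
  set η := ∫ t in (0 : ℝ)..1, b t
  refine (hle x).trans ?_
  rcases (le_trans (abs_nonneg _) (hle 0)).eq_or_lt with h0 | h0
  · rw [← h0]; positivity
  -- `|D|` is almost `Δ` at some `x₀`; by monotonicity of one distribution function and the
  -- Lipschitz bound of the other it stays above `Δ / 2` on an interval of length `Δ / (4 m)`
  -- beginning at `x₀` (or ending there, depending on the sign of `D x₀`)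
  have key : Δ / 2 * c - 12 * Δ * (Real.pi / (Δ / (8 * m))) ≤ 4 * η := by
    obtain ⟨x₀, hx₀⟩ := exists_lt_of_lt_ciSup (show 3 / 4 * Δ < ⨆ x, |D x| by rw [← hΔ]; linarith)
    have ha : 0 < Δ / (8 * m) := by positivity
    have ham : Δ / (8 * m) * m = Δ / 8 := by field_simp
    rcases lt_abs.1 hx₀ with h | h
    · -- `D` stays large to the right of `x₀`, where `cdf μ` can only grow
      have hs := abs_integral_fejer_mul_cdf_sub_le μ ν hb hφ (x₀ + Δ / (8 * m))
      refine le_trans (le_integral_fejer_mul (D := fun u => D (x₀ + Δ / (8 * m) - u))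
        (hDm.comp (measurable_const.sub measurable_id)) ha (fun u => hle _) fun u hu => ?_)
        ((le_abs_self _).trans hs)
      have hu' := abs_le.1 hu
      have h1 := hlip x₀ (x₀ + Δ / (8 * m) - u) (by linarith)
      have h2 := monotone_cdf μ (show x₀ ≤ x₀ + Δ / (8 * m) - u by linarith)
      have h3 : m * (x₀ + Δ / (8 * m) - u - x₀) ≤ Δ / 4 := by nlinarith
      simp only [hDdef] at h ⊢
      linarith
    · have hs := abs_integral_fejer_mul_cdf_sub_le μ ν hb hφ (x₀ - Δ / (8 * m))
      refine le_trans (le_integral_fejer_mul (D := fun u => -D (x₀ - Δ / (8 * m) - u))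
        (hDm.comp (measurable_const.sub measurable_id)).neg ha
        (fun u => by rw [abs_neg]; exact hle _) fun u hu => ?_)
        (le_trans (le_of_eq ?_) ((neg_le_abs _).trans hs))
      · have hu' := abs_le.1 hu
        have h1 := hlip (x₀ - Δ / (8 * m) - u) x₀ (by linarith)
        have h2 := monotone_cdf μ (show x₀ - Δ / (8 * m) - u ≤ x₀ by linarith)
        have h3 : m * (x₀ - (x₀ - Δ / (8 * m) - u)) ≤ Δ / 4 := by nlinarith
        simp only [hDdef] at h ⊢
        linarith
      · rw [← integral_neg]
        simp only [hDdef, mul_neg]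
  have e : 12 * Δ * (Real.pi / (Δ / (8 * m))) = 96 * Real.pi * m := by field_simp; ring
  rw [e] at key
  have hpi : 96 * Real.pi * m ≤ 400 * m := by
    have := Real.pi_lt_d2
    nlinarith
  rw [div_mul_eq_mul_div, div_mul_eq_mul_div, le_div_iff₀ hc0]
  linarith

/-! ### The Berry–Esseen inequality -/

lemma gaussianPDFReal_std (x : ℝ) :
    gaussianPDFReal 0 1 x = (√(2 * Real.pi))⁻¹ * Real.exp (-x ^ 2 / 2) := by
  simp [gaussianPDFReal]

lemma one_le_sqrt_two_pi : 1 ≤ √(2 * Real.pi) := by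
  rw [Real.one_le_sqrt]; linarith [Real.two_le_pi]

lemma gaussianReal_real_eq_integral (s : Set ℝ) :
    (gaussianReal 0 1).real s = ∫ x in s, gaussianPDFReal 0 1 x := by
  rw [measureReal_def, gaussianReal_apply_eq_integral _ (by norm_num), ENNReal.toReal_ofReal]
  exact integral_nonneg fun x => gaussianPDFReal_nonneg _ _ _

lemma Phi_sub_le {x y : ℝ} (hxy : x ≤ y) : Phi y - Phi x ≤ y - x := by
  rw [Phi, Phi, ← measureReal_Ioc_eq_cdf_sub _ hxy, gaussianReal_real_eq_integral]
  have h : ∀ u, gaussianPDFReal 0 1 u ≤ 1 := fun u => by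
    rw [gaussianPDFReal_std]
    have h1 : (√(2 * Real.pi))⁻¹ ≤ 1 := inv_le_one_of_one_le₀ one_le_sqrt_two_pi
    have h2 : Real.exp (-u ^ 2 / 2) ≤ 1 := Real.exp_le_one_iff.2 (by nlinarith [sq_nonneg u])
    exact mul_le_one₀ h1 (Real.exp_pos _).le h2
  calc ∫ u in Set.Ioc x y, gaussianPDFReal 0 1 u ≤ ∫ _ in Set.Ioc x y, (1 : ℝ) :=
        setIntegral_mono (integrable_gaussianPDFReal 0 1).integrableOn (by simp) h
    _ = y - x := by simp [hxy]

lemma cdf_map_const_mul (μ : Measure ℝ) [IsProbabilityMeasure μ] {c : ℝ} (hc : 0 < c) (x : ℝ) :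
    cdf (μ.map (c * ·)) x = cdf μ (x / c) := by
  have : IsProbabilityMeasure (μ.map (c * ·)) := Measure.isProbabilityMeasure_map (by fun_prop)
  rw [cdf_eq_real, cdf_eq_real, map_measureReal_apply (by fun_prop) measurableSet_Iic]
  congr 1
  ext y
  simp [le_div_iff₀ hc, mul_comm]

/-- A majorant of the characteristic function error whose integral is explicit, the primitive being
an arctangent. -/
lemma rpow_mul_exp_le {δ y : ℝ} (h0 : 0 ≤ δ) (h1 : δ ≤ 1) (hy : 0 < y) :
    y ^ (2 + δ) * Real.exp (-y ^ 2 / 4) ≤ 32 * (y * (1 + y ^ 2)⁻¹) := by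
  have e1 : y ^ (2 + δ) = y * y ^ (1 + δ) := by
    rw [show 2 + δ = 1 + (1 + δ) by ring, Real.rpow_add hy 1, Real.rpow_one]
  have h2 : y ^ (1 + δ) ≤ 1 + y ^ 2 := by
    rcases le_total y 1 with h | h
    · have := Real.rpow_le_one hy.le h (show 0 ≤ 1 + δ by linarith)
      nlinarith
    · have : y ^ (1 + δ) ≤ y ^ (2 : ℝ) := Real.rpow_le_rpow_of_exponent_le h (by linarith)
      rw [Real.rpow_two] at this
      linarith
  have h3 : (1 + y ^ 2) ^ 2 ≤ 32 * Real.exp (y ^ 2 / 4) := by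
    have := Real.quadratic_le_exp_of_nonneg (show 0 ≤ y ^ 2 / 4 by positivity)
    nlinarith [sq_nonneg y, sq_nonneg (y ^ 2)]
  have h4 : (1 + y ^ 2) * Real.exp (-y ^ 2 / 4) ≤ 32 * (1 + y ^ 2)⁻¹ := by
    rw [show -y ^ 2 / 4 = -(y ^ 2 / 4) by ring, Real.exp_neg, ← div_eq_mul_inv, ← div_eq_mul_inv,
      div_le_div_iff₀ (Real.exp_pos _) (by positivity)]
    linarith
  calc y ^ (2 + δ) * Real.exp (-y ^ 2 / 4) ≤ y * ((1 + y ^ 2) * Real.exp (-y ^ 2 / 4)) := by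
        rw [e1, mul_assoc]; gcongr
    _ ≤ y * (32 * (1 + y ^ 2)⁻¹) := by gcongr
    _ = _ := by ring

lemma integral_lorentz_le {T : ℝ} :
    ∫ t in (0 : ℝ)..1, T * (1 + (T * t) ^ 2)⁻¹ ≤ 2 := by
  have h : ∀ t ∈ Set.uIcc (0 : ℝ) 1, HasDerivAt (fun t => Real.arctan (T * t))
      (T * (1 + (T * t) ^ 2)⁻¹) t := fun t _ => by
    have h1 : HasDerivAt (fun t : ℝ => T * t) T t := by simpa using (hasDerivAt_id t).const_mul T
    convert! h1.arctan using 1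
    ring
  rw [intervalIntegral.integral_eq_sub_of_hasDerivAt h (Continuous.intervalIntegrable
    (continuous_const.mul (Continuous.inv₀ (by fun_prop) fun t => by positivity)) _ _)]
  have := Real.arctan_lt_pi_div_two (T * 1)
  simp only [mul_zero, Real.arctan_zero]
  linarith [Real.pi_le_four]

section Moments

variable {Ω : Type*} [MeasurableSpace Ω] {P : Measure Ω}

lemma integrable_rpow_map {X : Ω → ℝ} (hX : Measurable X) {p : ℝ}
    (h : Integrable (fun ω => |X ω| ^ p) P) : Integrable (fun y => |y| ^ p) (P.map X) := by
  rw [integrable_map_measure (Measurable.aestronglyMeasurable (by fun_prop)) hX.aemeasurable]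
  exact h

lemma integral_sq_pos {X : Ω → ℝ} (hn : ¬ ∃ c : ℝ, ∀ᵐ ω ∂P, X ω = c)
    (hi : Integrable (fun ω => X ω ^ 2) P) : 0 < ∫ ω, X ω ^ 2 ∂P := by
  refine lt_of_le_of_ne (integral_nonneg fun ω => sq_nonneg _) fun h => hn ⟨0, ?_⟩
  have := (integral_eq_zero_iff_of_nonneg (fun ω => sq_nonneg (X ω)) hi).1 h.symm
  filter_upwards [this] with ω hω
  simpa using hω

lemma integrable_pow_comp [IsFiniteMeasure P] {X : Ω → ℝ} (hX : Measurable X) {δ : ℝ} (h0 : 0 ≤ δ)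
    (h : Integrable (fun ω => |X ω| ^ (2 + δ)) P) {k : ℕ} (hk : k ≤ 2) :
    Integrable (fun ω => X ω ^ k) P := by
  have := integrable_pow_of_integrable_rpow h0 (integrable_rpow_map hX h) hk
  exact (integrable_map_measure (measurable_id.pow_const k).aestronglyMeasurable
    hX.aemeasurable).1 this

lemma sigma_sq {n : ℕ} (ξ : Fin n → Ω → ℝ) : sigma P ξ ^ 2 = ∑ i, ∫ ω, ξ i ω ^ 2 ∂P :=
  Real.sq_sqrt (Finset.sum_nonneg fun _ _ => integral_nonneg fun _ => sq_nonneg _)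

lemma sigma_pos [IsFiniteMeasure P] {n : ℕ} (hn : 1 ≤ n) {ξ : Fin n → Ω → ℝ}
    (hξ : CenteredIndep P ξ) {δ : ℝ} (h0 : 0 ≤ δ)
    (hp : ∀ i, Integrable (fun ω => |ξ i ω| ^ (2 + δ)) P) : 0 < sigma P ξ := by
  refine Real.sqrt_pos.2 (Finset.sum_pos (fun i _ => ?_) ⟨⟨0, hn⟩, Finset.mem_univ _⟩)
  exact integral_sq_pos (hξ.nondegenerate i)
    (integrable_pow_comp (hξ.measurable i) h0 (hp i) le_rfl)

lemma lyapunovRatio_pos [IsProbabilityMeasure P] {n : ℕ} (hn : 1 ≤ n) {ξ : Fin n → Ω → ℝ}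
    (hξ : CenteredIndep P ξ) {δ : ℝ} (h0 : 0 < δ)
    (hp : ∀ i, Integrable (fun ω => |ξ i ω| ^ (2 + δ)) P) : 0 < lyapunovRatio P ξ δ := by
  have hs := sigma_pos hn hξ h0.le hp
  refine div_pos (Finset.sum_pos (fun i _ => ?_) ⟨⟨0, hn⟩, Finset.mem_univ _⟩)
    (by positivity)
  have hm := hξ.measurable i
  have : IsProbabilityMeasure (P.map (ξ i)) := Measure.isProbabilityMeasure_map hm.aemeasurable
  have h := integral_sq_rpow_le (μ := P.map (ξ i)) h0 (integrable_rpow_map hm (hp i))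
  rw [integral_map hm.aemeasurable (by fun_prop), integral_map hm.aemeasurable
    (Measurable.aestronglyMeasurable (by fun_prop))] at h
  refine lt_of_lt_of_le (Real.rpow_pos_of_pos ?_ _) h
  exact integral_sq_pos (hξ.nondegenerate i) (integrable_pow_comp hm h0.le (hp i) le_rfl)

end Moments

/-- **Berry–Esseen inequality** for independent, not necessarily identically distributed
summands with finite `(2 + δ)`-th moments. It makes `lyapunovConst δ` an infimum over a nonempty
set, hence a genuine Berry–Esseen constant. -/
theorem exists_isBerryEsseenBound {δ : ℝ} (h0 : 0 < δ) (h1 : δ ≤ 1) :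
    ∃ C, IsBerryEsseenBound δ C := by
  obtain ⟨C₀, hC₀, hsm⟩ := exists_smoothing_bound
  -- `32` settles the case `L > 1/32`, and `352 = 160 * 2 + 32` is the sum of the two contributions
  -- to the smoothing bound
  refine ⟨max 32 (C₀ * 352), fun Ω _ P _ n ξ hn hξ hp x => ?_⟩
  have hs := sigma_pos hn hξ h0.le hp
  have hL := lyapunovRatio_pos hn hξ h0 hp
  set s := sigma P ξ with hs_def
  set L := lyapunovRatio P ξ δ with hL_def
  have hSm : Measurable (partialSum ξ) := by
    unfold partialSum; exact Finset.measurable_fun_sum _ fun i _ => hξ.measurable i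
  rcases lt_or_ge (1 / 32) L with hL32 | hL32
  · have h1 : |P.real {ω | partialSum ξ ω ≤ x * s} - Phi x| ≤ 1 := by
      have a := measureReal_nonneg (μ := P) (s := {ω | partialSum ξ ω ≤ x * s})
      have b := measureReal_le_one (μ := P) (s := {ω | partialSum ξ ω ≤ x * s})
      have c := cdf_nonneg (gaussianReal 0 1) x
      have d := cdf_le_one (gaussianReal 0 1) x
      rw [abs_le, Phi]
      constructor <;> linarith
    have h2 : 32 * L ≤ max 32 (C₀ * 352) * L := by gcongr; exact le_max_left _ _
    linarith
  -- frequencies up to `T` are used; in units of `1 / T` this becomes the interval `(0, 1]`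
  set T : ℝ := (32 * L) ^ (-(1 / δ)) with hT_def
  have hT : 0 < T := by positivity
  have hTδ : T ^ δ = (32 * L)⁻¹ := by
    rw [hT_def, ← Real.rpow_mul (by positivity), ← Real.rpow_neg_one]
    congr 1; field_simp
  have hTinv : T⁻¹ ≤ 32 * L := by
    rw [hT_def, Real.rpow_neg (by positivity), inv_inv]
    have : (32 * L) ^ (1 / δ) ≤ (32 * L) ^ (1 : ℝ) :=
      Real.rpow_le_rpow_of_exponent_ge (by positivity) (by linarith)
        ((one_le_div h0).2 h1)
    rwa [Real.rpow_one] at this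
  set S : Measure ℝ := P.map (partialSum ξ) with hS
  have : IsProbabilityMeasure S := Measure.isProbabilityMeasure_map hSm.aemeasurable
  have hTs : 0 < T / s := by positivity
  have hpμ : IsProbabilityMeasure (S.map (T / s * ·)) :=
    Measure.isProbabilityMeasure_map (by fun_prop)
  have hpν : IsProbabilityMeasure ((gaussianReal 0 1).map (T * ·)) :=
    Measure.isProbabilityMeasure_map (by fun_prop)
  have hprob : ∀ i, IsProbabilityMeasure (P.map (ξ i)) := fun i =>
    Measure.isProbabilityMeasure_map (hξ.measurable i).aemeasurable
  have hsq : ∀ i, ∫ y, y ^ 2 ∂(P.map (ξ i)) = ∫ ω, ξ i ω ^ 2 ∂P := fun i =>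
    integral_map (hξ.measurable i).aemeasurable (by fun_prop)
  have hab : ∀ i, ∫ y, |y| ^ (2 + δ) ∂(P.map (ξ i)) = ∫ ω, |ξ i ω| ^ (2 + δ) ∂P := fun i =>
    integral_map (hξ.measurable i).aemeasurable (Measurable.aestronglyMeasurable (by fun_prop))
  have hbound := hsm (S.map (T / s * ·)) ((gaussianReal 0 1).map (T * ·)) hpμ hpν T⁻¹
    (by positivity) (fun a b hab => by
      rw [cdf_map_const_mul _ hT, cdf_map_const_mul _ hT]
      refine (Phi_sub_le (div_le_div_of_nonneg_right hab hT.le)).trans (le_of_eq ?_)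
      field_simp)
    (fun t => 160 * L * (T * (1 + (T * t) ^ 2)⁻¹))
    (Continuous.intervalIntegrable (continuous_const.mul (continuous_const.mul
      (Continuous.inv₀ (by fun_prop) fun t => by positivity))) _ _)
    (fun t ht => by
      have hTt : 0 < T * t := mul_pos hT ht.1
      have e1 : charFun (S.map (T / s * ·)) t = ∏ i, charFun (P.map (ξ i)) (T * t / s) := by
        rw [charFun_map_mul, hS, show partialSum ξ = fun ω => ∑ i, ξ i ω from rfl,
          hξ.indep.charFun_map_fun_sum_eq_prod fun i => (hξ.measurable i).aemeasurable,
          Finset.prod_apply]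
        congr 1; ext i; congr 1; ring
      have e2 : charFun ((gaussianReal 0 1).map (T * ·)) t
          = Complex.exp (-((T * t : ℝ) : ℂ) ^ 2 / 2) := by
        rw [charFun_map_mul, charFun_gaussianReal]
        congr 1
        push_cast; ring
      rw [e1, e2]
      refine (norm_prod_charFun_sub_le (fun i => P.map (ξ i)) h0 h1
        (fun i => integrable_rpow_map (hξ.measurable i) (hp i)) (fun i => ?_) hs (L := L) ?_ ?_
        hL32 ?_).trans ?_
      · rw [integral_map (hξ.measurable i).aemeasurable (by fun_prop)]
        exact hξ.mean_zero i
      · simp_rw [hsq]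
        exact (sigma_sq ξ).symm
      · simp_rw [hab]; rfl
      · rw [abs_of_pos hTt, Real.mul_rpow hT.le ht.1.le, hTδ]
        have h3 : t ^ δ ≤ 1 := Real.rpow_le_one ht.1.le ht.2 h0.le
        rw [show L * ((32 * L)⁻¹ * t ^ δ) = t ^ δ / 32 by field_simp]
        linarith
      · rw [abs_of_pos hTt]
        have := rpow_mul_exp_le h0.le h1 hTt
        calc _ = 5 * L * ((T * t) ^ (2 + δ) * Real.exp (-(T * t) ^ 2 / 4)) := by ring
          _ ≤ 5 * L * (32 * (T * t * (1 + (T * t) ^ 2)⁻¹)) := by gcongr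
          _ = _ := by ring)
    (T * x)
  have e1 : cdf (S.map (T / s * ·)) (T * x) = P.real {ω | partialSum ξ ω ≤ x * s} := by
    rw [cdf_map_const_mul _ hTs, cdf_eq_real, hS, map_measureReal_apply hSm measurableSet_Iic]
    congr 1
    ext ω
    simp only [Set.mem_preimage, Set.mem_Iic, Set.mem_ofPred_eq]
    rw [show T * x / (T / s) = x * s by field_simp]
  have e2 : cdf ((gaussianReal 0 1).map (T * ·)) (T * x) = Phi x := by
    rw [cdf_map_const_mul _ hT, mul_div_cancel_left₀ _ hT.ne', Phi]
  rw [e1, e2] at hbound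
  refine hbound.trans ?_
  rw [intervalIntegral.integral_const_mul]
  have h4 : 160 * L * (∫ t in (0 : ℝ)..1, T * (1 + (T * t) ^ 2)⁻¹) + T⁻¹ ≤ 352 * L := by
    have := mul_le_mul_of_nonneg_left (integral_lorentz_le (T := T))
        (show 0 ≤ 160 * L by positivity)
    linarith
  calc _ ≤ C₀ * (352 * L) := by gcongr
    _ = C₀ * 352 * L := by ring
    _ ≤ _ := by gcongr; exact le_max_right _ _

/-- The infimum defining `lyapunovConst δ` is itself an admissible constant. -/
lemma abs_sub_Phi_le_lyapunovConst {δ : ℝ} (h0 : 0 < δ) (h1 : δ ≤ 1) {Ω : Type}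
    [MeasurableSpace Ω] {P : Measure Ω} [IsProbabilityMeasure P] {n : ℕ} (hn : 1 ≤ n)
    {ξ : Fin n → Ω → ℝ} (hξ : CenteredIndep P ξ)
    (hp : ∀ i, Integrable (fun ω => |ξ i ω| ^ (2 + δ)) P) (x : ℝ) :
    |P.real {ω | partialSum ξ ω ≤ x * sigma P ξ} - Phi x|
      ≤ lyapunovConst δ * lyapunovRatio P ξ δ := by
  have hL := lyapunovRatio_pos hn hξ h0 hp
  rw [← div_le_iff₀ hL]
  refine le_csInf (exists_isBerryEsseenBound h0 h1) fun C hC => ?_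
  rw [div_le_iff₀ hL]
  exact hC Ω _ P inferInstance n ξ hn hξ hp x

/-! ### The function `Θ` as a Laplace transform -/

/-- `∫₀^∞ yᵏ exp (-a y - y² / 2) dy`; for `k = 0` this is the Mills ratio at `a`. -/
noncomputable def millsMoment (k : ℕ) (a : ℝ) : ℝ :=
  ∫ y in Set.Ioi (0 : ℝ), y ^ k * Real.exp (-(a * y) - y ^ 2 / 2)

lemma integrableOn_millsMoment (k : ℕ) {a : ℝ} (ha : 0 ≤ a) :
    IntegrableOn (fun y : ℝ => y ^ k * Real.exp (-(a * y) - y ^ 2 / 2)) (Set.Ioi 0) := by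
  have h := (integrableOn_rpow_mul_exp_neg_mul_sq (b := 1 / 2) (by norm_num) (s := (k : ℝ))
    (by have : (0 : ℝ) ≤ k := k.cast_nonneg
        linarith))
  refine Integrable.mono' h (by fun_prop) ?_
  filter_upwards [ae_restrict_mem measurableSet_Ioi] with y hy
  have hy' : (0 : ℝ) < y := hy
  rw [Real.rpow_natCast, Real.norm_of_nonneg (by positivity)]
  gcongr
  nlinarith [mul_nonneg ha hy'.le]

lemma tendsto_pow_mul_exp_mills (k : ℕ) {a : ℝ} (ha : 0 ≤ a) :
    Tendsto (fun y : ℝ => -(y ^ k * Real.exp (-(a * y) - y ^ 2 / 2))) atTop (nhds 0) := by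
  have h := Real.tendsto_pow_mul_exp_neg_atTop_nhds_zero k
  rw [← neg_zero]
  refine Tendsto.neg (squeeze_zero' ?_ ?_ h)
  · filter_upwards [eventually_ge_atTop 0] with y hy
    positivity
  · filter_upwards [eventually_ge_atTop 2] with y hy
    gcongr
    nlinarith [mul_nonneg ha (show 0 ≤ y by linarith)]

lemma hasDerivAt_exp_mills (a y : ℝ) :
    HasDerivAt (fun y : ℝ => Real.exp (-(a * y) - y ^ 2 / 2))
      (Real.exp (-(a * y) - y ^ 2 / 2) * (-a - y)) y := by
  have h1 : HasDerivAt (fun y : ℝ => -(a * y) - y ^ 2 / 2) (-a - y) y := by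
    convert! (((hasDerivAt_id y).const_mul a).neg).sub (((hasDerivAt_id y).pow 2).div_const 2)
      using 1
    simp
  exact h1.exp

lemma millsMoment_one {a : ℝ} (ha : 0 ≤ a) : millsMoment 1 a = 1 - a * millsMoment 0 a := by
  have h := integral_Ioi_of_hasDerivAt_of_tendsto' (a := (0 : ℝ))
    (f := fun y : ℝ => -(y ^ 0 * Real.exp (-(a * y) - y ^ 2 / 2)))
    (f' := fun y => y ^ 1 * Real.exp (-(a * y) - y ^ 2 / 2)
      + a * (y ^ 0 * Real.exp (-(a * y) - y ^ 2 / 2)))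
    (fun y _ => by
      convert! (hasDerivAt_exp_mills a y).neg using 1
      · ext; simp
      · ring)
    ((integrableOn_millsMoment 1 ha).add ((integrableOn_millsMoment 0 ha).const_mul a))
    (tendsto_pow_mul_exp_mills 0 ha)
  rw [integral_add (integrableOn_millsMoment 1 ha) ((integrableOn_millsMoment 0 ha).const_mul a),
    integral_const_mul] at h
  simp only [millsMoment]
  norm_num at h ⊢
  linarith

lemma millsMoment_two {a : ℝ} (ha : 0 ≤ a) :
    millsMoment 2 a = millsMoment 0 a - a * millsMoment 1 a := by
  have h := integral_Ioi_of_hasDerivAt_of_tendsto' (a := (0 : ℝ))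
    (f := fun y : ℝ => -(y ^ 1 * Real.exp (-(a * y) - y ^ 2 / 2)))
    (f' := fun y => (y ^ 2 * Real.exp (-(a * y) - y ^ 2 / 2)
      + a * (y ^ 1 * Real.exp (-(a * y) - y ^ 2 / 2)))
      - y ^ 0 * Real.exp (-(a * y) - y ^ 2 / 2))
    (fun y _ => by
      convert! ((hasDerivAt_id y).mul (hasDerivAt_exp_mills a y)).neg using 1
      · ext; simp
      · simp; ring)
    (((integrableOn_millsMoment 2 ha).add ((integrableOn_millsMoment 1 ha).const_mul a)).sub
      (integrableOn_millsMoment 0 ha))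
    (tendsto_pow_mul_exp_mills 1 ha)
  have i1 : IntegrableOn (fun y : ℝ => y ^ 2 * Real.exp (-(a * y) - y ^ 2 / 2)
      + a * (y ^ 1 * Real.exp (-(a * y) - y ^ 2 / 2))) (Set.Ioi 0) :=
    (integrableOn_millsMoment 2 ha).add ((integrableOn_millsMoment 1 ha).const_mul a)
  rw [integral_sub i1 (integrableOn_millsMoment 0 ha),
    integral_add (integrableOn_millsMoment 2 ha) ((integrableOn_millsMoment 1 ha).const_mul a),
    integral_const_mul] at h
  simp only [millsMoment]
  norm_num at h ⊢
  linarith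

lemma millsMoment_nonneg (k : ℕ) (a : ℝ) : 0 ≤ millsMoment k a :=
  setIntegral_nonneg measurableSet_Ioi fun y hy => by
    have : (0 : ℝ) < y := hy
    positivity

/-- The second moment is nonnegative, and integration by parts expresses it by the first one. -/
lemma millsMoment_one_le {a : ℝ} (ha : 0 ≤ a) : millsMoment 1 a ≤ 1 / (1 + a ^ 2) := by
  rw [le_div_iff₀ (by positivity)]
  have h1 := millsMoment_one ha
  have h2 := millsMoment_two ha
  have h3 := millsMoment_nonneg 2 a
  have : a * (a * millsMoment 1 a) ≤ a * millsMoment 0 a := by gcongr; linarith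
  linarith

lemma millsMoment_zero_antitone {a b : ℝ} (ha : 0 ≤ a) (hab : a ≤ b) :
    millsMoment 0 b ≤ millsMoment 0 a := by
  refine setIntegral_mono_on (integrableOn_millsMoment 0 (ha.trans hab))
    (integrableOn_millsMoment 0 ha) measurableSet_Ioi fun y hy => ?_
  have : (0 : ℝ) < y := hy
  gcongr

lemma millsMoment_zero_sub_le {a b : ℝ} (ha : 0 ≤ a) (hab : a ≤ b) :
    millsMoment 0 a - millsMoment 0 b ≤ (b - a) * millsMoment 1 a := by
  unfold millsMoment
  rw [← integral_sub (integrableOn_millsMoment 0 ha) (integrableOn_millsMoment 0 (ha.trans hab)),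
    ← integral_const_mul]
  refine setIntegral_mono_on ((integrableOn_millsMoment 0 ha).sub
    (integrableOn_millsMoment 0 (ha.trans hab))) ((integrableOn_millsMoment 1 ha).const_mul _)
    measurableSet_Ioi fun y _ => ?_
  have e : Real.exp (-(b * y) - y ^ 2 / 2)
      = Real.exp (-(a * y) - y ^ 2 / 2) * Real.exp (-((b - a) * y)) := by
    rw [← Real.exp_add]; ring_nf
  have h := Real.add_one_le_exp (-((b - a) * y))
  have h2 := Real.exp_pos (-(a * y) - y ^ 2 / 2)
  simp only [pow_zero, one_mul, pow_one]
  rw [e]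
  nlinarith

lemma le_millsMoment_zero {a : ℝ} (ha : 0 ≤ a) : 1 / (2 * (1 + a)) ≤ millsMoment 0 a := by
  have key : ∀ c : ℝ, 1 ≤ c → 1 / (2 * c) ≤ millsMoment 0 c := fun c hc => by
    have h1 := millsMoment_one (show 0 ≤ c by linarith)
    have h2 := millsMoment_one_le (show 0 ≤ c by linarith)
    have h3 : 1 / (1 + c ^ 2) ≤ 1 / 2 := one_div_le_one_div_of_le (by norm_num) (by nlinarith)
    rw [div_le_iff₀ (by positivity)]
    linarith
  rcases le_total a 1 with h | h
  · refine le_trans ?_ (millsMoment_zero_antitone ha h)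
    refine le_trans ?_ (key 1 le_rfl)
    exact one_div_le_one_div_of_le (by norm_num) (by linarith)
  · exact (one_div_le_one_div_of_le (by linarith) (by linarith)).trans (key a h)

lemma integral_exp_neg_gaussian (a : ℝ) :
    ∫ y in Set.Ioi 0, Real.exp (-(a * y)) ∂(gaussianReal 0 1)
      = (√(2 * Real.pi))⁻¹ * millsMoment 0 a := by
  rw [← integral_indicator measurableSet_Ioi, integral_gaussianReal_eq_integral_smul (by norm_num),
    millsMoment, ← integral_const_mul, ← integral_indicator measurableSet_Ioi]
  refine integral_congr_ae (ae_of_all _ fun y => ?_)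
  simp only [Set.indicator_apply, smul_eq_mul]
  split_ifs
  · rw [gaussianPDFReal_std, mul_assoc, ← Real.exp_add]
    ring_nf
  · simp

/-- `Θ` is, up to a constant, the Mills ratio. -/
lemma Theta_eq (x : ℝ) : Theta x = (√(2 * Real.pi))⁻¹ * millsMoment 0 x := by
  have h1 : 1 - Phi x = ∫ y in Set.Ioi x, gaussianPDFReal 0 1 y := by
    rw [← gaussianReal_real_eq_integral, Phi, cdf_eq_real, ← Set.compl_Iic,
      probReal_compl_eq_one_sub measurableSet_Iic]
  rw [Theta, h1, ← integral_mul_const, millsMoment, ← integral_const_mul,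
    ← integral_indicator measurableSet_Ioi, ← integral_indicator measurableSet_Ioi,
    ← integral_add_right_eq_self _ x]
  refine integral_congr_ae (ae_of_all _ fun y => ?_)
  simp only [Set.indicator_apply, Set.mem_Ioi, lt_add_iff_pos_left]
  split_ifs
  · rw [gaussianPDFReal_std, mul_assoc, ← Real.exp_add, pow_zero, one_mul]
    ring_nf
  · rfl

/-- The Lipschitz constant of `Θ` on `[m, ∞)` decays like `1 / m²`. -/
lemma abs_Theta_sub_le {a b m : ℝ} (hm : 0 ≤ m) (ha : m ≤ a) (hb : m ≤ b) :
    |Theta a - Theta b| ≤ |a - b| / (√(2 * Real.pi) * (1 + m ^ 2)) := by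
  wlog hab : a ≤ b generalizing a b
  · rw [abs_sub_comm, abs_sub_comm a]
    exact this hb ha (le_of_not_ge hab)
  have ha0 := hm.trans ha
  have h1 := millsMoment_zero_antitone ha0 hab
  have h2 := millsMoment_zero_sub_le ha0 hab
  have h3 := millsMoment_one_le ha0
  have h4 : 1 / (1 + a ^ 2) ≤ 1 / (1 + m ^ 2) := by gcongr
  have hs : 0 < √(2 * Real.pi) := by positivity
  rw [Theta_eq, Theta_eq, ← mul_sub, abs_mul, abs_of_pos (inv_pos.2 hs),
    abs_of_nonneg (by linarith),
    abs_sub_comm a, abs_of_nonneg (show 0 ≤ b - a by linarith)]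
  calc _ ≤ (√(2 * Real.pi))⁻¹ * ((b - a) * (1 / (1 + m ^ 2))) := by
        refine mul_le_mul_of_nonneg_left (h2.trans ?_) (inv_pos.2 hs).le
        exact mul_le_mul_of_nonneg_left (h3.trans h4) (by linarith)
    _ = _ := by field_simp

lemma le_Theta {x : ℝ} (hx : 0 ≤ x) : (√(2 * Real.pi))⁻¹ / (2 * (1 + x)) ≤ Theta x := by
  rw [Theta_eq, div_eq_mul_one_div]
  exact mul_le_mul_of_nonneg_left (le_millsMoment_zero hx) (by positivity)

lemma Theta_pos {x : ℝ} (hx : 0 ≤ x) : 0 < Theta x :=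
  lt_of_lt_of_le (by positivity) (le_Theta hx)

lemma abs_measureReal_Iio_sub_le {μ ν : Measure ℝ} [IsProbabilityMeasure μ]
    [IsProbabilityMeasure ν] {Δ : ℝ} (h : ∀ x, |μ.real (Set.Iic x) - ν.real (Set.Iic x)| ≤ Δ)
    (c : ℝ) : |μ.real (Set.Iio c) - ν.real (Set.Iio c)| ≤ Δ := by
  have hlim : ∀ ρ : Measure ℝ, IsProbabilityMeasure ρ → Tendsto
      (fun k : ℕ => ρ.real (Set.Iic (c - 1 / ((k : ℝ) + 1)))) atTop
      (nhds (ρ.real (Set.Iio c))) := fun ρ _ => by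
    have hU : ⋃ k : ℕ, Set.Iic (c - 1 / ((k : ℝ) + 1)) = Set.Iio c := by
      ext y
      simp only [Set.mem_iUnion, Set.mem_Iic, Set.mem_Iio]
      constructor
      · rintro ⟨k, hk⟩
        have : 0 < 1 / ((k : ℝ) + 1) := by positivity
        linarith
      · intro hy
        obtain ⟨k, hk⟩ := exists_nat_one_div_lt (sub_pos.2 hy)
        exact ⟨k, by linarith⟩
    have hmono : Monotone fun k : ℕ => Set.Iic (c - 1 / ((k : ℝ) + 1)) := fun i j hij =>
      Set.Iic_subset_Iic.2 (sub_le_sub_left (one_div_le_one_div_of_le (by positivity)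
        (by gcongr)) c)
    have := tendsto_measure_iUnion_atTop (μ := ρ) hmono
    rw [hU] at this
    exact (ENNReal.tendsto_toReal (measure_ne_top _ _)).comp this
  exact le_of_tendsto ((hlim μ inferInstance).sub (hlim ν inferInstance)).abs
    (Eventually.of_forall fun k => h _)

/-- The layer cake formula turns a bound on superlevel sets into one on integrals. -/
lemma abs_integral_sub_le_of_superlevel {μ ν : Measure ℝ} [IsProbabilityMeasure μ]
    [IsProbabilityMeasure ν] {f : ℝ → ℝ} (hf : Measurable f) (h0 : ∀ y, 0 ≤ f y)
    (h1 : ∀ y, f y ≤ 1) {C : ℝ}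
    (h : ∀ r, 0 < r → r < 1 → |μ.real {y | r < f y} - ν.real {y | r < f y}| ≤ C) :
    |∫ y, f y ∂μ - ∫ y, f y ∂ν| ≤ C := by
  have hint : ∀ ρ : Measure ℝ, IsProbabilityMeasure ρ → Integrable f ρ := fun ρ _ =>
    (integrable_const (1 : ℝ)).mono' hf.aestronglyMeasurable
      (ae_of_all _ fun y => by rw [Real.norm_of_nonneg (h0 y)]; exact h1 y)
  have hl : ∀ ρ : Measure ℝ, IsProbabilityMeasure ρ →
      ∫ y, f y ∂ρ = ∫ r in Set.Ioo (0 : ℝ) 1, ρ.real {y | r < f y} := fun ρ _ => by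
    rw [(hint ρ inferInstance).integral_eq_integral_meas_lt (ae_of_all _ h0)]
    refine setIntegral_eq_of_subset_of_forall_sdiff_eq_zero measurableSet_Ioi
      Set.Ioo_subset_Ioi_self fun r hr => ?_
    have hr1 : 1 ≤ r := by
      by_contra! hlt
      exact hr.2 ⟨hr.1, hlt⟩
    have : {y | r < f y} = ∅ := by
      ext y
      simpa using (h1 y).trans hr1
    rw [this, measureReal_empty]
  have hm : ∀ ρ : Measure ℝ, IsProbabilityMeasure ρ →
      IntegrableOn (fun r : ℝ => ρ.real {y | r < f y}) (Set.Ioo 0 1) := fun ρ _ => by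
    have ha : Antitone fun r : ℝ => ρ.real {y | r < f y} := fun r r' hrr =>
      measureReal_mono fun y (hy : r' < f y) => lt_of_le_of_lt hrr hy
    refine Integrable.mono' (integrable_const (1 : ℝ)) ha.measurable.aestronglyMeasurable
      (ae_of_all _ fun r => ?_)
    rw [Real.norm_of_nonneg measureReal_nonneg]
    exact measureReal_le_one
  rw [hl μ inferInstance, hl ν inferInstance,
    ← integral_sub (hm μ inferInstance) (hm ν inferInstance), ← Real.norm_eq_abs]
  have := norm_setIntegral_le_of_norm_le_const (μ := volume) (s := Set.Ioo (0 : ℝ) 1)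
    (f := fun r => μ.real {y | r < f y} - ν.real {y | r < f y}) (C := C) (by simp)
    (fun r hr => h r hr.1 hr.2)
  simpa using this

lemma setOf_lt_indicator_exp (s : Set ℝ) {a : ℝ} {r : ℝ} (h0 : 0 < r) :
    {y | r < s.indicator (fun y => Real.exp (-(a * y))) y} = s ∩ {y | a * y < -Real.log r} := by
  ext y
  by_cases hy : y ∈ s
  · simp only [Set.mem_ofPred_eq, Set.indicator_of_mem hy, Set.mem_inter_iff, hy, true_and]
    rw [← Real.log_lt_iff_lt_exp h0]
    constructor <;> intro <;> linarith
  · simp [hy, h0.le]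

/-- The Laplace transform over a half-line, which may contain its endpoint or not, changes by at
most twice the uniform distance of the distribution functions. -/
lemma abs_integral_exp_sub_le {μ ν : Measure ℝ} [IsProbabilityMeasure μ]
    [IsProbabilityMeasure ν] {Δ : ℝ} (h : ∀ x, |μ.real (Set.Iic x) - ν.real (Set.Iic x)| ≤ Δ)
    {a : ℝ} (ha : 0 ≤ a) {s : Set ℝ} (hs : s = Set.Ioi 0 ∨ s = Set.Ici 0) :
    |∫ y in s, Real.exp (-(a * y)) ∂μ - ∫ y in s, Real.exp (-(a * y)) ∂ν| ≤ 2 * Δ := by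
  have hms : MeasurableSet s := by
    rcases hs with rfl | rfl
    exacts [measurableSet_Ioi, measurableSet_Ici]
  have hs0 : ∀ y ∈ s, 0 ≤ y := by
    rcases hs with rfl | rfl
    exacts [fun y hy => le_of_lt hy, fun y hy => hy]
  rw [← integral_indicator hms, ← integral_indicator hms]
  refine abs_integral_sub_le_of_superlevel (Measurable.indicator (by fun_prop) hms)
    (fun y => Set.indicator_nonneg (fun _ _ => (Real.exp_pos _).le) y)
    (fun y => Set.indicator_le' (fun y hy => Real.exp_le_one_iff.2 ?_) (fun _ _ => zero_le_one) y)
    fun r hr0 hr1 => ?_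
  · have := mul_nonneg ha (hs0 y hy)
    linarith
  rw [setOf_lt_indicator_exp s hr0]
  have hlog : 0 < -Real.log r := by have := Real.log_neg hr0 hr1; linarith
  -- the complement of `s`, a half-line on which the two measures differ by at most `Δ`
  have hcompl : |μ.real sᶜ - ν.real sᶜ| ≤ Δ := by
    rcases hs with rfl | rfl
    · rw [Set.compl_Ioi]; exact h 0
    · rw [Set.compl_Ici]; exact abs_measureReal_Iio_sub_le h 0
  have hΔ := (abs_nonneg _).trans hcompl
  have hc := abs_le.1 hcompl
  rcases ha.eq_or_lt with rfl | ha
  · have e : s ∩ {y | 0 * y < -Real.log r} = s := by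
      ext y; simp only [zero_mul, Set.mem_inter_iff, Set.mem_ofPred_eq, hlog, and_true]
    rw [e]
    rw [probReal_compl_eq_one_sub hms, probReal_compl_eq_one_sub hms] at hc
    rw [abs_le]
    constructor <;> linarith
  · have e : s ∩ {y | a * y < -Real.log r} = Set.Iio (-Real.log r / a) \ sᶜ := by
      ext y
      simp only [Set.mem_inter_iff, Set.mem_ofPred_eq, Set.mem_sdiff, Set.mem_Iio, lt_div_iff₀ ha,
        Set.mem_compl_iff, not_not, mul_comm a]
      exact and_comm
    have hsub : sᶜ ⊆ Set.Iio (-Real.log r / a) := by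
      intro y hy
      have : y ≤ 0 := by
        rcases hs with rfl | rfl
        · simpa using hy
        · exact le_of_lt (by simpa using hy)
      exact this.trans_lt (by positivity)
    rw [e, measureReal_sdiff hsub hms.compl, measureReal_sdiff hsub hms.compl]
    have hi := abs_le.1 (abs_measureReal_Iio_sub_le h (-Real.log r / a))
    rw [abs_le]
    constructor <;> linarith

/-- For the standard Gaussian itself the restricted Laplace transform is `Theta`. -/
lemma integral_exp_gaussian_eq_Theta (a : ℝ) {s : Set ℝ} (hs : s = Set.Ioi 0 ∨ s = Set.Ici 0) :
    ∫ y in s, Real.exp (-(a * y)) ∂(gaussianReal 0 1) = Theta a := by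
  rcases hs with rfl | rfl
  · rw [integral_exp_neg_gaussian, Theta_eq]
  · have := nullSingletonClass_gaussianReal (μ := 0) (v := 1) (by norm_num)
    rw [integral_Ici_eq_integral_Ioi, integral_exp_neg_gaussian, Theta_eq]

/-! ### Moments under exponential tilting -/

lemma exp_le_quadratic {z : ℝ} (hz : z ≤ 1 / 2) : Real.exp z ≤ 1 + z + 0.6 * z ^ 2 := by
  rcases le_total 0 z with h | h
  · have := Real.exp_bound' (x := z) h (by linarith) (n := 4) (by norm_num)
    norm_num [Finset.sum_range_succ, Nat.factorial] at this
    have h3 : z ^ 2 * (z / 6 + 5 * z ^ 2 / 96) ≤ z ^ 2 * (1 / 10) :=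
      mul_le_mul_of_nonneg_left (by nlinarith) (sq_nonneg z)
    nlinarith
  · have h1 : 1 - z + z ^ 2 / 2 ≤ Real.exp (-z) := by
      have := Real.quadratic_le_exp_of_nonneg (show 0 ≤ -z by linarith)
      linarith [this, show (-z) ^ 2 = z ^ 2 by ring]
    have h2 : Real.exp z * Real.exp (-z) = 1 := by rw [← Real.exp_add]; simp
    have h3 := Real.exp_pos z
    -- `(1 + z + 0.6 z²) (1 - z + z²/2) ≥ 1` for `z ≤ 0`
    have h4 : 1 ≤ (1 + z + 0.6 * z ^ 2) * (1 - z + z ^ 2 / 2) := by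
      have : 0 ≤ z ^ 2 * (0.1 - 0.1 * z + 0.3 * z ^ 2) := by
        refine mul_nonneg (sq_nonneg _) ?_
        nlinarith [sq_nonneg z]
      nlinarith
    have h5 : 0 < 1 + z + 0.6 * z ^ 2 := by nlinarith [sq_nonneg (z + 1)]
    nlinarith

section SingleSummand

lemma integrable_mul_exp {μ : Measure ℝ} {B l : ℝ} (hB : ∀ᵐ y ∂μ, y ≤ B) (hl : 0 ≤ l) {f : ℝ → ℝ}
    (hf : Integrable f μ) :
    Integrable (fun y => f y * Real.exp (l * y)) μ := by
  refine hf.mul_bdd (c := Real.exp (l * B)) (by fun_prop) ?_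
  filter_upwards [hB] with y hy
  rw [Real.norm_of_nonneg (Real.exp_pos _).le]
  gcongr

variable {μ : Measure ℝ} {B l : ℝ}

lemma integrable_exp_mul [IsProbabilityMeasure μ] (hB : ∀ᵐ y ∂μ, y ≤ B) (hl : 0 ≤ l) :
    Integrable (fun y => Real.exp (l * y)) μ := by
  simpa using integrable_mul_exp hB hl (integrable_const (1 : ℝ))

lemma one_le_integral_exp [IsProbabilityMeasure μ] (hB : ∀ᵐ y ∂μ, y ≤ B) (hl : 0 ≤ l)
    (h1 : Integrable (fun y => y) μ)
    (hm : ∫ y, y ∂μ = 0) : 1 ≤ ∫ y, Real.exp (l * y) ∂μ := by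
  have : ∫ y, (l * y + 1) ∂μ = 1 := by
    rw [integral_add (h1.const_mul l) (integrable_const _), integral_const_mul, hm]; simp
  rw [← this]
  exact integral_mono ((h1.const_mul l).add (integrable_const _)) (integrable_exp_mul hB hl)
    fun y => Real.add_one_le_exp _

lemma integral_exp_le [IsProbabilityMeasure μ] (hB : ∀ᵐ y ∂μ, y ≤ B) (hl : 0 ≤ l)
    (h1 : Integrable (fun y => y) μ)
    (h2 : Integrable (fun y : ℝ => y ^ 2) μ) (hm : ∫ y, y ∂μ = 0) (hv : ∫ y, y ^ 2 ∂μ ≤ B ^ 2)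
    (hlB : l * B ≤ 1 / 2) : ∫ y, Real.exp (l * y) ∂μ ≤ 1 + 0.6 * (l * B) ^ 2 := by
  have i1 : Integrable (fun y : ℝ => 1 + l * y) μ := (integrable_const _).add (h1.const_mul l)
  have e : ∫ y, (1 + l * y + 0.6 * l ^ 2 * y ^ 2) ∂μ = 1 + 0.6 * l ^ 2 * ∫ y, y ^ 2 ∂μ := by
    rw [integral_add i1 (h2.const_mul _),
      integral_add (integrable_const _) (h1.const_mul l), integral_const_mul, integral_const_mul,
      hm]
    simp
  have hmono : ∫ y, Real.exp (l * y) ∂μ ≤ ∫ y, (1 + l * y + 0.6 * l ^ 2 * y ^ 2) ∂μ := by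
    refine integral_mono_ae (integrable_exp_mul hB hl) (i1.add (h2.const_mul _)) ?_
    filter_upwards [hB] with y hy
    have := exp_le_quadratic (z := l * y) ((mul_le_mul_of_nonneg_left hy hl).trans hlB)
    linarith [this, mul_pow l y 2]
  rw [e] at hmono
  have := mul_le_mul_of_nonneg_left hv (show 0 ≤ 0.6 * l ^ 2 by positivity)
  linarith [mul_pow l B 2]

lemma integral_mul_exp_nonneg (hB : ∀ᵐ y ∂μ, y ≤ B) (hl : 0 ≤ l) (h1 : Integrable (fun y => y) μ)
    (hm : ∫ y, y ∂μ = 0) : 0 ≤ ∫ y, y * Real.exp (l * y) ∂μ := by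
  rw [← hm]
  refine integral_mono h1 (integrable_mul_exp hB hl h1) fun y => ?_
  rcases le_total 0 y with h | h
  · have : 1 ≤ Real.exp (l * y) := Real.one_le_exp (by positivity)
    nlinarith
  · have : Real.exp (l * y) ≤ 1 := Real.exp_le_one_iff.2 (mul_nonpos_of_nonneg_of_nonpos hl h)
    nlinarith

lemma integral_mul_exp_le (hB : ∀ᵐ y ∂μ, y ≤ B) (hB0 : 0 ≤ B) (hl : 0 ≤ l)
    (h1 : Integrable (fun y => y) μ) (h2 : Integrable (fun y : ℝ => y ^ 2) μ)
    (hm : ∫ y, y ∂μ = 0) (hlB : l * B ≤ 1 / 2) :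
    ∫ y, y * Real.exp (l * y) ∂μ ≤ (∫ y, y ^ 2 ∂μ) * l * (1 + 0.6 * (l * B)) := by
  have e : ∫ y, (y + l * (1 + 0.6 * (l * B)) * y ^ 2) ∂μ
      = (∫ y, y ^ 2 ∂μ) * l * (1 + 0.6 * (l * B)) := by
    rw [integral_add h1 (h2.const_mul _), integral_const_mul, hm]; ring
  rw [← e]
  refine integral_mono_ae (integrable_mul_exp hB hl h1) (h1.add (h2.const_mul _)) ?_
  filter_upwards [hB] with y hy
  have hly := mul_le_mul_of_nonneg_left hy hl
  rcases le_total 0 y with h | h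
  · have h3 := exp_le_quadratic (z := l * y) (hly.trans hlB)
    have h4 : Real.exp (l * y) ≤ 1 + l * y * (1 + 0.6 * (l * B)) := by
      nlinarith [mul_nonneg hl h]
    have := mul_le_mul_of_nonneg_left h4 h
    linarith [this, show y * (1 + l * y * (1 + 0.6 * (l * B)))
      = y + l * (1 + 0.6 * (l * B)) * y ^ 2 by ring]
  · have h3 := Real.add_one_le_exp (l * y)
    have h4 := mul_le_mul_of_nonpos_left h3 h
    have h5 : 0 ≤ l * (0.6 * (l * B)) * y ^ 2 := by positivity
    nlinarith

lemma integral_mul_exp_le_exp_mul (hB : ∀ᵐ y ∂μ, y ≤ B) (hl : 0 ≤ l) {f : ℝ → ℝ}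
    (hf : Integrable f μ)
    (h0 : ∀ y, 0 ≤ f y) :
    ∫ y, f y * Real.exp (l * y) ∂μ ≤ Real.exp (l * B) * ∫ y, f y ∂μ := by
  rw [← integral_const_mul]
  refine integral_mono_ae (integrable_mul_exp hB hl hf) (hf.const_mul _) ?_
  filter_upwards [hB] with y hy
  rw [mul_comm]
  gcongr
  exact h0 y

/-- `E Y e^{lY}` is the integral over `[0, l]` of its derivative `E Y² e^{sY}` in the tilting
parameter, since it vanishes at `0`. -/
lemma integral_mul_exp_eq_intervalIntegral [IsProbabilityMeasure μ] (hB : ∀ᵐ y ∂μ, y ≤ B)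
    (hB0 : 0 ≤ B) (hl : 0 ≤ l)
    (h1 : Integrable (fun y => y) μ) (h2 : Integrable (fun y : ℝ => y ^ 2) μ)
    (hm : ∫ y, y ∂μ = 0) :
    IntervalIntegrable (fun s => ∫ y, y ^ 2 * Real.exp (s * y) ∂μ) volume 0 l ∧
    ∫ y, y * Real.exp (l * y) ∂μ = ∫ s in (0 : ℝ)..l, ∫ y, y ^ 2 * Real.exp (s * y) ∂μ := by
  have hint : Integrable (Function.uncurry fun y s : ℝ => y ^ 2 * Real.exp (s * y))
      (μ.prod (volume.restrict (Set.Ioc 0 l))) := by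
    have hg : Integrable (fun p : ℝ × ℝ => p.1 ^ 2 * Real.exp (l * B))
        (μ.prod (volume.restrict (Set.Ioc 0 l))) :=
      ((h2.mul_const (Real.exp (l * B))).comp_fst _ : _)
    refine hg.mono' (Measurable.aestronglyMeasurable (by unfold Function.uncurry; fun_prop)) ?_
    have hB' : ∀ᵐ p ∂(μ.prod (volume.restrict (Set.Ioc 0 l))), p.1 ≤ B :=
      Measure.quasiMeasurePreserving_fst.ae hB
    have hs' : ∀ᵐ p ∂(μ.prod (volume.restrict (Set.Ioc 0 l))), p.2 ∈ Set.Ioc 0 l :=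
      Measure.quasiMeasurePreserving_snd.ae (ae_restrict_mem measurableSet_Ioc)
    filter_upwards [hB', hs'] with p hp hs
    simp only [Function.uncurry]
    rw [Real.norm_of_nonneg (by positivity)]
    refine mul_le_mul_of_nonneg_left (Real.exp_le_exp.2 ?_) (sq_nonneg _)
    calc p.2 * p.1 ≤ p.2 * B := mul_le_mul_of_nonneg_left hp hs.1.le
      _ ≤ l * B := mul_le_mul_of_nonneg_right hs.2 hB0
  refine ⟨?_, ?_⟩
  · rw [intervalIntegrable_iff_integrableOn_Ioc_of_le hl]
    exact hint.integral_prod_right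
  · rw [intervalIntegral.integral_of_le hl, ← integral_integral_swap hint]
    have e : ∀ y : ℝ, ∫ s in Set.Ioc 0 l, y ^ 2 * Real.exp (s * y)
        = y * Real.exp (l * y) - y := fun y => by
      rw [← intervalIntegral.integral_of_le hl]
      have hd : ∀ s ∈ Set.uIcc 0 l, HasDerivAt (fun s => y * Real.exp (s * y))
          (y ^ 2 * Real.exp (s * y)) s := fun s _ => by
        have h3 : HasDerivAt (fun s : ℝ => s * y) y s := by
          simpa using (hasDerivAt_id s).mul_const y
        convert! h3.exp.const_mul y using 1
        ring
      rw [intervalIntegral.integral_eq_sub_of_hasDerivAt hd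
        (Continuous.intervalIntegrable (by fun_prop) _ _)]
      simp
    simp_rw [e]
    rw [integral_sub (integrable_mul_exp hB hl h1) h1, hm, sub_zero]

lemma continuousOn_integral_mul_exp (hB : ∀ᵐ y ∂μ, y ≤ B) (hB0 : 0 ≤ B) {f : ℝ → ℝ}
    (hf : Integrable f μ) (a : ℝ) :
    ContinuousOn (fun l => ∫ y, f y * Real.exp (l * y) ∂μ) (Set.Icc 0 a) := by
  refine continuousOn_of_dominated (bound := fun y => ‖f y‖ * Real.exp (a * B))
    (fun l hl => (integrable_mul_exp hB hl.1 hf).aestronglyMeasurable) (fun l hl => ?_)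
    (hf.norm.mul_const _) (ae_of_all _ fun y => by fun_prop)
  filter_upwards [hB] with y hy
  rw [norm_mul, Real.norm_of_nonneg (Real.exp_pos _).le]
  refine mul_le_mul_of_nonneg_left (Real.exp_le_exp.2 ?_) (norm_nonneg _)
  calc l * y ≤ l * B := mul_le_mul_of_nonneg_left hy hl.1
    _ ≤ a * B := mul_le_mul_of_nonneg_right hl.2 hB0

end SingleSummand

/-- The laws of the summands, under the hypotheses of the expansion: centred, bounded above by `B`,
with positive variances, and subject to condition (A). -/
structure AdmissibleLaws {n : ℕ} (μ : Fin n → Measure ℝ) (δ B : ℝ) : Prop where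
  delta_pos : 0 < δ
  delta_le_one : δ ≤ 1
  B_pos : 0 < B
  n_pos : 1 ≤ n
  prob : ∀ i, IsProbabilityMeasure (μ i)
  le_B : ∀ i, ∀ᵐ y ∂(μ i), y ≤ B
  integrable_moment : ∀ i, Integrable (fun y => |y| ^ (2 + δ)) (μ i)
  moment_le : ∀ i, ∫ y, |y| ^ (2 + δ) ∂(μ i) ≤ B ^ (2 + δ)
  mean : ∀ i, ∫ y, y ∂(μ i) = 0
  sq_pos : ∀ i, 0 < ∫ y, y ^ 2 ∂(μ i)
  le_tilted : ∀ l : ℝ, 0 ≤ l →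
    (1 - B * l) * ∑ i, ∫ y, y ^ 2 ∂(μ i) ≤ ∑ i, ∫ y, y ^ 2 * Real.exp (l * y) ∂(μ i)

/-- The mean of the exponentially tilted measure `e^{ly} dμ / ∫ e^{ly} dμ`. -/
noncomputable def tiltMean (μ : Measure ℝ) (l : ℝ) : ℝ :=
  (∫ y, y * Real.exp (l * y) ∂μ) / ∫ y, Real.exp (l * y) ∂μ

/-- The variance of the exponentially tilted measure `e^{ly} dμ / ∫ e^{ly} dμ`. -/
noncomputable def tiltVar (μ : Measure ℝ) (l : ℝ) : ℝ :=
  (∫ y, y ^ 2 * Real.exp (l * y) ∂μ) / (∫ y, Real.exp (l * y) ∂μ) - tiltMean μ l ^ 2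

namespace AdmissibleLaws

variable {n : ℕ} {μ : Fin n → Measure ℝ} {δ B : ℝ}

lemma integrable_pow (h : AdmissibleLaws μ δ B) (i : Fin n) {k : ℕ} (hk : k ≤ 2) :
    Integrable (fun y : ℝ => y ^ k) (μ i) :=
  have := h.prob i
  integrable_pow_of_integrable_rpow h.delta_pos.le (h.integrable_moment i) hk

lemma integrable_id (h : AdmissibleLaws μ δ B) (i : Fin n) : Integrable (fun y : ℝ => y) (μ i) := by
  simpa using h.integrable_pow i (k := 1) (by norm_num)

lemma sq_le (h : AdmissibleLaws μ δ B) (i : Fin n) : ∫ y, y ^ 2 ∂(μ i) ≤ B ^ 2 := by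
  have := h.prob i
  have hd := h.delta_pos
  have h1 := (integral_sq_rpow_le hd (h.integrable_moment i)).trans (h.moment_le i)
  have e : B ^ (2 + δ) = (B ^ 2) ^ ((2 + δ) / 2) := by
    rw [← Real.rpow_natCast, ← Real.rpow_mul h.B_pos.le]
    congr 1; push_cast; ring
  rw [e] at h1
  exact (Real.rpow_le_rpow_iff (h.sq_pos i).le (sq_nonneg B) (by linarith)).1 h1

lemma sum_sq_pos (h : AdmissibleLaws μ δ B) : 0 < ∑ i, ∫ y, y ^ 2 ∂(μ i) :=
  Finset.sum_pos (fun i _ => h.sq_pos i) ⟨⟨0, h.n_pos⟩, Finset.mem_univ _⟩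

lemma one_le_mgf (h : AdmissibleLaws μ δ B) (i : Fin n) {l : ℝ} (hl : 0 ≤ l) :
    1 ≤ ∫ y, Real.exp (l * y) ∂(μ i) :=
  have := h.prob i
  one_le_integral_exp (h.le_B i) hl (h.integrable_id i) (h.mean i)

lemma mgf_le (h : AdmissibleLaws μ δ B) (i : Fin n) {l : ℝ} (hl : 0 ≤ l) (hlB : l * B ≤ 1 / 2) :
    ∫ y, Real.exp (l * y) ∂(μ i) ≤ 1 + 0.6 * (l * B) ^ 2 :=
  have := h.prob i
  integral_exp_le (h.le_B i) hl (h.integrable_id i) (h.integrable_pow i le_rfl) (h.mean i)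
    (h.sq_le i) hlB

/-- Integrating condition (A) in the tilting parameter. -/
lemma le_sum_integral_mul_exp (h : AdmissibleLaws μ δ B) {l : ℝ} (hl : 0 ≤ l) :
    (∑ i, ∫ y, y ^ 2 ∂(μ i)) * (l * (1 - l * B / 2))
      ≤ ∑ i, ∫ y, y * Real.exp (l * y) ∂(μ i) := by
  have := h.prob
  have hi := fun i => integral_mul_exp_eq_intervalIntegral (h.le_B i) h.B_pos.le hl
    (h.integrable_id i) (h.integrable_pow i le_rfl) (h.mean i)
  simp_rw [fun i => (hi i).2]
  rw [← intervalIntegral.integral_finsetSum fun i _ => (hi i).1]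
  have e : (∑ i, ∫ y, y ^ 2 ∂(μ i)) * (l * (1 - l * B / 2))
      = ∫ s in (0 : ℝ)..l, (1 - B * s) * ∑ i, ∫ y, y ^ 2 ∂(μ i) := by
    rw [intervalIntegral.integral_mul_const, intervalIntegral.integral_sub (by simp)
      (Continuous.intervalIntegrable (by fun_prop) _ _), intervalIntegral.integral_const_mul,
      integral_id]
    simp; ring
  rw [e]
  refine intervalIntegral.integral_mono_on hl (Continuous.intervalIntegrable (by fun_prop) _ _)
    ?_ fun s hs => h.le_tilted s hs.1
  have := IntervalIntegrable.sum (μ := volume) (a := 0) (b := l) Finset.univ fun i _ => (hi i).1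
  convert! this using 1
  ext s; simp

lemma le_sum_tiltMean (h : AdmissibleLaws μ δ B) {l : ℝ} (hl : 0 ≤ l) (hlB : l * B ≤ 1 / 2) :
    (∑ i, ∫ y, y ^ 2 ∂(μ i)) * l * (1 - l * B) ≤ ∑ i, tiltMean (μ i) l := by
  have := h.prob
  have hu : 0 ≤ l * B := mul_nonneg hl h.B_pos.le
  have hs := h.sum_sq_pos
  have h1 : (∑ i, ∫ y, y * Real.exp (l * y) ∂(μ i)) / (1 + 0.6 * (l * B) ^ 2)
      ≤ ∑ i, tiltMean (μ i) l := by
    rw [Finset.sum_div]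
    refine Finset.sum_le_sum fun i _ => ?_
    have := h.one_le_mgf i hl
    exact div_le_div_of_nonneg_left (integral_mul_exp_nonneg (h.le_B i) hl (h.integrable_id i)
      (h.mean i)) (by linarith) (h.mgf_le i hl hlB)
  refine le_trans ?_ h1
  rw [le_div_iff₀ (by positivity)]
  refine le_trans ?_ (h.le_sum_integral_mul_exp hl)
  rw [mul_assoc, mul_assoc]
  refine mul_le_mul_of_nonneg_left ?_ hs.le
  refine mul_le_mul_of_nonneg_left ?_ hl
  nlinarith [mul_nonneg hu (show 0 ≤ 1 / 2 - l * B by linarith), sq_nonneg (l * B),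
    mul_nonneg hu (sq_nonneg (l * B))]

lemma tiltMean_nonneg (h : AdmissibleLaws μ δ B) (i : Fin n) {l : ℝ} (hl : 0 ≤ l) :
    0 ≤ tiltMean (μ i) l := by
  have := h.prob i
  exact div_nonneg (integral_mul_exp_nonneg (h.le_B i) hl (h.integrable_id i) (h.mean i))
    (by linarith [h.one_le_mgf i hl])

lemma tiltMean_le (h : AdmissibleLaws μ δ B) (i : Fin n) {l : ℝ} (hl : 0 ≤ l)
    (hlB : l * B ≤ 1 / 2) :
    tiltMean (μ i) l ≤ (∫ y, y ^ 2 ∂(μ i)) * l * (1 + 0.6 * (l * B)) := by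
  have := h.prob i
  refine (div_le_self (integral_mul_exp_nonneg (h.le_B i) hl (h.integrable_id i) (h.mean i))
    (h.one_le_mgf i hl)).trans ?_
  exact integral_mul_exp_le (h.le_B i) h.B_pos.le hl (h.integrable_id i)
    (h.integrable_pow i le_rfl) (h.mean i) hlB

lemma sum_tiltMean_le (h : AdmissibleLaws μ δ B) {l : ℝ} (hl : 0 ≤ l) (hlB : l * B ≤ 1 / 2) :
    ∑ i, tiltMean (μ i) l ≤ (∑ i, ∫ y, y ^ 2 ∂(μ i)) * l * (1 + 0.6 * (l * B)) := by
  rw [Finset.sum_mul, Finset.sum_mul]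
  exact Finset.sum_le_sum fun i _ => h.tiltMean_le i hl hlB

lemma le_sum_tiltVar (h : AdmissibleLaws μ δ B) {l : ℝ} (hl : 0 ≤ l) (hlB : l * B ≤ 1 / 2) :
    (1 - 2 * (l * B)) * ∑ i, ∫ y, y ^ 2 ∂(μ i) ≤ ∑ i, tiltVar (μ i) l := by
  have := h.prob
  have hu : 0 ≤ l * B := mul_nonneg hl h.B_pos.le
  have hs := h.sum_sq_pos
  have h1 : ((1 - l * B) * ∑ i, ∫ y, y ^ 2 ∂(μ i)) / (1 + 0.6 * (l * B) ^ 2)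
      ≤ ∑ i, (∫ y, y ^ 2 * Real.exp (l * y) ∂(μ i)) / ∫ y, Real.exp (l * y) ∂(μ i) := by
    have h2 := h.le_tilted l hl
    rw [mul_comm B l] at h2
    refine (div_le_div_of_nonneg_right h2 (by positivity)).trans ?_
    rw [Finset.sum_div]
    refine Finset.sum_le_sum fun i _ => ?_
    have := h.one_le_mgf i hl
    exact div_le_div_of_nonneg_left (integral_nonneg fun y => by positivity) (by linarith)
      (h.mgf_le i hl hlB)
  have h2 : ∑ i, tiltMean (μ i) l ^ 2
      ≤ (∑ i, ∫ y, y ^ 2 ∂(μ i)) * ((l * B) ^ 2 * (1 + 0.6 * (l * B)) ^ 2) := by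
    rw [Finset.sum_mul]
    refine Finset.sum_le_sum fun i _ => ?_
    have h3 := pow_le_pow_left₀ (h.tiltMean_nonneg i hl) (h.tiltMean_le i hl hlB) 2
    refine h3.trans ?_
    have h4 := h.sq_le i
    have h5 := (h.sq_pos i).le
    calc ((∫ y, y ^ 2 ∂(μ i)) * l * (1 + 0.6 * (l * B))) ^ 2
        = (∫ y, y ^ 2 ∂(μ i)) * (∫ y, y ^ 2 ∂(μ i)) * (l ^ 2 * (1 + 0.6 * (l * B)) ^ 2) := by ring
      _ ≤ (∫ y, y ^ 2 ∂(μ i)) * B ^ 2 * (l ^ 2 * (1 + 0.6 * (l * B)) ^ 2) := by gcongr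
      _ = _ := by ring
  have h3 : ∑ i, tiltVar (μ i) l
      = ∑ i, (∫ y, y ^ 2 * Real.exp (l * y) ∂(μ i)) / (∫ y, Real.exp (l * y) ∂(μ i))
        - ∑ i, tiltMean (μ i) l ^ 2 := by
    rw [← Finset.sum_sub_distrib]; rfl
  rw [h3]
  refine le_trans ?_ (sub_le_sub h1 h2)
  set u := l * B with hu_def
  set V := ∑ i, ∫ y, y ^ 2 ∂(μ i)
  have hpoly : (1 - 2 * u) + u ^ 2 * (1 + 0.6 * u) ^ 2 ≤ (1 - u) / (1 + 0.6 * u ^ 2) := by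
    rw [le_div_iff₀ (by positivity)]
    have h2u : 0 ≤ 1 - 2 * u := by linarith
    have : 0 ≤ u * (1 - 1.6 * u - 0.96 * u ^ 3 - 0.72 * u ^ 4 - 0.216 * u ^ 5) := by
      refine mul_nonneg hu ?_
      have a1 : u ^ 3 ≤ 1 / 8 := by
        calc u ^ 3 ≤ (1 / 2) ^ 3 := pow_le_pow_left₀ hu hlB 3
          _ = 1 / 8 := by norm_num
      have a3 : u ^ 4 ≤ 1 / 16 := by
        calc u ^ 4 ≤ (1 / 2) ^ 4 := pow_le_pow_left₀ hu hlB 4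
          _ = 1 / 16 := by norm_num
      have a2 : u ^ 5 ≤ 1 / 32 := by
        calc u ^ 5 ≤ (1 / 2) ^ 5 := pow_le_pow_left₀ hu hlB 5
          _ = 1 / 32 := by norm_num
      nlinarith
    nlinarith
  have := mul_le_mul_of_nonneg_right hpoly hs.le
  rw [div_mul_eq_mul_div] at this
  linarith

lemma sum_tiltVar_le (h : AdmissibleLaws μ δ B) {l : ℝ} (hl : 0 ≤ l) (hlB : l * B ≤ 1 / 2) :
    ∑ i, tiltVar (μ i) l ≤ (1 + 0.6 * (l * B)) ^ 2 * ∑ i, ∫ y, y ^ 2 ∂(μ i) := by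
  have := h.prob
  have hu : 0 ≤ l * B := mul_nonneg hl h.B_pos.le
  rw [Finset.mul_sum]
  refine Finset.sum_le_sum fun i _ => ?_
  have h1 : (∫ y, y ^ 2 * Real.exp (l * y) ∂(μ i)) / (∫ y, Real.exp (l * y) ∂(μ i))
      ≤ Real.exp (l * B) * ∫ y, y ^ 2 ∂(μ i) :=
    (div_le_self (integral_nonneg fun y => by positivity) (h.one_le_mgf i hl)).trans
      (integral_mul_exp_le_exp_mul (h.le_B i) hl (h.integrable_pow i le_rfl) fun y => sq_nonneg y)
  have h2 : Real.exp (l * B) ≤ (1 + 0.6 * (l * B)) ^ 2 := by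
    have := exp_le_quadratic hlB
    nlinarith
  have h3 := mul_le_mul_of_nonneg_right h2 (h.sq_pos i).le
  have := sq_nonneg (tiltMean (μ i) l)
  unfold tiltVar
  linarith

/-- The saddle point equation: `∑ tiltMean (μ i) l = c` has a solution with `l B ≤ u`, by the
intermediate value theorem. -/
lemma exists_sum_tiltMean_eq (h : AdmissibleLaws μ δ B) {c u : ℝ} (hc : 0 ≤ c) (hu0 : 0 ≤ u)
    (hu : u ≤ 1 / 2) (hcu : c * B = (∑ i, ∫ y, y ^ 2 ∂(μ i)) * (u * (1 - u))) :
    ∃ l : ℝ, 0 ≤ l ∧ l * B ≤ u ∧ ∑ i, tiltMean (μ i) l = c := by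
  have := h.prob
  have hB := h.B_pos
  have huB : u / B * B = u := div_mul_cancel₀ _ hB.ne'
  have hcont : ContinuousOn (fun l => ∑ i, tiltMean (μ i) l) (Set.Icc 0 (u / B)) := by
    refine continuousOn_finsetSum _ fun i _ => ContinuousOn.div
      (continuousOn_integral_mul_exp (h.le_B i) hB.le (h.integrable_id i) _) ?_ fun l hl => ?_
    · simpa using continuousOn_integral_mul_exp (h.le_B i) hB.le (integrable_const (1 : ℝ)) (u / B)
    · have := h.one_le_mgf i hl.1
      linarith
  have h0 : ∑ i, tiltMean (μ i) 0 = 0 := by simp [tiltMean, h.mean]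
  have h1 : c ≤ ∑ i, tiltMean (μ i) (u / B) := by
    refine le_trans (le_of_eq ?_) (h.le_sum_tiltMean (l := u / B) (by positivity) (by rwa [huB]))
    rw [huB]
    field_simp
    linarith
  obtain ⟨l, hl, hl2⟩ := intermediate_value_Icc (by positivity) hcont
    (show c ∈ Set.Icc _ _ from ⟨by simpa only [h0] using hc, h1⟩)
  exact ⟨l, hl.1, by rw [← huB]; exact mul_le_mul_of_nonneg_right hl.2 hB.le, hl2⟩

end AdmissibleLaws

/-! ### The tilted product measure -/

lemma integral_tilted_mul (μ : Measure ℝ) (l : ℝ) (g : ℝ → ℝ) :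
    ∫ y, g y ∂(μ.tilted (l * ·))
      = (∫ y, g y * Real.exp (l * y) ∂μ) / ∫ y, Real.exp (l * y) ∂μ := by
  rw [integral_tilted, ← integral_div]
  refine integral_congr_ae (ae_of_all _ fun y => ?_)
  simp only [smul_eq_mul]
  ring

lemma integrable_tilted_mul {μ : Measure ℝ} [IsProbabilityMeasure μ] {B l : ℝ}
    (hB : ∀ᵐ y ∂μ, y ≤ B) (hl : 0 ≤ l) {g : ℝ → ℝ} (hg : Integrable g μ) :
    Integrable g (μ.tilted (l * ·)) := by
  rw [integrable_tilted_iff (integrable_exp_mul hB hl)]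
  simpa [mul_comm] using integrable_mul_exp hB hl hg

lemma integral_exp_sum_eq {n : ℕ} (μ : Fin n → Measure ℝ) [∀ i, IsProbabilityMeasure (μ i)]
    (l c : ℝ) : ∫ ω, Real.exp (l * (∑ i, ω i - c)) ∂(Measure.pi μ)
      = Real.exp (-(l * c)) * ∏ i, ∫ y, Real.exp (l * y) ∂(μ i) := by
  rw [← integral_fintype_prod_eq_prod (fun _ y => Real.exp (l * y)), ← integral_const_mul]
  refine integral_congr_ae (ae_of_all _ fun ω => ?_)
  simp only
  rw [← Real.exp_sum, ← Real.exp_add, ← Finset.mul_sum]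
  ring_nf

/-- The exponential tilt of a product measure in the direction of the sum of the coordinates is the
product of the tilted factors. The shift `c` only rescales the density before normalisation. -/
lemma pi_tilted_eq {n : ℕ} (μ : Fin n → Measure ℝ) [∀ i, IsProbabilityMeasure (μ i)] {l : ℝ}
    (hint : ∀ i, Integrable (fun y => Real.exp (l * y)) (μ i)) (c : ℝ) :
    Measure.pi (fun i => (μ i).tilted (l * ·))
      = (Measure.pi μ).tilted (fun ω => l * (∑ i, ω i - c)) := by
  have hp : ∀ i, IsProbabilityMeasure ((μ i).tilted (l * ·)) := fun i =>
    isProbabilityMeasure_tilted (hint i)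
  have hexp : ∀ ω : Fin n → ℝ, Real.exp (l * (∑ i, ω i - c))
      = Real.exp (-(l * c)) * ∏ i, Real.exp (l * ω i) := fun ω => by
    rw [← Real.exp_sum, ← Real.exp_add, ← Finset.mul_sum]; ring_nf
  have hM : ∀ i, 0 < ∫ y, Real.exp (l * y) ∂(μ i) := fun i => integral_exp_pos (hint i)
  refine (Measure.pi_eq fun s hs => ?_)
  rw [tilted_apply_eq_ofReal_integral' _ (MeasurableSet.univ_pi hs),
    integral_exp_sum_eq]
  have hi : ∀ i, (μ i).tilted (l * ·) (s i) = ENNReal.ofReal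
      (∫ y, (s i).indicator (fun y => Real.exp (l * y) / ∫ z, Real.exp (l * z) ∂(μ i)) y ∂(μ i)) :=
    fun i => by
      rw [tilted_apply_eq_ofReal_integral' _ (hs i), integral_indicator (hs i)]
  simp_rw [hi]
  rw [← ENNReal.ofReal_prod_of_nonneg, ← integral_fintype_prod_eq_prod (fun i =>
    (s i).indicator (fun y => Real.exp (l * y) / ∫ z, Real.exp (l * z) ∂(μ i))),
    ← integral_indicator (MeasurableSet.univ_pi hs)]
  · congr 1
    refine integral_congr_ae (ae_of_all _ fun ω => ?_)
    beta_reduce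
    by_cases hω : ∀ i, ω i ∈ s i
    · rw [Set.indicator_of_mem (by simpa using hω)]
      rw [Finset.prod_congr rfl fun i _ => Set.indicator_of_mem (hω i) _, hexp,
        Finset.prod_div_distrib, mul_div_mul_left _ _ (Real.exp_pos _).ne']
    · rw [Set.indicator_of_notMem (by simpa using hω)]
      push Not at hω
      obtain ⟨i, hi⟩ := hω
      exact (Finset.prod_eq_zero (Finset.mem_univ i) (by simp [hi])).symm
  · intro i _
    exact integral_nonneg fun y => Set.indicator_nonneg
      (fun y _ => div_nonneg (Real.exp_pos _).le (hM i).le) y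

lemma integral_coord_pi {n : ℕ} (ν : Fin n → Measure ℝ) [∀ i, IsProbabilityMeasure (ν i)]
    (i : Fin n) {f : ℝ → ℝ} (hf : Measurable f) :
    ∫ ω : Fin n → ℝ, f (ω i) ∂(Measure.pi ν) = ∫ y, f y ∂(ν i) :=
  integral_comp_eval hf.aestronglyMeasurable

lemma integrable_coord_pi {n : ℕ} (ν : Fin n → Measure ℝ) [∀ i, IsProbabilityMeasure (ν i)]
    (i : Fin n) {f : ℝ → ℝ} (hf : Integrable f (ν i)) :
    Integrable (fun ω : Fin n → ℝ => f (ω i)) (Measure.pi ν) :=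
  integrable_comp_eval hf

lemma abs_sub_rpow_le {p : ℝ} (hp : 1 ≤ p) (y b : ℝ) :
    |y - b| ^ p ≤ 2 ^ (p - 1) * (|y| ^ p + |b| ^ p) := by
  refine (Real.rpow_le_rpow (abs_nonneg _) (abs_sub y b) (by linarith)).trans ?_
  exact_mod_cast NNReal.rpow_add_le_mul_rpow_add_rpow ⟨|y|, abs_nonneg y⟩ ⟨|b|, abs_nonneg b⟩ hp

/-- Centring at the mean costs a factor `2 ^ p` in the `p`-th absolute moment. -/
lemma integral_abs_sub_mean_rpow_le {ν : Measure ℝ} [IsProbabilityMeasure ν] {p : ℝ} (hp : 1 ≤ p)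
    (h1 : Integrable (fun y => y) ν) (hi : Integrable (fun y => |y| ^ p) ν) :
    Integrable (fun y => |y - ∫ z, z ∂ν| ^ p) ν ∧
      ∫ y, |y - ∫ z, z ∂ν| ^ p ∂ν ≤ 2 ^ p * ∫ y, |y| ^ p ∂ν := by
  set b := ∫ z, z ∂ν with hb
  have hbp : |b| ^ p ≤ ∫ y, |y| ^ p ∂ν := by
    have h2 := (convexOn_rpow hp).map_integral_le (μ := ν) (f := fun y : ℝ => |y|)
      (Real.continuous_rpow_const (by linarith)).continuousOn isClosed_Ici
      (ae_of_all _ fun y => abs_nonneg y) h1.abs hi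
    refine le_trans (Real.rpow_le_rpow (abs_nonneg _) ?_ (by linarith)) h2
    exact abs_integral_le_integral_abs
  have hdom : Integrable (fun y => 2 ^ (p - 1) * (|y| ^ p + |b| ^ p)) ν :=
    (hi.add (integrable_const _)).const_mul _
  have hint : Integrable (fun y => |y - b| ^ p) ν := by
    refine hdom.mono' (Measurable.aestronglyMeasurable (by fun_prop)) (ae_of_all _ fun y => ?_)
    rw [Real.norm_of_nonneg (by positivity)]
    exact abs_sub_rpow_le hp y b
  refine ⟨hint, (integral_mono hint hdom fun y => abs_sub_rpow_le hp y b).trans ?_⟩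
  rw [integral_const_mul, integral_add hi (integrable_const _)]
  simp only [integral_const, probReal_univ, one_smul]
  have e : (2 : ℝ) ^ p = 2 ^ (p - 1) * 2 := by
    rw [← Real.rpow_add_one (by norm_num)]; ring_nf
  rw [e, mul_assoc]
  gcongr
  linarith

namespace AdmissibleLaws

variable {n : ℕ} {μ : Fin n → Measure ℝ} {δ B l : ℝ}

lemma integrable_exp (h : AdmissibleLaws μ δ B) (i : Fin n) (hl : 0 ≤ l) :
    Integrable (fun y => Real.exp (l * y)) (μ i) :=
  have := h.prob i
  integrable_exp_mul (h.le_B i) hl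

lemma isProbabilityMeasure_tilted (h : AdmissibleLaws μ δ B) (i : Fin n) (hl : 0 ≤ l) :
    IsProbabilityMeasure ((μ i).tilted (l * ·)) :=
  have := h.prob i
  MeasureTheory.isProbabilityMeasure_tilted (h.integrable_exp i hl)

lemma integral_id_tilted (i : Fin n) :
    ∫ y, y ∂((μ i).tilted (l * ·)) = tiltMean (μ i) l :=
  integral_tilted_mul _ _ _

lemma integral_sq_sub_tilted (h : AdmissibleLaws μ δ B) (i : Fin n) (hl : 0 ≤ l) :
    ∫ y, (y - tiltMean (μ i) l) ^ 2 ∂((μ i).tilted (l * ·)) = tiltVar (μ i) l := by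
  have := h.prob i
  have := h.isProbabilityMeasure_tilted i hl
  have i1 := integrable_tilted_mul (h.le_B i) hl (h.integrable_id i)
  have i2 := integrable_tilted_mul (h.le_B i) hl (h.integrable_pow i le_rfl)
  have e : ∀ y : ℝ, (y - tiltMean (μ i) l) ^ 2
      = y ^ 2 - 2 * tiltMean (μ i) l * y + tiltMean (μ i) l ^ 2 := fun y => by ring
  simp_rw [e]
  have i3 : Integrable (fun y : ℝ => y ^ 2 - 2 * tiltMean (μ i) l * y)
      ((μ i).tilted (l * ·)) := i2.sub (i1.const_mul _)
  rw [integral_add i3 (integrable_const _), integral_sub i2 (i1.const_mul _), integral_const_mul,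
    integral_id_tilted,
    integral_tilted_mul, tiltVar]
  simp
  ring

lemma integral_abs_sub_tilted_le (h : AdmissibleLaws μ δ B) (i : Fin n) (hl : 0 ≤ l) :
    Integrable (fun y => |y - tiltMean (μ i) l| ^ (2 + δ)) ((μ i).tilted (l * ·)) ∧
    ∫ y, |y - tiltMean (μ i) l| ^ (2 + δ) ∂((μ i).tilted (l * ·))
      ≤ 2 ^ (2 + δ) * (Real.exp (l * B) * ∫ y, |y| ^ (2 + δ) ∂(μ i)) := by
  have := h.prob i
  have := h.isProbabilityMeasure_tilted i hl
  have hd := h.delta_pos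
  have h1 := integral_abs_sub_mean_rpow_le (p := 2 + δ) (by linarith)
    (integrable_tilted_mul (h.le_B i) hl (h.integrable_id i))
    (integrable_tilted_mul (h.le_B i) hl (h.integrable_moment i))
  rw [integral_id_tilted] at h1
  refine ⟨h1.1, h1.2.trans ?_⟩
  gcongr
  rw [integral_tilted_mul]
  refine (div_le_self (integral_nonneg fun y => by positivity) (h.one_le_mgf i hl)).trans ?_
  exact integral_mul_exp_le_exp_mul (h.le_B i) hl (h.integrable_moment i) fun y => by positivity

/-- Under the tilted product measure the recentred coordinates again satisfy the standing
assumptions. -/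
lemma centeredIndep_tilted (h : AdmissibleLaws μ δ B) (hl : 0 ≤ l) :
    CenteredIndep (Measure.pi fun i => (μ i).tilted (l * ·))
      (fun i (ω : Fin n → ℝ) => ω i - tiltMean (μ i) l) := by
  have := h.prob
  have := fun i => h.isProbabilityMeasure_tilted (l := l) i hl
  refine ⟨fun i => by fun_prop, iIndepFun_pi (X := fun i y => y - tiltMean (μ i) l)
    fun i => by fun_prop, fun i => ?_, fun i => ?_, fun i => ?_⟩
  · exact integrable_coord_pi (fun i => (μ i).tilted (l * ·)) i (f := fun y => y - tiltMean (μ i) l)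
      ((integrable_tilted_mul (h.le_B i) hl (h.integrable_id i)).sub (integrable_const _))
  · rw [integral_coord_pi (fun i => (μ i).tilted (l * ·)) i (f := fun y => y - tiltMean (μ i) l)
      (by fun_prop),
      integral_sub (integrable_tilted_mul (h.le_B i) hl (h.integrable_id i)) (integrable_const _),
      integral_id_tilted]
    simp
  · rintro ⟨c, hc⟩
    have h1 : ∀ᵐ y ∂((μ i).tilted (l * ·)), y = c + tiltMean (μ i) l := by
      have hmp := measurePreserving_eval (fun i => (μ i).tilted (l * ·)) i
      rw [← hmp.map_eq, ae_map_iff hmp.measurable.aemeasurable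
        (measurableSet_eq_fun (by fun_prop) (by fun_prop))]
      filter_upwards [hc] with ω hω
      simp only [Function.eval]
      linarith
    have h2 : ∀ᵐ y ∂(μ i), y = c + tiltMean (μ i) l :=
      (absolutelyContinuous_tilted (h.integrable_exp i hl)).ae_le h1
    have h3 : c + tiltMean (μ i) l = 0 := by
      rw [← h.mean i, integral_congr_ae h2]; simp
    have h4 : ∫ y, y ^ 2 ∂(μ i) = 0 := by
      rw [integral_congr_ae (g := fun _ => (0 : ℝ))]
      · simp
      · filter_upwards [h2] with y hy
        rw [hy, h3]; simp
    exact (h.sq_pos i).ne' h4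

lemma sigma_tilted (h : AdmissibleLaws μ δ B) (hl : 0 ≤ l) :
    sigma (Measure.pi fun i => (μ i).tilted (l * ·))
      (fun i (ω : Fin n → ℝ) => ω i - tiltMean (μ i) l) = √(∑ i, tiltVar (μ i) l) := by
  have := fun i => h.isProbabilityMeasure_tilted (l := l) i hl
  unfold sigma
  congr 1
  refine Finset.sum_congr rfl fun i _ => ?_
  simp only
  rw [integral_coord_pi (fun i => (μ i).tilted (l * ·)) i (f := fun y => (y - tiltMean (μ i) l) ^ 2)
    (by fun_prop),
    h.integral_sq_sub_tilted i hl]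

lemma integrable_moment_tilted (h : AdmissibleLaws μ δ B) (hl : 0 ≤ l) (i : Fin n) :
    Integrable (fun ω : Fin n → ℝ => |ω i - tiltMean (μ i) l| ^ (2 + δ))
      (Measure.pi fun i => (μ i).tilted (l * ·)) :=
  have := fun i => h.isProbabilityMeasure_tilted (l := l) i hl
  integrable_coord_pi (fun i => (μ i).tilted (l * ·)) i
    (f := fun y => |y - tiltMean (μ i) l| ^ (2 + δ))
    (h.integral_abs_sub_tilted_le i hl).1

/-- Tilting multiplies the absolute moments by at most `e^{lB}`, centring by `2^{2+δ}`, and the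
variance loses at most the factor `1 - 2lB`. -/
lemma lyapunovRatio_tilted_le (h : AdmissibleLaws μ δ B) (hl : 0 ≤ l) (hlB : l * B < 1 / 2) :
    lyapunovRatio (Measure.pi fun i => (μ i).tilted (l * ·))
      (fun i (ω : Fin n → ℝ) => ω i - tiltMean (μ i) l) δ
    ≤ 2 ^ (2 + δ) * Real.exp (l * B) / ((1 - 2 * (l * B)) * (1 - 2 * (l * B)) ^ (δ / 2))
      * ((∑ i, ∫ y, |y| ^ (2 + δ) ∂(μ i)) / √(∑ i, ∫ y, y ^ 2 ∂(μ i)) ^ (2 + δ)) := by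
  have := fun i => h.isProbabilityMeasure_tilted (l := l) i hl
  have hV := h.sum_sq_pos
  have hu : 0 < 1 - 2 * (l * B) := by linarith
  have hd := h.delta_pos
  have hvar := h.le_sum_tiltVar hl hlB.le
  unfold lyapunovRatio
  rw [h.sigma_tilted hl]
  set V := ∑ i, ∫ y, y ^ 2 ∂(μ i)
  have hnum : ∑ i, ∫ ω : Fin n → ℝ, |ω i - tiltMean (μ i) l| ^ (2 + δ)
      ∂(Measure.pi fun i => (μ i).tilted (l * ·))
      ≤ 2 ^ (2 + δ) * Real.exp (l * B) * ∑ i, ∫ y, |y| ^ (2 + δ) ∂(μ i) := by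
    rw [Finset.mul_sum]
    refine Finset.sum_le_sum fun i _ => ?_
    rw [integral_coord_pi (fun i => (μ i).tilted (l * ·)) i
      (f := fun y => |y - tiltMean (μ i) l| ^ (2 + δ))
      (by fun_prop), mul_assoc]
    exact (h.integral_abs_sub_tilted_le i hl).2
  have hden : (1 - 2 * (l * B)) * (1 - 2 * (l * B)) ^ (δ / 2) * √V ^ (2 + δ)
      ≤ √(∑ i, tiltVar (μ i) l) ^ (2 + δ) := by
    have e1 : (1 - 2 * (l * B)) * (1 - 2 * (l * B)) ^ (δ / 2)
        = √(1 - 2 * (l * B)) ^ (2 + δ) := by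
      rw [Real.sqrt_eq_rpow, ← Real.rpow_mul hu.le,
        show 1 / 2 * (2 + δ) = 1 + δ / 2 by ring, Real.rpow_add hu, Real.rpow_one]
    rw [e1, ← Real.mul_rpow (Real.sqrt_nonneg _) (Real.sqrt_nonneg _), ← Real.sqrt_mul hu.le]
    exact Real.rpow_le_rpow (Real.sqrt_nonneg _) (Real.sqrt_le_sqrt hvar) (by linarith)
  have hS : 0 ≤ ∑ i, ∫ y, |y| ^ (2 + δ) ∂(μ i) :=
    Finset.sum_nonneg fun i _ => integral_nonneg fun y => by positivity
  rw [div_mul_div_comm]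
  exact div_le_div₀ (by positivity) hnum (by positivity) hden

end AdmissibleLaws

/-- The part of the error term due to replacing the standardised tilt `l * s`, where `s ^ 2` is the
tilted variance, by `x`. Here `u = l B`, and `V = σ²`. -/
lemma abs_Theta_tilt_sub_le {l B V m S : ℝ} (hl : 0 ≤ l) (hB : 0 < B) (hV : 0 < V)
    (hu : l * B < 1 / 2) (hm1 : V * l * (1 - l * B) ≤ m) (hm2 : m ≤ V * l * (1 + 0.6 * (l * B)))
    (hS1 : (1 - 2 * (l * B)) * V ≤ S) (hS2 : S ≤ (1 + 0.6 * (l * B)) ^ 2 * V) :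
    |Theta (l * √S) - Theta (m / √V)|
      ≤ Real.exp (l * B) / (1 - 2 * (l * B)) * (1.58 / √Real.pi * (B / √V)) := by
  set u := l * B with hu_def
  have hu0 : 0 ≤ u := mul_nonneg hl hB.le
  have h2u : 0 < 1 - 2 * u := by linarith
  set s := √V with hs_def
  have hs : 0 < s := Real.sqrt_pos.2 hV
  have hVs : V = s * s := (Real.mul_self_sqrt hV.le).symm
  set v := l * s with hv
  have hv0 : 0 ≤ v := mul_nonneg hl hs.le
  have huv : u = v * (B / s) := by rw [hu_def, hv]; field_simp
  set r := √(1 - 2 * u) with hr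
  have hr0 : 0 ≤ r := Real.sqrt_nonneg _
  have hr2 : r ^ 2 = 1 - 2 * u := Real.sq_sqrt h2u.le
  have hr_le : r ≤ 1 - u := by
    rw [hr, Real.sqrt_le_left (by linarith)]; nlinarith
  have hr_ge : 1 - u - 2 * u ^ 2 ≤ r := by
    refine Real.le_sqrt_of_sq_le ?_
    have : 0 ≤ u ^ 2 * ((1 - 2 * u) * (3 + 2 * u)) := by positivity
    nlinarith
  have hm1' : v * (1 - u) ≤ m / s := by
    rw [le_div_iff₀ hs]; rw [hVs] at hm1; nlinarith
  have hm2' : m / s ≤ v * (1 + 0.6 * u) := by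
    rw [div_le_iff₀ hs]; rw [hVs] at hm2; nlinarith
  have hS1' : v * r ≤ l * √S := by
    rw [hv, mul_assoc]
    refine mul_le_mul_of_nonneg_left ?_ hl
    rw [mul_comm, hr, hs_def, ← Real.sqrt_mul h2u.le]
    exact Real.sqrt_le_sqrt hS1
  have hS2' : l * √S ≤ v * (1 + 0.6 * u) := by
    rw [hv, mul_assoc]
    refine mul_le_mul_of_nonneg_left ?_ hl
    rw [Real.sqrt_le_left (by positivity), mul_pow, hs_def, Real.sq_sqrt hV.le, mul_comm]
    exact hS2
  have hvu : v * r ≤ v * (1 - u) := mul_le_mul_of_nonneg_left hr_le hv0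
  have hvr : v * (1 - u - 2 * u ^ 2) ≤ v * r := mul_le_mul_of_nonneg_left hr_ge hv0
  refine (abs_Theta_sub_le (m := v * r) (by positivity) hS1' (hvu.trans hm1')).trans ?_
  have hdiff : |l * √S - m / s| ≤ v * (u * (1.6 + 2 * u)) := by
    rw [abs_le]
    constructor <;> nlinarith
  have hpi : 0 < √Real.pi := Real.sqrt_pos.2 Real.pi_pos
  have hsqrt : √(2 * Real.pi) = √2 * √Real.pi := Real.sqrt_mul (by norm_num) _
  have h14 : (1.4 : ℝ) ≤ √2 := Real.le_sqrt_of_sq_le (by norm_num)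
  have hexp : 1 + u ≤ Real.exp u := by linarith [Real.add_one_le_exp u]
  rw [mul_pow, hr2, hsqrt]
  have hD : 0 < 1 + v ^ 2 * (1 - 2 * u) := by positivity
  rw [div_le_iff₀ (by positivity)]
  refine hdiff.trans ?_
  have hfac : v * (u * (1.6 + 2 * u)) = v ^ 2 * (B / s) * (1.6 + 2 * u) := by
    nth_rewrite 1 [huv]; ring
  have hstep : 1.6 + 2 * u ≤ Real.exp u * 1.58 * √2 := by
    have : 1.6 + 2 * u ≤ (1 + u) * 1.58 * 1.4 := by nlinarith
    refine this.trans ?_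
    gcongr
  have hBs : 0 ≤ B / s := by positivity
  have hR : Real.exp u / (1 - 2 * u) * (1.58 / √Real.pi * (B / s))
      * (√2 * √Real.pi * (1 + v ^ 2 * (1 - 2 * u)))
      = (Real.exp u * 1.58 * √2) * (B / s) * ((1 + v ^ 2 * (1 - 2 * u)) / (1 - 2 * u)) := by
    field_simp
  rw [hfac, hR]
  have h3 : v ^ 2 ≤ (1 + v ^ 2 * (1 - 2 * u)) / (1 - 2 * u) := by
    rw [le_div_iff₀ h2u]; linarith
  calc v ^ 2 * (B / s) * (1.6 + 2 * u) = (1.6 + 2 * u) * (B / s) * v ^ 2 := by ring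
    _ ≤ (Real.exp u * 1.58 * √2) * (B / s) * ((1 + v ^ 2 * (1 - 2 * u)) / (1 - 2 * u)) := by
        gcongr

/-- The variables `ξ` only witness that the Berry–Esseen inequality is not vacuous. -/
lemma lyapunovConst_nonneg {δ : ℝ} (h0 : 0 < δ) (h1 : δ ≤ 1) {Ω : Type}
    [MeasurableSpace Ω] {P : Measure Ω} [IsProbabilityMeasure P] {n : ℕ} (hn : 1 ≤ n)
    {ξ : Fin n → Ω → ℝ} (hξ : CenteredIndep P ξ)
    (hp : ∀ i, Integrable (fun ω => |ξ i ω| ^ (2 + δ)) P) : 0 ≤ lyapunovConst δ :=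
  nonneg_of_mul_nonneg_left ((abs_nonneg _).trans (abs_sub_Phi_le_lyapunovConst h0 h1 hn hξ hp 0))
    (lyapunovRatio_pos hn hξ h0 hp)

/-- `t = 2y / (1 + √(1 - 4y))` is the smaller root of `t (1 - t) = y`. -/
lemma tParam_spec {y : ℝ} (hy0 : 0 ≤ y) (hy : y < 1 / 4) :
    0 ≤ 2 * y / (1 + √(1 - 4 * y)) ∧ 2 * y / (1 + √(1 - 4 * y)) < 1 / 2 ∧
    2 * y / (1 + √(1 - 4 * y)) * (1 - 2 * y / (1 + √(1 - 4 * y))) = y := by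
  have h1 : 0 < 1 - 4 * y := by linarith
  set r := √(1 - 4 * y) with hr
  have hr0 : 0 < r := Real.sqrt_pos.2 h1
  have hr2 : r ^ 2 = 1 - 4 * y := Real.sq_sqrt h1.le
  refine ⟨by positivity, ?_, ?_⟩
  · rw [div_lt_iff₀ (by positivity)]; linarith
  · field_simp
    nlinarith

/-! ### The saddle point expansion on the product space -/

/-- The error bound as a function of `t`, of the ratio `b = B / σ`, of the Berry–Esseen constant
`C` and of the Lyapunov ratio `L`. -/
noncomputable def errorBound (δ t b C L : ℝ) : ℝ :=
  Real.exp t / (1 - 2 * t) * (1.58 / √Real.pi * b + 2 ^ (3 + δ) * C / (1 - 2 * t) ^ (δ / 2) * L)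

namespace AdmissibleLaws

variable {n : ℕ} {μ : Fin n → Measure ℝ} {δ B l : ℝ}

lemma integrable_exp_sum (h : AdmissibleLaws μ δ B) (hl : 0 ≤ l) (c : ℝ) :
    Integrable (fun ω : Fin n → ℝ => Real.exp (l * (∑ i, ω i - c))) (Measure.pi μ) := by
  have := h.prob
  have hi : Integrable (fun ω : Fin n → ℝ => ∏ i, Real.exp (l * ω i)) (Measure.pi μ) :=
    Integrable.fintype_prod fun i => h.integrable_exp i hl
  refine (hi.const_mul (Real.exp (-(l * c)))).congr (ae_of_all _ fun ω => ?_)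
  simp only
  rw [← Real.exp_sum, ← Real.exp_add, ← Finset.mul_sum]; ring_nf

/-- Change of measure: up to the total mass `∫ e^{l(S - c)}`, integrals of `e^{l(S - c)} g` are
integrals of `g` against the tilted product measure. -/
lemma integral_exp_mul_eq (h : AdmissibleLaws μ δ B) (hl : 0 ≤ l) (c : ℝ) (g : (Fin n → ℝ) → ℝ) :
    ∫ ω, Real.exp (l * (∑ i, ω i - c)) * g ω ∂(Measure.pi μ)
      = (∫ ω, Real.exp (l * (∑ i, ω i - c)) ∂(Measure.pi μ))
        * ∫ ω, g ω ∂(Measure.pi fun i => (μ i).tilted (l * ·)) := by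
  have := h.prob
  rw [pi_tilted_eq μ (fun i => h.integrable_exp i hl) c, integral_tilted, ← integral_const_mul]
  have hpos : 0 < ∫ ω, Real.exp (l * (∑ i, ω i - c)) ∂(Measure.pi μ) :=
    integral_exp_pos (h.integrable_exp_sum hl c)
  refine integral_congr_ae (ae_of_all _ fun ω => ?_)
  simp only [smul_eq_mul]
  field_simp

/-- If the tilted sum has mean `c`, then `l` minimises `E e^{l(S - c)}`: convexity enters through
`e^y ≥ 1 + y` under the tilted measure. -/
lemma integral_exp_le_of_sum_tiltMean_eq (h : AdmissibleLaws μ δ B) (hl : 0 ≤ l) {c : ℝ}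
    (hc : ∑ i, tiltMean (μ i) l = c) {l' : ℝ} (hl' : 0 ≤ l') :
    ∫ ω, Real.exp (l * (∑ i, ω i - c)) ∂(Measure.pi μ)
      ≤ ∫ ω, Real.exp (l' * (∑ i, ω i - c)) ∂(Measure.pi μ) := by
  have := h.prob
  have := fun i => h.isProbabilityMeasure_tilted (l := l) i hl
  have hcoord : ∀ i, Integrable (fun ω : Fin n → ℝ => ω i)
      (Measure.pi fun i => (μ i).tilted (l * ·)) := fun i =>
    integrable_coord_pi (fun i => (μ i).tilted (l * ·)) i (f := fun y => y)
      (integrable_tilted_mul (h.le_B i) hl (h.integrable_id i))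
  have hsum : Integrable (fun ω : Fin n → ℝ => ∑ i, ω i - c)
      (Measure.pi fun i => (μ i).tilted (l * ·)) :=
    (integrable_finsetSum _ fun i _ => hcoord i).sub (integrable_const _)
  have hmean : ∫ ω : Fin n → ℝ, (∑ i, ω i - c) ∂(Measure.pi fun i => (μ i).tilted (l * ·)) = 0 := by
    rw [integral_sub (integrable_finsetSum _ fun i _ => hcoord i) (integrable_const _),
      integral_finsetSum _ fun i _ => hcoord i]
    have : ∀ i, ∫ ω : Fin n → ℝ, ω i ∂(Measure.pi fun i => (μ i).tilted (l * ·))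
        = tiltMean (μ i) l := fun i => by
      rw [integral_coord_pi (fun i => (μ i).tilted (l * ·)) i (f := fun y => y) (by fun_prop),
        integral_id_tilted]
    simp_rw [this, hc]
    simp
  have e : ∀ ω : Fin n → ℝ, Real.exp (l' * (∑ i, ω i - c))
      = Real.exp (l * (∑ i, ω i - c)) * Real.exp ((l' - l) * (∑ i, ω i - c)) := fun ω => by
    rw [← Real.exp_add]; ring_nf
  simp_rw [e]
  rw [h.integral_exp_mul_eq hl]
  have hJ : 0 ≤ ∫ ω, Real.exp (l * (∑ i, ω i - c)) ∂(Measure.pi μ) :=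
    integral_nonneg fun ω => (Real.exp_pos _).le
  refine le_mul_of_one_le_right hJ ?_
  have hone : ∫ ω : Fin n → ℝ, ((l' - l) * (∑ i, ω i - c) + 1)
      ∂(Measure.pi fun i => (μ i).tilted (l * ·)) = 1 := by
    rw [integral_add (hsum.const_mul _) (integrable_const _), integral_const_mul, hmean]; simp
  rw [← hone]
  refine integral_mono ((hsum.const_mul _).add (integrable_const _)) ?_
    fun ω => Real.add_one_le_exp _
  rw [pi_tilted_eq μ (fun i => h.integrable_exp i hl) c,
    integrable_tilted_iff (h.integrable_exp_sum hl c)]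
  refine (h.integrable_exp_sum hl' c).congr (ae_of_all _ fun ω => ?_)
  simp only [smul_eq_mul]
  exact e ω

/-- Berry–Esseen under the tilted measure, in Laplace-transform form. -/
lemma abs_integral_exp_tilted_sub_Theta_le (h : AdmissibleLaws μ δ B) (hl : 0 ≤ l) {c : ℝ}
    (hc : ∑ i, tiltMean (μ i) l = c) {s : Set ℝ}
    (hs : s = Set.Ioi 0 ∨ s = Set.Ici 0) :
    |∫ ω, s.indicator (fun y => Real.exp (-(l * y))) (∑ i, ω i - c)
        ∂(Measure.pi fun i => (μ i).tilted (l * ·)) - Theta (l * √(∑ i, tiltVar (μ i) l))|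
      ≤ 2 * (lyapunovConst δ * lyapunovRatio (Measure.pi fun i => (μ i).tilted (l * ·))
      (fun i (ω : Fin n → ℝ) => ω i - tiltMean (μ i) l) δ) := by
  have := fun i => h.isProbabilityMeasure_tilted (l := l) i hl
  have hcen := h.centeredIndep_tilted hl
  have hmom := h.integrable_moment_tilted hl
  have hsig := h.sigma_tilted hl
  have hpos := sigma_pos h.n_pos hcen h.delta_pos.le hmom
  rw [hsig] at hpos
  set Q := Measure.pi fun i => (μ i).tilted (l * ·) with hQ
  set r := √(∑ i, tiltVar (μ i) l) with hr
  have hms : MeasurableSet s := by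
    rcases hs with rfl | rfl
    exacts [measurableSet_Ioi, measurableSet_Ici]
  have hYm : Measurable fun ω : Fin n → ℝ => (∑ i, ω i - c) / r := by fun_prop
  have hρ : IsProbabilityMeasure (Q.map fun ω => (∑ i, ω i - c) / r) :=
    Measure.isProbabilityMeasure_map hYm.aemeasurable
  have hBE : ∀ x, |(Q.map fun ω => (∑ i, ω i - c) / r).real (Set.Iic x)
      - (gaussianReal 0 1).real (Set.Iic x)| ≤ lyapunovConst δ * lyapunovRatio Q
      (fun i (ω : Fin n → ℝ) => ω i - tiltMean (μ i) l) δ := fun x => by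
    have h1 := abs_sub_Phi_le_lyapunovConst h.delta_pos h.delta_le_one h.n_pos hcen hmom x
    rw [hsig] at h1
    rw [map_measureReal_apply hYm measurableSet_Iic, ← cdf_eq_real]
    convert! h1 using 5
    ext ω
    simp only [Set.mem_preimage, Set.mem_Iic, partialSum, Finset.sum_sub_distrib, hc,
      Set.mem_ofPred_eq]
    rw [div_le_iff₀ hpos]
  have h2 := abs_integral_exp_sub_le hBE (a := l * r) (by positivity) hs
  rw [integral_exp_gaussian_eq_Theta _ hs, ← integral_indicator hms,
    integral_map hYm.aemeasurable
      (Measurable.aestronglyMeasurable (Measurable.indicator (by fun_prop) hms))] at h2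
  refine le_of_eq_of_le (congrArg (fun z => |z - _|) ?_) h2
  refine integral_congr_ae (ae_of_all _ fun ω => ?_)
  beta_reduce
  have hmem : (∑ i, ω i - c) / r ∈ s ↔ ∑ i, ω i - c ∈ s := by
    rcases hs with rfl | rfl
    · simp only [Set.mem_Ioi, div_pos_iff_of_pos_right hpos]
    · simp only [Set.mem_Ici, le_div_iff₀ hpos, zero_mul]
  by_cases hω : ∑ i, ω i - c ∈ s
  · rw [Set.indicator_of_mem hω, Set.indicator_of_mem (hmem.2 hω),
      show l * r * ((∑ i, ω i - c) / r) = l * (∑ i, ω i - c) by field_simp]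
  · rw [Set.indicator_of_notMem hω, Set.indicator_of_notMem (fun h => hω (hmem.1 h))]

/-- The expansion for the canonical product space: `l` is the saddle point. -/
theorem tail_expansion (h : AdmissibleLaws μ δ B) {x : ℝ} (hx0 : 0 ≤ x)
    (hx : x < 0.25 * (√(∑ i, ∫ y, y ^ 2 ∂(μ i)) / B)) :
    ∃ l : ℝ, 0 ≤ l ∧
      (∀ l' : ℝ, 0 ≤ l' →
        ∫ ω, Real.exp (l * (∑ i, ω i - x * √(∑ i, ∫ y, y ^ 2 ∂(μ i)))) ∂(Measure.pi μ)
          ≤ ∫ ω, Real.exp (l' * (∑ i, ω i - x * √(∑ i, ∫ y, y ^ 2 ∂(μ i)))) ∂(Measure.pi μ)) ∧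
      0 < ∫ ω, Real.exp (l * (∑ i, ω i - x * √(∑ i, ∫ y, y ^ 2 ∂(μ i)))) ∂(Measure.pi μ) ∧
      ∀ s : Set ℝ, (s = Set.Ioi 0 ∨ s = Set.Ici 0) → ∃ E : ℝ,
        (Measure.pi μ).real {ω | ∑ i, ω i - x * √(∑ i, ∫ y, y ^ 2 ∂(μ i)) ∈ s}
          = E * ∫ ω, Real.exp (l * (∑ i, ω i - x * √(∑ i, ∫ y, y ^ 2 ∂(μ i)))) ∂(Measure.pi μ) ∧
        E ≤ 1 ∧
        |E - Theta x| ≤ errorBound δ (tParam x B (√(∑ i, ∫ y, y ^ 2 ∂(μ i))))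
          (B / √(∑ i, ∫ y, y ^ 2 ∂(μ i))) (lyapunovConst δ)
          ((∑ i, ∫ y, |y| ^ (2 + δ) ∂(μ i)) / √(∑ i, ∫ y, y ^ 2 ∂(μ i)) ^ (2 + δ)) := by
  have := h.prob
  have hV := h.sum_sq_pos
  have hB := h.B_pos
  set V := ∑ i, ∫ y, y ^ 2 ∂(μ i) with hV_def
  set σ := √V with hσ_def
  have hσ : 0 < σ := Real.sqrt_pos.2 hV
  have hσV : σ * σ = V := Real.mul_self_sqrt hV.le
  -- `t` solves `t (1 - t) = x B / σ`
  obtain ⟨ht0, ht1, ht2⟩ := tParam_spec (y := x * B / σ) (by positivity) (by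
    rw [div_lt_iff₀ hσ]
    rw [← mul_div_assoc, lt_div_iff₀ hB] at hx
    linarith)
  have ht_eq : tParam x B σ = 2 * (x * B / σ) / (1 + √(1 - 4 * (x * B / σ))) := by
    rw [tParam, show 4 * x * B / σ = 4 * (x * B / σ) by ring,
      show 2 * x * B / σ = 2 * (x * B / σ) by ring]
  rw [← ht_eq] at ht0 ht1 ht2
  set t := tParam x B σ with ht_def
  obtain ⟨l, hl, hlt, hc⟩ := h.exists_sum_tiltMean_eq (c := x * σ) (u := t) (by positivity) ht0
    ht1.le (by rw [ht2, ← hV_def, ← hσV]; field_simp)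
  have hlB : l * B < 1 / 2 := by linarith
  have := fun i => h.isProbabilityMeasure_tilted (l := l) i hl
  have hu0 : 0 ≤ l * B := mul_nonneg hl hB.le
  refine ⟨l, hl, fun l' hl' => h.integral_exp_le_of_sum_tiltMean_eq hl hc hl',
    integral_exp_pos (h.integrable_exp_sum hl _), fun s hs => ?_⟩
  have hms : MeasurableSet s := by
    rcases hs with rfl | rfl
    exacts [measurableSet_Ioi, measurableSet_Ici]
  have hs0 : ∀ y ∈ s, 0 ≤ y := by
    rcases hs with rfl | rfl
    exacts [fun y hy => le_of_lt hy, fun y hy => hy]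
  refine ⟨∫ ω, s.indicator (fun y => Real.exp (-(l * y))) (∑ i, ω i - x * σ)
        ∂(Measure.pi fun i => (μ i).tilted (l * ·)), ?_, ?_, ?_⟩
  · refine Eq.trans ?_ ((h.integral_exp_mul_eq hl _ _).trans (mul_comm _ _))
    rw [← integral_indicator_one
      (show MeasurableSet {ω : Fin n → ℝ | ∑ i, ω i - x * σ ∈ s} from
        (show Measurable fun ω : Fin n → ℝ => ∑ i, ω i - x * σ by fun_prop) hms)]
    refine integral_congr_ae (ae_of_all _ fun ω => ?_)
    beta_reduce
    by_cases hω : ∑ i, ω i - x * σ ∈ s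
    · rw [Set.indicator_of_mem hω, Set.indicator_of_mem (by exact hω), ← Real.exp_add]
      simp
    · rw [Set.indicator_of_notMem hω, Set.indicator_of_notMem (by exact hω), mul_zero]
  · refine (integral_mono_of_nonneg (ae_of_all _ fun ω => Set.indicator_nonneg
      (fun y _ => (Real.exp_pos _).le) _) (integrable_const (1 : ℝ)) (ae_of_all _ fun ω =>
        Set.indicator_le' (fun y hy => Real.exp_le_one_iff.2 ?_) (fun _ _ => zero_le_one) _)).trans
        (by simp)
    have := mul_nonneg hl (hs0 y hy)
    linarith
  · have hBE := h.abs_integral_exp_tilted_sub_Theta_le hl hc hs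
    have hC := lyapunovConst_nonneg h.delta_pos h.delta_le_one h.n_pos (h.centeredIndep_tilted hl)
      (h.integrable_moment_tilted hl)
    have hL := h.lyapunovRatio_tilted_le hl hlB
    rw [← hV_def, ← hσ_def] at hL
    have hΘ := abs_Theta_tilt_sub_le hl hB hV hlB (h.le_sum_tiltMean hl hlB.le)
      (h.sum_tiltMean_le hl hlB.le) (h.le_sum_tiltVar hl hlB.le) (h.sum_tiltVar_le hl hlB.le)
    rw [hc, mul_div_cancel_right₀ _ hσ.ne', ← hσ_def] at hΘ
    have h2t : 0 < 1 - 2 * t := by linarith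
    have h2tu : 1 - 2 * t ≤ 1 - 2 * (l * B) := by linarith
    have h2u : 0 < 1 - 2 * (l * B) := by linarith
    have hd := h.delta_pos
    set L := (∑ i, ∫ y, |y| ^ (2 + δ) ∂(μ i)) / σ ^ (2 + δ) with hL_def
    have hL0 : 0 ≤ L := div_nonneg (Finset.sum_nonneg fun i _ => integral_nonneg fun y => by
      positivity) (by positivity)
    have hfirst : 2 * (lyapunovConst δ * lyapunovRatio (Measure.pi fun i => (μ i).tilted (l * ·))
        (fun i (ω : Fin n → ℝ) => ω i - tiltMean (μ i) l) δ)
        ≤ Real.exp t / (1 - 2 * t)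
          * (2 ^ (3 + δ) * lyapunovConst δ / (1 - 2 * t) ^ (δ / 2) * L) := by
      have h3 : 2 ^ (2 + δ) * Real.exp (l * B)
          / ((1 - 2 * (l * B)) * (1 - 2 * (l * B)) ^ (δ / 2))
          ≤ 2 ^ (2 + δ) * Real.exp t / ((1 - 2 * t) * (1 - 2 * t) ^ (δ / 2)) := by
        gcongr
      have h4 : (2 : ℝ) ^ (3 + δ) = 2 * 2 ^ (2 + δ) := by
        rw [show 3 + δ = 1 + (2 + δ) by ring, Real.rpow_add (by norm_num), Real.rpow_one]
      calc _ ≤ 2 * (lyapunovConst δ * (2 ^ (2 + δ) * Real.exp t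
            / ((1 - 2 * t) * (1 - 2 * t) ^ (δ / 2)) * L)) := by
            have := hL.trans (mul_le_mul_of_nonneg_right h3 hL0)
            gcongr
        _ = _ := by
            rw [h4]
            have : 0 < (1 - 2 * t) ^ (δ / 2) := by positivity
            field_simp
    have hsecond : Real.exp (l * B) / (1 - 2 * (l * B)) * (1.58 / √Real.pi * (B / σ))
        ≤ Real.exp t / (1 - 2 * t) * (1.58 / √Real.pi * (B / σ)) := by
      gcongr
    calc _ ≤ _ := abs_sub_le _ (Theta (l * √(∑ i, tiltVar (μ i) l))) _
      _ ≤ _ := add_le_add (hBE.trans hfirst) (hΘ.trans hsecond)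
      _ = _ := by rw [errorBound]; ring

end AdmissibleLaws

/-! ### Hoeffding's inequality -/

lemma exp_sub_taylor_eq_integral (z : ℝ) :
    Real.exp z - 1 - z = z ^ 2 * ∫ r in (0 : ℝ)..1, (1 - r) * Real.exp (r * z) := by
  have hd : ∀ r ∈ Set.uIcc (0 : ℝ) 1, HasDerivAt (fun r => z * (1 - r) * Real.exp (r * z)
      + Real.exp (r * z)) (z ^ 2 * ((1 - r) * Real.exp (r * z))) r := fun r _ => by
    have h1 : HasDerivAt (fun r : ℝ => r * z) z r := by simpa using (hasDerivAt_id r).mul_const z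
    have h2 := ((hasDerivAt_id r).const_sub 1).const_mul z
    convert! (h2.mul h1.exp).add h1.exp using 1
    simp
    ring
  rw [← intervalIntegral.integral_const_mul, intervalIntegral.integral_eq_sub_of_hasDerivAt hd
    (Continuous.intervalIntegrable (by fun_prop) _ _)]
  simp
  ring

/-- `(e^z - 1 - z) / z²` is nondecreasing. -/
lemma exp_sub_taylor_le {z c : ℝ} (hzc : z ≤ c) (hc : 0 < c) :
    Real.exp z - 1 - z ≤ z ^ 2 * ((Real.exp c - 1 - c) / c ^ 2) := by
  rw [exp_sub_taylor_eq_integral z, exp_sub_taylor_eq_integral c,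
    mul_div_cancel_left₀ _ (by positivity)]
  refine mul_le_mul_of_nonneg_left ?_ (sq_nonneg z)
  refine intervalIntegral.integral_mono_on zero_le_one (Continuous.intervalIntegrable
    (by fun_prop) _ _) (Continuous.intervalIntegrable (by fun_prop) _ _) fun r hr => ?_
  have h1 : 0 ≤ 1 - r := by linarith [hr.2]
  have h2 := hr.1
  gcongr

/-- Among centred variables bounded above by `1` with variance `s`, the moment generating function
is largest for the two-point law on `-s` and `1`. -/
lemma integral_exp_le_two_point {μ : Measure ℝ} [IsProbabilityMeasure μ]
    (hB : ∀ᵐ y ∂μ, y ≤ 1) (h1 : Integrable (fun y => y) μ) (h2 : Integrable (fun y : ℝ => y ^ 2) μ)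
    (hm : ∫ y, y ∂μ = 0) {s : ℝ} (hs : ∫ y, y ^ 2 ∂μ = s) {l : ℝ} (hl : 0 < l) :
    ∫ y, Real.exp (l * y) ∂μ ≤ (Real.exp (-(l * s)) + s * Real.exp l) / (1 + s) := by
  have hs0 : 0 ≤ s := hs ▸ integral_nonneg fun y => sq_nonneg y
  set c := l * (1 + s) with hc
  have hc0 : 0 < c := by positivity
  set κ := (Real.exp c - 1 - c) / c ^ 2 with hκ
  have hpt : ∀ y ≤ 1, Real.exp (l * y)
      ≤ Real.exp (-(l * s)) * ((1 + l * s + l ^ 2 * s ^ 2 * κ) + (l + 2 * l ^ 2 * s * κ) * y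
        + l ^ 2 * κ * y ^ 2) := fun y hy => by
    have h := exp_sub_taylor_le (z := l * (y + s)) (c := c)
      (mul_le_mul_of_nonneg_left (by linarith) hl.le) hc0
    have e : Real.exp (l * y) = Real.exp (-(l * s)) * Real.exp (l * (y + s)) := by
      rw [← Real.exp_add]; ring_nf
    rw [e]
    refine mul_le_mul_of_nonneg_left ?_ (Real.exp_pos _).le
    rw [← hκ] at h
    linarith [h, show (l * (y + s)) ^ 2 * κ = l ^ 2 * s ^ 2 * κ + 2 * l ^ 2 * s * κ * y
      + l ^ 2 * κ * y ^ 2 by ring]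
  have i1 : Integrable (fun y : ℝ => (1 + l * s + l ^ 2 * s ^ 2 * κ)
      + (l + 2 * l ^ 2 * s * κ) * y) μ := (integrable_const _).add (h1.const_mul _)
  have hi := integral_mono_ae (integrable_exp_mul hB hl.le)
    ((i1.add (h2.const_mul (l ^ 2 * κ))).const_mul (Real.exp (-(l * s))))
    (hB.mono fun y hy => hpt y hy)
  refine hi.trans (le_of_eq ?_)
  rw [integral_const_mul]
  simp only [Pi.add_apply]
  rw [integral_add i1 (h2.const_mul _), integral_add (integrable_const _) (h1.const_mul _),
    integral_const_mul, integral_const_mul, hm, hs]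
  have hκc : κ * c ^ 2 = Real.exp c - 1 - c := div_mul_cancel₀ _ (by positivity)
  have hel : Real.exp l = Real.exp (-(l * s)) * Real.exp c := by
    rw [← Real.exp_add, hc]; ring_nf
  have h1s : (1 + s) ≠ 0 := by positivity
  simp only [integral_const, probReal_univ, one_smul]
  rw [eq_div_iff h1s, hel]
  have : Real.exp c = κ * c ^ 2 + 1 + c := by linarith
  rw [this, hc]
  ring

/-- For `c ≠ 0` this function is `(1 - e^{-c}) / c`; the integral representation makes its convexity
plain. -/
lemma convexOn_integral_exp_neg :
    ConvexOn ℝ Set.univ fun c : ℝ => ∫ r in (0 : ℝ)..1, Real.exp (-(c * r)) := by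
  refine ⟨convex_univ, fun x _ y _ a b ha hb hab => ?_⟩
  simp only [smul_eq_mul]
  have hi : ∀ c : ℝ, IntervalIntegrable (fun r => Real.exp (-(c * r))) volume 0 1 := fun c =>
    Continuous.intervalIntegrable (by fun_prop) _ _
  rw [← intervalIntegral.integral_const_mul, ← intervalIntegral.integral_const_mul,
    ← intervalIntegral.integral_add ((hi x).const_mul a) ((hi y).const_mul b)]
  refine intervalIntegral.integral_mono_on zero_le_one (hi _)
    (((hi x).const_mul a).add ((hi y).const_mul b)) fun r _ => ?_
  have := convexOn_exp.2 (Set.mem_univ (-(x * r))) (Set.mem_univ (-(y * r))) ha hb hab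
  simp only [smul_eq_mul] at this
  refine le_of_eq_of_le ?_ this
  congr 1; ring

lemma integral_exp_neg_eq {c : ℝ} (hc : c ≠ 0) :
    ∫ r in (0 : ℝ)..1, Real.exp (-(c * r)) = (1 - Real.exp (-c)) / c := by
  have hd : ∀ r ∈ Set.uIcc (0 : ℝ) 1, HasDerivAt (fun r => -(Real.exp (-(c * r)) / c))
      (Real.exp (-(c * r))) r := fun r _ => by
    have h1 : HasDerivAt (fun r : ℝ => -(c * r)) (-c) r := by
      convert! ((hasDerivAt_id r).const_mul c).neg using 1
      simp
    convert! (h1.exp.div_const c).neg using 1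
    field_simp
  rw [intervalIntegral.integral_eq_sub_of_hasDerivAt hd
    (Continuous.intervalIntegrable (by fun_prop) _ _)]
  simp
  ring

/-- The two-point moment generating function through the convex function
`c ↦ (1 - e^{-c}) / c` at `c = l (1 + s)`. -/
lemma two_point_eq {s l : ℝ} (hs : 0 ≤ s) (hl : 0 < l) :
    (Real.exp (-(l * s)) + s * Real.exp l) / (1 + s)
      = Real.exp l * (1 - l * ∫ r in (0 : ℝ)..1, Real.exp (-(l * (1 + s) * r))) := by
  have h1s : 0 < 1 + s := by positivity
  rw [integral_exp_neg_eq (by positivity)]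
  have : Real.exp (-(l * s)) = Real.exp l * Real.exp (-(l * (1 + s))) := by
    rw [← Real.exp_add]; ring_nf
  rw [this]
  field_simp
  ring

lemma prod_le_mean_pow {n : ℕ} (hn : 1 ≤ n) (a : Fin n → ℝ) (ha : ∀ i, 0 ≤ a i) :
    ∏ i, a i ≤ ((∑ i, a i) / n) ^ n := by
  have hn' : (0 : ℝ) < n := by exact_mod_cast hn
  have h := Real.geom_mean_le_arith_mean Finset.univ (fun _ => (1 : ℝ)) a (fun _ _ => zero_le_one)
    (by simpa using hn') (fun i _ => ha i)
  simp only [Real.rpow_one, Finset.sum_const, Finset.card_univ, Fintype.card_fin, nsmul_eq_mul,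
    mul_one, one_mul] at h
  have hp : 0 ≤ ∏ i, a i := Finset.prod_nonneg fun i _ => ha i
  calc ∏ i, a i = ((∏ i, a i) ^ ((n : ℝ)⁻¹)) ^ n := by
        rw [Real.rpow_inv_natCast_pow hp (by omega)]
    _ ≤ _ := pow_le_pow_left₀ (by positivity) h n

/-- Replacing all variances by their mean `w` only increases the product of the two-point
moment generating functions. -/
lemma prod_two_point_le {n : ℕ} (hn : 1 ≤ n) (v : Fin n → ℝ) (hv : ∀ i, 0 ≤ v i) {l : ℝ}
    (hl : 0 < l) {w : ℝ} (hw : ∑ i, v i = n * w) :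
    ∏ i, (Real.exp (-(l * v i)) + v i * Real.exp l) / (1 + v i)
      ≤ ((Real.exp (-(l * w)) + w * Real.exp l) / (1 + w)) ^ n := by
  have hn' : (0 : ℝ) < n := by exact_mod_cast hn
  have hw0 : 0 ≤ w := by
    have := Finset.sum_nonneg fun i (_ : i ∈ Finset.univ) => hv i
    rw [hw] at this
    exact nonneg_of_mul_nonneg_right this hn'
  have hpos : ∀ i, 0 ≤ (Real.exp (-(l * v i)) + v i * Real.exp l) / (1 + v i) := fun i => by
    have := hv i
    positivity
  refine (prod_le_mean_pow hn _ hpos).trans (pow_le_pow_left₀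
    (div_nonneg (Finset.sum_nonneg fun i _ => hpos i) hn'.le) ?_ n)
  simp_rw [fun i => two_point_eq (hv i) hl]
  rw [two_point_eq hw0 hl, ← Finset.mul_sum, mul_div_assoc]
  refine mul_le_mul_of_nonneg_left ?_ (Real.exp_pos _).le
  have hconv := convexOn_integral_exp_neg.map_sum_le (t := Finset.univ) (w := fun _ : Fin n =>
    (n : ℝ)⁻¹) (p := fun i => l * (1 + v i)) (fun _ _ => by positivity)
    (by simp [hn'.ne']) (fun _ _ => Set.mem_univ _)
  have hmean : ∑ i : Fin n, (n : ℝ)⁻¹ • (l * (1 + v i)) = l * (1 + w) := by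
    simp only [smul_eq_mul]
    rw [← Finset.mul_sum, ← Finset.mul_sum, Finset.sum_add_distrib, hw]
    simp only [Finset.sum_const, Finset.card_univ, Fintype.card_fin, nsmul_eq_mul]
    field_simp
  rw [hmean] at hconv
  simp only [smul_eq_mul] at hconv
  rw [← Finset.mul_sum] at hconv
  rw [Finset.sum_sub_distrib, ← Finset.mul_sum]
  simp only [Finset.sum_const, Finset.card_univ, Fintype.card_fin, nsmul_eq_mul, mul_one]
  rw [sub_div, div_self hn'.ne']
  have := mul_le_mul_of_nonneg_left hconv hl.le
  refine sub_le_sub_left (this.trans (le_of_eq ?_)) 1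
  field_simp

lemma integral_exp_sum_le {n : ℕ} (hn : 1 ≤ n) (μ : Fin n → Measure ℝ)
    [∀ i, IsProbabilityMeasure (μ i)] (hB : ∀ i, ∀ᵐ y ∂(μ i), y ≤ 1)
    (h1 : ∀ i, Integrable (fun y => y) (μ i)) (h2 : ∀ i, Integrable (fun y : ℝ => y ^ 2) (μ i))
    (hm : ∀ i, ∫ y, y ∂(μ i) = 0) {w : ℝ} (hw : ∑ i, ∫ y, y ^ 2 ∂(μ i) = n * w) {l : ℝ}
    (hl : 0 < l) (z : ℝ) :
    ∫ ω, Real.exp (l * (∑ i, ω i - n * z)) ∂(Measure.pi μ)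
      ≤ (Real.exp (-(l * z)) * ((Real.exp (-(l * w)) + w * Real.exp l) / (1 + w))) ^ n := by
  rw [integral_exp_sum_eq, mul_pow, ← Real.exp_nat_mul,
    show (n : ℝ) * -(l * z) = -(l * (n * z)) by ring]
  refine mul_le_mul_of_nonneg_left ?_ (Real.exp_pos _).le
  refine le_trans (Finset.prod_le_prod (fun i _ => integral_nonneg fun y => (Real.exp_pos _).le)
    fun i _ => integral_exp_le_two_point (hB i) (h1 i) (h2 i) (hm i) rfl hl) ?_
  exact prod_two_point_le hn _ (fun i => integral_nonneg fun y => sq_nonneg y) hl hw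

/-- The value of the two-point bound at its minimiser, in the interior case. -/
lemma hoeffdingH_eq_of_lt {n : ℕ} (hn : 1 ≤ n) {x s w z l : ℝ} (hx : 0 < x) (hs : 0 < s)
    (hw : s ^ 2 = n * w) (hz : x * s = n * z) (hz1 : z < 1)
    (hl : l = Real.log ((w + z) / (w * (1 - z))) / (1 + w)) :
    (Real.exp (-(l * z)) * ((Real.exp (-(l * w)) + w * Real.exp l) / (1 + w))) ^ n
      = hoeffdingH n x s := by
  have hn' : (0 : ℝ) < n := by exact_mod_cast hn
  have hw0 : 0 < w := by
    have : 0 < n * w := hw ▸ (by positivity)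
    exact (mul_pos_iff_of_pos_left hn').1 this
  have hz0 : 0 < z := by
    have : 0 < n * z := hz ▸ (by positivity)
    exact (mul_pos_iff_of_pos_left hn').1 this
  have h1z : 0 < 1 - z := by linarith
  have hxn : x ≤ n / s := by rw [le_div_iff₀ hs, hz]; nlinarith
  have he : Real.exp (l * (1 + w)) = (w + z) / (w * (1 - z)) := by
    rw [hl, div_mul_cancel₀ _ (by positivity), Real.exp_log (by positivity)]
  have hlw : l * (1 + w) = Real.log ((w + z) / w) - Real.log (1 - z) := by
    rw [hl, div_mul_cancel₀ _ (by positivity), ← div_div, Real.log_div (by positivity) h1z.ne']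
  have hin : Real.exp (-(l * z)) * ((Real.exp (-(l * w)) + w * Real.exp l) / (1 + w))
      = Real.exp (-(l * (z + w)) - Real.log (1 - z)) := by
    have e1 : Real.exp l = Real.exp (-(l * w)) * Real.exp (l * (1 + w)) := by
      rw [← Real.exp_add]; ring_nf
    have e2 : Real.exp (-(l * (z + w))) = Real.exp (-(l * z)) * Real.exp (-(l * w)) := by
      rw [← Real.exp_add]; ring_nf
    rw [Real.exp_sub, Real.exp_log h1z, e2, e1, he]
    field_simp
    ring
  have hb1 : s / (x + s) = ((w + z) / w)⁻¹ := by
    have e3 : s / (x + s) = s ^ 2 / (x * s + s ^ 2) := by field_simp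
    rw [e3, hw, hz]; field_simp; ring
  have hb2 : (n : ℝ) / (n - x * s) = (1 - z)⁻¹ := by
    rw [hz, show (n : ℝ) - n * z = n * (1 - z) by ring]; field_simp
  have hb3 : (n : ℝ) / (n + s ^ 2) = (1 + w)⁻¹ := by
    rw [hw, show (n : ℝ) + n * w = n * (1 + w) by ring]; field_simp
  rw [hoeffdingH, if_pos hxn, hin, ← Real.exp_nat_mul, hb1, hb2, hb3, hw, hz,
    Real.rpow_def_of_pos (show 0 < ((w + z) / w)⁻¹ by positivity),
    Real.rpow_def_of_pos (show 0 < (1 - z)⁻¹ by positivity), ← Real.exp_add,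
    ← Real.exp_mul, Real.log_inv, Real.log_inv]
  congr 1
  have h1w : 0 < 1 + w := by positivity
  have hll : l = (Real.log ((w + z) / w) - Real.log (1 - z)) / (1 + w) := by
    rw [eq_div_iff h1w.ne', hlw]
  rw [hll]
  field_simp
  ring

lemma hoeffdingH_zero {n : ℕ} (hn : 1 ≤ n) {s : ℝ} (hs : 0 < s) : hoeffdingH n 0 s = 1 := by
  have hn' : (0 : ℝ) < n := by exact_mod_cast hn
  rw [hoeffdingH, if_pos (by positivity)]
  simp [hs.ne', hn'.ne']

/-- **Hoeffding's inequality**: any lower bound of the exponential moments `E e^{l(S - xσ)}` over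
`l ≥ 0` is at most `Hₙ(x, σ)`. -/
theorem le_hoeffdingH {n : ℕ} (hn : 1 ≤ n) (μ : Fin n → Measure ℝ)
    [∀ i, IsProbabilityMeasure (μ i)] (hB : ∀ i, ∀ᵐ y ∂(μ i), y ≤ 1)
    (h1 : ∀ i, Integrable (fun y => y) (μ i)) (h2 : ∀ i, Integrable (fun y : ℝ => y ^ 2) (μ i))
    (hm : ∀ i, ∫ y, y ∂(μ i) = 0) {s : ℝ} (hs : 0 < s) (hs2 : ∑ i, ∫ y, y ^ 2 ∂(μ i) = s ^ 2)
    {x : ℝ} (hx : 0 ≤ x) {m : ℝ}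
    (hmin : ∀ l : ℝ, 0 ≤ l → m ≤ ∫ ω, Real.exp (l * (∑ i, ω i - x * s)) ∂(Measure.pi μ)) :
    m ≤ hoeffdingH n x s := by
  have hn' : (0 : ℝ) < n := by exact_mod_cast hn
  rcases hx.eq_or_lt with rfl | hx
  · rw [hoeffdingH_zero hn hs]
    simpa using hmin 0 le_rfl
  set w := s ^ 2 / n with hw_def
  set z := x * s / n with hz_def
  have hw : s ^ 2 = n * w := by rw [hw_def]; field_simp
  have hz : x * s = n * z := by rw [hz_def]; field_simp
  have hw0 : 0 < w := by positivity
  have hz0 : 0 < z := by positivity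
  rcases lt_trichotomy z 1 with hz1 | hz1 | hz1
  · have h1z : 0 < 1 - z := by linarith
    have hl : 0 < Real.log ((w + z) / (w * (1 - z))) / (1 + w) := by
      refine div_pos (Real.log_pos ?_) (by positivity)
      rw [one_lt_div (by positivity)]
      nlinarith
    rw [← hoeffdingH_eq_of_lt hn hx hs hw hz hz1 rfl]
    refine (hmin _ hl.le).trans ?_
    rw [hz]
    exact integral_exp_sum_le hn μ hB h1 h2 hm (hs2.trans hw) hl z
  · -- at the right end point the infimum is only approached as `l → ∞`
    have hxs : x * s = n := by rw [hz, hz1, mul_one]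
    have hH : hoeffdingH n x s = (w / (1 + w)) ^ n := by
      rw [hoeffdingH, if_pos (by rw [le_div_iff₀ hs, hxs]), hxs, sub_self, Real.rpow_zero, mul_one,
        ← Real.rpow_mul (by positivity), mul_div_cancel₀ _ (by positivity), Real.rpow_natCast]
      congr 1
      have e3 : s / (x + s) = s ^ 2 / (x * s + s ^ 2) := by field_simp
      rw [e3, hxs, hw]; field_simp
    rw [hH]
    have hlim : Tendsto (fun l : ℝ => ((Real.exp (-(l * (1 + w))) + w) / (1 + w)) ^ n) atTop
        (nhds (((0 + w) / (1 + w)) ^ n)) := by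
      have h3 : Tendsto (fun l : ℝ => Real.exp (-(l * (1 + w)))) atTop (nhds 0) :=
        Real.tendsto_exp_neg_atTop_nhds_zero.comp
          (tendsto_id.atTop_mul_const (by positivity))
      exact ((h3.add_const w).div_const _).pow n
    rw [zero_add] at hlim
    refine ge_of_tendsto hlim ((eventually_gt_atTop 0).mono fun l hl => (hmin l hl.le).trans ?_)
    rw [hz]
    refine (integral_exp_sum_le hn μ hB h1 h2 hm (hs2.trans hw) hl z).trans (le_of_eq ?_)
    congr 1
    rw [hz1, mul_one, ← mul_div_assoc, mul_add, ← Real.exp_add, mul_left_comm, ← Real.exp_add]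
    simp
    ring_nf
  · have hxn : ¬ x ≤ n / s := by
      rw [not_le, div_lt_iff₀ hs, hz]; nlinarith
    rw [hoeffdingH, if_neg hxn]
    have hgap : 0 < x * s - n := by rw [hz]; nlinarith
    have hlim : Tendsto (fun l : ℝ => Real.exp (-(l * (x * s - n)))) atTop (nhds 0) :=
      Real.tendsto_exp_neg_atTop_nhds_zero.comp (tendsto_id.atTop_mul_const hgap)
    refine ge_of_tendsto hlim ((eventually_ge_atTop 0).mono fun l (hl : 0 ≤ l) => ?_)
    refine (hmin l hl).trans ?_
    rw [integral_exp_sum_eq]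
    have hM : ∏ i, ∫ y, Real.exp (l * y) ∂(μ i) ≤ Real.exp l ^ n := by
      refine (Finset.prod_le_prod (g := fun _ => Real.exp l)
        (fun i _ => integral_nonneg fun y => (Real.exp_pos _).le) fun i _ => ?_).trans (by simp)
      refine (integral_mono_of_nonneg (ae_of_all _ fun y => (Real.exp_pos _).le)
        (integrable_const (Real.exp l)) ?_).trans (by simp)
      filter_upwards [hB i] with y hy
      exact Real.exp_le_exp.2 (by nlinarith)
    calc _ ≤ Real.exp (-(l * (x * s))) * Real.exp l ^ n := by gcongr
      _ = _ := by rw [← Real.exp_nat_mul, ← Real.exp_add]; ring_nf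

/-! ### Back to random variables, and the i.i.d. case -/

section Transfer

variable {Ω : Type*} [MeasurableSpace Ω] {P : Measure Ω} {n : ℕ} {ξ : Fin n → Ω → ℝ}
  {δ B x : ℝ}

lemma integral_map_law (h : CenteredIndep P ξ) (i : Fin n) {g : ℝ → ℝ} (hg : Measurable g) :
    ∫ y, g y ∂(P.map (ξ i)) = ∫ ω, g (ξ i ω) ∂P :=
  integral_map (h.measurable i).aemeasurable hg.aestronglyMeasurable

lemma ae_map_le (h : CenteredIndep P ξ) {b : ℝ} (hb : ∀ i, ∀ᵐ ω ∂P, ξ i ω ≤ b) (i : Fin n) :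
    ∀ᵐ y ∂(P.map (ξ i)), y ≤ b :=
  (ae_map_iff (h.measurable i).aemeasurable measurableSet_Iic).2 (hb i)

lemma sigma_eq_map (h : CenteredIndep P ξ) :
    √(∑ i, ∫ y, y ^ 2 ∂(P.map (ξ i))) = sigma P ξ := by
  simp_rw [fun i => integral_map_law h i (g := fun y => y ^ 2) (by fun_prop)]
  rfl

lemma expInf_le (x : ℝ) {l : ℝ} (hl : 0 ≤ l) :
    expInf P ξ x ≤ ∫ ω, Real.exp (l * (partialSum ξ ω - x * sigma P ξ)) ∂P :=
  ciInf_le (f := fun l : ℝ≥0 => ∫ ω, Real.exp ((l : ℝ) * (partialSum ξ ω - x * sigma P ξ)) ∂P)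
    ⟨0, by rintro _ ⟨l, rfl⟩; exact integral_nonneg fun ω => (Real.exp_pos _).le⟩ ⟨l, hl⟩

lemma expInf_eq {l : ℝ} (hl : 0 ≤ l)
    (hmin : ∀ l' : ℝ, 0 ≤ l' → ∫ ω, Real.exp (l * (partialSum ξ ω - x * sigma P ξ)) ∂P
      ≤ ∫ ω, Real.exp (l' * (partialSum ξ ω - x * sigma P ξ)) ∂P) :
    expInf P ξ x = ∫ ω, Real.exp (l * (partialSum ξ ω - x * sigma P ξ)) ∂P :=
  le_antisymm (expInf_le x hl) (le_ciInf fun l' => hmin l' l'.2)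

variable [IsProbabilityMeasure P]

lemma admissibleLaws_map (hn : 1 ≤ n) (h : CenteredIndep P ξ) (hA : ConditionA P ξ δ B)
    (hB : ∀ i, ∀ᵐ ω ∂P, ξ i ω ≤ B) : AdmissibleLaws (fun i => P.map (ξ i)) δ B where
  delta_pos := hA.delta_pos
  delta_le_one := hA.delta_le_one
  B_pos := hA.B_pos
  n_pos := hn
  prob i := Measure.isProbabilityMeasure_map (h.measurable i).aemeasurable
  le_B := ae_map_le h hB
  integrable_moment i := integrable_rpow_map (h.measurable i) (hA.integrable_moment i)
  moment_le i := by
    rw [integral_map_law h i (g := fun y => |y| ^ (2 + δ)) (by fun_prop)]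
    exact hA.moment_le i
  mean i := by
    rw [integral_map_law h i (g := fun y => y) (by fun_prop)]
    exact h.mean_zero i
  sq_pos i := by
    rw [integral_map_law h i (g := fun y => y ^ 2) (by fun_prop)]
    exact integral_sq_pos (h.nondegenerate i)
      (integrable_pow_comp (h.measurable i) hA.delta_pos.le (hA.integrable_moment i) le_rfl)
  le_tilted l hl := by
    simp_rw [fun i => integral_map_law h i (g := fun y => y ^ 2) (by fun_prop),
      fun i => integral_map_law h i (g := fun y => y ^ 2 * Real.exp (l * y)) (by fun_prop)]
    exact hA.le_tilted l hl

lemma map_eq_pi (h : CenteredIndep P ξ) :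
    P.map (fun ω i => ξ i ω) = Measure.pi fun i => P.map (ξ i) :=
  (iIndepFun_iff_map_fun_eq_pi_map fun i => (h.measurable i).aemeasurable).1 h.indep

lemma integral_exp_pi_map (h : CenteredIndep P ξ) (l c : ℝ) :
    ∫ ω, Real.exp (l * (∑ i, ω i - c)) ∂(Measure.pi fun i => P.map (ξ i))
      = ∫ ω, Real.exp (l * (partialSum ξ ω - c)) ∂P := by
  rw [← map_eq_pi h]
  exact integral_map (φ := fun ω i => ξ i ω)
    (f := fun w : Fin n → ℝ => Real.exp (l * (∑ i, w i - c)))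
    (measurable_pi_lambda _ h.measurable).aemeasurable
    (Measurable.aestronglyMeasurable (by fun_prop))

lemma measureReal_pi_map (h : CenteredIndep P ξ) (c : ℝ) {s : Set ℝ} (hs : MeasurableSet s) :
    (Measure.pi fun i => P.map (ξ i)).real {ω | ∑ i, ω i - c ∈ s}
      = P.real {ω | partialSum ξ ω - c ∈ s} := by
  rw [← map_eq_pi h]
  exact map_measureReal_apply (f := fun ω i => ξ i ω) (measurable_pi_lambda _ h.measurable)
    ((show Measurable fun ω : Fin n → ℝ => ∑ i, ω i - c by fun_prop) hs)

/-- The saddle point expansion of both the open and the closed upper tail. -/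
theorem tail_expansion (hn : 1 ≤ n) (h : CenteredIndep P ξ) (hA : ConditionA P ξ δ B)
    (hB : ∀ i, ∀ᵐ ω ∂P, ξ i ω ≤ B) (hx0 : 0 ≤ x) (hx : x < 0.25 * (sigma P ξ / B)) :
    0 < expInf P ξ x ∧
    (∃ E : ℝ, P.real {ω | x * sigma P ξ < partialSum ξ ω} = E * expInf P ξ x ∧ E ≤ 1 ∧
      |E - Theta x| ≤ epsilonX P ξ δ B x) ∧
    ∃ E : ℝ, P.real {ω | x * sigma P ξ ≤ partialSum ξ ω} = E * expInf P ξ x ∧ E ≤ 1 ∧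
      |E - Theta x| ≤ epsilonX P ξ δ B x := by
  obtain ⟨l, hl, hmin, hpos, hE⟩ := (admissibleLaws_map hn h hA hB).tail_expansion hx0
    (by rwa [sigma_eq_map h])
  simp_rw [sigma_eq_map h, integral_exp_pi_map h] at hmin hpos hE
  have hM := expInf_eq hl hmin
  rw [← hM] at hpos hE
  have hL : (∑ i, ∫ y, |y| ^ (2 + δ) ∂(P.map (ξ i))) / sigma P ξ ^ (2 + δ)
      = lyapunovRatio P ξ δ := by
    simp_rw [fun i => integral_map_law h i (g := fun y => |y| ^ (2 + δ)) (by fun_prop)]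
    rfl
  rw [hL] at hE
  refine ⟨hpos, ?_, ?_⟩
  · have := hE (Set.Ioi 0) (Or.inl rfl)
    rw [measureReal_pi_map h _ measurableSet_Ioi] at this
    simp only [Set.mem_Ioi, sub_pos] at this
    exact this
  · have := hE (Set.Ici 0) (Or.inr rfl)
    rw [measureReal_pi_map h _ measurableSet_Ici] at this
    simp only [Set.mem_Ici, sub_nonneg] at this
    exact this

lemma expInf_le_hoeffdingH (hn : 1 ≤ n) (h : CenteredIndep P ξ) (hA : ConditionA P ξ δ B)
    (h1 : ∀ i, ∀ᵐ ω ∂P, ξ i ω ≤ 1) (hx0 : 0 ≤ x) :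
    expInf P ξ x ≤ hoeffdingH n x (sigma P ξ) := by
  have := fun i => Measure.isProbabilityMeasure_map (μ := P) (h.measurable i).aemeasurable
  have hint := fun i => integrable_rpow_map (h.measurable i) (hA.integrable_moment i)
  refine le_hoeffdingH hn (fun i => P.map (ξ i)) (ae_map_le h h1) (fun i => ?_) (fun i => ?_)
    (fun i => ?_) (sigma_pos hn h hA.delta_pos.le hA.integrable_moment) ?_ hx0 fun l hl => ?_
  · simpa using integrable_pow_of_integrable_rpow hA.delta_pos.le (hint i) (k := 1) (by norm_num)
  · exact integrable_pow_of_integrable_rpow hA.delta_pos.le (hint i) le_rfl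
  · rw [integral_map_law h i (g := fun y => y) (by fun_prop)]
    exact h.mean_zero i
  · rw [sigma_sq]
    exact Finset.sum_congr rfl fun i _ =>
      integral_map_law h i (g := fun y => y ^ 2) (by fun_prop)
  · rw [integral_exp_pi_map h]
    exact expInf_le x hl

end Transfer

section IID

variable {Ω : Type*} [MeasurableSpace Ω] {P : Measure Ω} {ξ : ℕ → Ω → ℝ} {δ B : ℝ}

lemma sigma_iid (hid : ∀ i, IdentDistrib (ξ i) (ξ 0) P P) (n : ℕ) :
    sigma P (fun i : Fin n => ξ i) = √n * √(∫ ω, ξ 0 ω ^ 2 ∂P) := by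
  have : ∀ i, ∫ ω, ξ i ω ^ 2 ∂P = ∫ ω, ξ 0 ω ^ 2 ∂P := fun i =>
    ((hid i).comp (u := fun y : ℝ => y ^ 2) (by fun_prop)).integral_eq
  rw [sigma, ← Real.sqrt_mul (by positivity)]
  simp [this]

lemma lyapunovRatio_iid (hid : ∀ i, IdentDistrib (ξ i) (ξ 0) P P) {n : ℕ} (hn : 1 ≤ n) :
    lyapunovRatio P (fun i : Fin n => ξ i) δ
      = (∫ ω, |ξ 0 ω| ^ (2 + δ) ∂P) / √(∫ ω, ξ 0 ω ^ 2 ∂P) ^ (2 + δ) * (1 / (n : ℝ) ^ (δ / 2)) := by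
  have hn' : (0 : ℝ) < n := by exact_mod_cast hn
  have : ∀ i, ∫ ω, |ξ i ω| ^ (2 + δ) ∂P = ∫ ω, |ξ 0 ω| ^ (2 + δ) ∂P := fun i =>
    ((hid i).comp (u := fun y : ℝ => |y| ^ (2 + δ)) (by fun_prop)).integral_eq
  have h2 : √(n : ℝ) ^ (2 + δ) = n * (n : ℝ) ^ (δ / 2) := by
    rw [Real.sqrt_eq_rpow, ← Real.rpow_mul hn'.le,
      show 1 / 2 * (2 + δ) = 1 + δ / 2 by ring, Real.rpow_add hn', Real.rpow_one]
  rw [lyapunovRatio, sigma_iid hid, Real.mul_rpow (by positivity) (by positivity), h2]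
  simp only [this, Finset.sum_const, Finset.card_univ, Fintype.card_fin, nsmul_eq_mul]
  field_simp

lemma ConditionA.mono {n : ℕ} {ξ : Fin n → Ω → ℝ} {B' : ℝ} (hA : ConditionA P ξ δ B)
    (hBB : B ≤ B') : ConditionA P ξ δ B' where
  delta_pos := hA.delta_pos
  delta_le_one := hA.delta_le_one
  B_pos := hA.B_pos.trans_le hBB
  integrable_moment := hA.integrable_moment
  moment_le i := (hA.moment_le i).trans
    (Real.rpow_le_rpow hA.B_pos.le hBB (by linarith [hA.delta_pos]))
  le_tilted l hl := by
    refine le_trans (mul_le_mul_of_nonneg_right ?_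
      (Finset.sum_nonneg fun i _ => integral_nonneg fun ω => sq_nonneg _)) (hA.le_tilted l hl)
    have := mul_le_mul_of_nonneg_right hBB hl
    linarith

lemma inv_sqrt_le_inv_rpow {n : ℕ} (hn : 1 ≤ n) (h1 : δ ≤ 1) :
    1 / √(n : ℝ) ≤ 1 / (n : ℝ) ^ (δ / 2) := by
  have hn' : (1 : ℝ) ≤ n := by exact_mod_cast hn
  rw [Real.sqrt_eq_rpow]
  exact one_div_le_one_div_of_le (by positivity) (Real.rpow_le_rpow_of_exponent_le hn'
    (by linarith))

/-- The error bound increases with `t`, so that for `t ≤ 1/4` it is linear in a common bound `r` of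
`b` and `L`. It is used with `r = n^{-δ/2}`. -/
lemma errorBound_le {t b C L b₀ L₀ r : ℝ} (hδ : 0 < δ) (ht : t ≤ 1 / 4)
    (hb : b ≤ b₀ * r) (hL : L ≤ L₀ * r) (hb0 : 0 ≤ b) (hL0 : 0 ≤ L) (hC : 0 ≤ C) :
    errorBound δ t b C L
      ≤ Real.exp (1 / 4) / (1 / 2) *
        (1.58 / √Real.pi * b₀ + 2 ^ (3 + δ) * C / (1 / 2) ^ (δ / 2) * L₀) * r := by
  have h2 : (1 / 2 : ℝ) ≤ 1 - 2 * t := by linarith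
  have h3 : 0 ≤ b₀ * r := hb0.trans hb
  have h4 : 0 ≤ L₀ * r := hL0.trans hL
  calc errorBound δ t b C L
      ≤ Real.exp (1 / 4) / (1 / 2) * (1.58 / √Real.pi * (b₀ * r)
        + 2 ^ (3 + δ) * C / (1 / 2) ^ (δ / 2) * (L₀ * r)) := by
        rw [errorBound]
        gcongr
    _ = _ := by ring

/-- In the i.i.d. case, for `x = o(n^{δ/2})` the saddle point expansion is eventually available,
with an error at most a constant multiple of `n^{-δ/2}`. -/
lemma eventually_tail_expansion [IsProbabilityMeasure P]
    (hid : ∀ i, IdentDistrib (ξ i) (ξ 0) P P)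
    (hξ : ∀ n : ℕ, CenteredIndep P (fun i : Fin n => ξ i))
    (hA : ∀ n : ℕ, ConditionA P (fun i : Fin n => ξ i) δ B) (h1 : ∀ i, ∀ᵐ ω ∂P, ξ i ω ≤ 1) :
    ∃ K : ℝ, ∀ x : ℕ → ℝ, (∀ n, 0 ≤ x n) →
      (x =o[atTop] fun n : ℕ => (n : ℝ) ^ (δ / 2)) → ∀ᶠ n : ℕ in atTop, 1 ≤ n ∧
        0 < expInf P (fun i : Fin n => ξ i) (x n) ∧
        (∃ E : ℝ, P.real {ω | x n * sigma P (fun i : Fin n => ξ i)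
            < partialSum (fun i : Fin n => ξ i) ω}
            = E * expInf P (fun i : Fin n => ξ i) (x n) ∧
          |E - Theta (x n)| ≤ K * (1 / (n : ℝ) ^ (δ / 2))) ∧
        ∃ E : ℝ, P.real {ω | x n * sigma P (fun i : Fin n => ξ i)
            ≤ partialSum (fun i : Fin n => ξ i) ω}
            = E * expInf P (fun i : Fin n => ξ i) (x n) ∧
          |E - Theta (x n)| ≤ K * (1 / (n : ℝ) ^ (δ / 2)) := by
  -- `ξ i ≤ B` is not assumed here, but condition (A) is monotone in `B` and `ξ i ≤ 1`
  set B' := max B 1 with hB'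
  have hA' : ∀ n : ℕ, ConditionA P (fun i : Fin n => ξ i) δ B' :=
    fun n => (hA n).mono (le_max_left B 1)
  have hB1 : ∀ i, ∀ᵐ ω ∂P, ξ i ω ≤ B' := fun i => (h1 i).mono fun ω h => h.trans (le_max_right _ _)
  have hBpos : 0 < B' := (hA' 0).B_pos
  have hδ := (hA 0).delta_pos
  have hδ1 := (hA 0).delta_le_one
  set s := √(∫ ω, ξ 0 ω ^ 2 ∂P) with hs_def
  have hs : 0 < s := by
    have := sigma_pos le_rfl (hξ 1) hδ.le (hA 1).integrable_moment
    rw [sigma_iid hid] at this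
    simpa [hs_def] using this
  have hC : 0 ≤ lyapunovConst δ := by
    have hlaw := admissibleLaws_map le_rfl (hξ 1) (hA' 1) fun i => hB1 i
    have := fun i => hlaw.isProbabilityMeasure_tilted (l := 0) i le_rfl
    exact lyapunovConst_nonneg hδ hδ1 le_rfl (hlaw.centeredIndep_tilted le_rfl)
      (hlaw.integrable_moment_tilted le_rfl)
  set K := Real.exp (1 / 4) / (1 / 2) * (1.58 / √Real.pi * (B' / s) + 2 ^ (3 + δ) * lyapunovConst δ
    / (1 / 2) ^ (δ / 2) * ((∫ ω, |ξ 0 ω| ^ (2 + δ) ∂P) / s ^ (2 + δ))) with hK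
  refine ⟨K, fun x hx0 hx => ?_⟩
  filter_upwards [hx.bound (show 0 < s / (8 * B') by positivity), eventually_ge_atTop 1]
    with n hn hn1
  have hn' : (1 : ℝ) ≤ n := by exact_mod_cast hn1
  have hσ : sigma P (fun i : Fin n => ξ i) = √n * s := sigma_iid hid n
  have hsn : 0 < √(n : ℝ) := by positivity
  have hpow : (n : ℝ) ^ (δ / 2) ≤ √n := by
    rw [Real.sqrt_eq_rpow]
    exact Real.rpow_le_rpow_of_exponent_le hn' (by linarith)
  rw [Real.norm_of_nonneg (hx0 n), Real.norm_of_nonneg (by positivity)] at hn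
  have hxB : x n * B' / (√n * s) ≤ 1 / 8 := by
    rw [div_le_iff₀ (by positivity)]
    have := hn.trans (mul_le_mul_of_nonneg_left hpow (by positivity))
    calc x n * B' ≤ s / (8 * B') * √n * B' := by gcongr
      _ = _ := by field_simp
  have hxlt : x n < 0.25 * (sigma P (fun i : Fin n => ξ i) / B') := by
    rw [hσ, ← mul_div_assoc, lt_div_iff₀ hBpos]
    rw [div_le_iff₀ (by positivity)] at hxB
    have : 0 < √n * s := by positivity
    linarith
  obtain ⟨hpos, ⟨E, hE, _, hEε⟩, E', hE', _, hEε'⟩ :=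
    tail_expansion hn1 (hξ n) (hA' n) (fun i => hB1 i) (hx0 n) hxlt
  have ht : tParam (x n) B' (√n * s) ≤ 1 / 4 := by
    rw [tParam, div_le_iff₀ (by positivity), show 2 * x n * B' / (√n * s)
      = 2 * (x n * B' / (√n * s)) by ring]
    have := Real.sqrt_nonneg (1 - 4 * x n * B' / (√n * s))
    linarith
  have hε : epsilonX P (fun i : Fin n => ξ i) δ B' (x n) ≤ K * (1 / (n : ℝ) ^ (δ / 2)) := by
    refine errorBound_le (b := B' / sigma P (fun i : Fin n => ξ i)) (C := lyapunovConst δ)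
      (L := lyapunovRatio P (fun i : Fin n => ξ i) δ) (b₀ := B' / s) hδ ?_ ?_
      (lyapunovRatio_iid hid hn1).le ?_ ?_ hC
    · rw [hσ]; exact ht
    · rw [hσ, show B' / (√n * s) = B' / s * (1 / √n) by field_simp]
      have := inv_sqrt_le_inv_rpow hn1 hδ1
      gcongr
    · rw [hσ]; positivity
    · exact (lyapunovRatio_pos hn1 (hξ n) hδ (hA n).integrable_moment).le
  exact ⟨hn1, hpos, ⟨E, hE, hEε.trans hε⟩, E', hE', hEε'.trans hε⟩

end IID

end SharpTail

theorem theorem2p1 {Ω : Type*} [MeasurableSpace Ω] (P : Measure Ω) [IsProbabilityMeasure P]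
    (δ B : ℝ) :
    -- the expansion and the upper bound, for every `n`
    (∀ (n : ℕ) (ξ : Fin n → Ω → ℝ), CenteredIndep P ξ → ConditionA P ξ δ B →
      (∀ i, ∀ᵐ ω ∂P, ξ i ω ≤ 1) → (∀ i, ∀ᵐ ω ∂P, ξ i ω ≤ B) →
      ∀ x : ℝ, 0 ≤ x → x < 0.25 * (sigma P ξ / B) →
        (∃ θ : ℝ, |θ| ≤ 1 ∧
          P.real {ω | x * sigma P ξ < partialSum ξ ω}
            = (Theta x + θ * epsilonX P ξ δ B x) * expInf P ξ x) ∧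
        P.real {ω | x * sigma P ξ < partialSum ξ ω}
          ≤ min (Theta x + epsilonX P ξ δ B x) 1 * hoeffdingH n x (sigma P ξ)) ∧
    -- the i.i.d. case, `n → ∞`
    (∀ ξ : ℕ → Ω → ℝ, (∀ i, IdentDistrib (ξ i) (ξ 0) P P) →
      (∀ n : ℕ, CenteredIndep P (fun i : Fin n => ξ i)) →
      (∀ n : ℕ, ConditionA P (fun i : Fin n => ξ i) δ B) →
      (∀ i, ∀ᵐ ω ∂P, ξ i ω ≤ 1) →
      (∀ x : ℕ → ℝ, (∀ n, 0 ≤ x n) → (x =o[atTop] fun n : ℕ => (n : ℝ) ^ (δ / 2)) →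
        Tendsto (fun n : ℕ =>
          P.real {ω | x n * sigma P (fun i : Fin n => ξ i)
              ≤ partialSum (fun i : Fin n => ξ i) ω}
            / (Theta (x n) * expInf P (fun i : Fin n => ξ i) (x n))) atTop (nhds 1)) ∧
      (∃ K : ℝ, ∀ x : ℕ → ℝ, (∀ n, 0 ≤ x n) →
        (x =o[atTop] fun n : ℕ => (n : ℝ) ^ (δ / 2)) →
        ∀ᶠ n : ℕ in atTop,
          |P.real {ω | x n * sigma P (fun i : Fin n => ξ i)
                < partialSum (fun i : Fin n => ξ i) ω}
              - Theta (x n) * expInf P (fun i : Fin n => ξ i) (x n)|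
            ≤ K * (1 / (n : ℝ) ^ (δ / 2)
                * hoeffdingH n (x n) (sigma P (fun i : Fin n => ξ i))))) := by
  refine ⟨fun n ξ h hA h1 hB x hx0 hx => ?_, fun ξ hid hξ hA h1 => ?_⟩
  · have hn : 1 ≤ n := by
      rw [Nat.one_le_iff_ne_zero]
      rintro rfl
      simp [sigma] at hx
      linarith
    obtain ⟨hM, ⟨E, hE, hE1, hEε⟩, -⟩ := tail_expansion hn h hA hB hx0 hx
    have hE0 : 0 ≤ E := nonneg_of_mul_nonneg_left (hE ▸ measureReal_nonneg) hM
    refine ⟨⟨(E - Theta x) / epsilonX P ξ δ B x, ?_, ?_⟩, ?_⟩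
    · rw [abs_div, abs_of_nonneg ((abs_nonneg _).trans hEε)]
      exact div_le_one_of_le₀ hEε ((abs_nonneg _).trans hEε)
    · rw [hE, div_mul_cancel_of_imp fun h0 => abs_nonpos_iff.1 (h0 ▸ hEε), add_sub_cancel]
    · rw [hE]
      exact mul_le_mul (le_min (by linarith [le_abs_self (E - Theta x)]) hE1)
        (expInf_le_hoeffdingH hn h hA h1 hx0) hM.le
        (hE0.trans (le_min (by linarith [le_abs_self (E - Theta x)]) hE1))
  · obtain ⟨K, hK⟩ := eventually_tail_expansion hid hξ hA h1
    refine ⟨fun x hx0 hx => ?_, K, fun x hx0 hx => ?_⟩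
    · have hδ := (hA 0).delta_pos
      -- `1 / Θ(x)` grows at most linearly, so that the relative error is `O((1 + x) n^{-δ/2})`
      have hlim : Tendsto (fun n : ℕ => K * (2 * √(2 * Real.pi)) *
          (1 / (n : ℝ) ^ (δ / 2) + x n / (n : ℝ) ^ (δ / 2))) atTop (nhds 0) := by
        have h2 : Tendsto (fun n : ℕ => (n : ℝ) ^ (δ / 2)) atTop atTop :=
          (tendsto_rpow_atTop (by positivity)).comp tendsto_natCast_atTop_atTop
        have := ((h2.const_div_atTop 1).add hx.tendsto_div_nhds_zero).const_mul
          (K * (2 * √(2 * Real.pi)))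
        simpa using this
      rw [tendsto_iff_norm_sub_tendsto_zero]
      refine squeeze_zero' (Eventually.of_forall fun n => norm_nonneg _) ?_ hlim
      filter_upwards [hK x hx0 hx] with n ⟨_, hM, _, E, hE, hEK⟩
      have hΘ := Theta_pos (hx0 n)
      have hx1 : 0 < 1 + x n := by linarith [hx0 n]
      have hpi : 0 < √(2 * Real.pi) := by positivity
      have hinv : 1 / Theta (x n) ≤ 2 * √(2 * Real.pi) * (1 + x n) := by
        refine (one_div_le_one_div_of_le (by positivity) (le_Theta (hx0 n))).trans (le_of_eq ?_)
        field_simp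
      have hr0 : 0 ≤ K * (1 / (n : ℝ) ^ (δ / 2)) := (abs_nonneg _).trans hEK
      rw [hE, mul_div_mul_right _ _ hM.ne', Real.norm_eq_abs, div_sub_one hΘ.ne', abs_div,
        abs_of_pos hΘ, div_eq_mul_one_div]
      calc _ ≤ K * (1 / (n : ℝ) ^ (δ / 2)) * (2 * √(2 * Real.pi) * (1 + x n)) := by gcongr
        _ = _ := by ring
    · filter_upwards [hK x hx0 hx] with n ⟨hn, hM, ⟨E, hE, hEK⟩, _⟩
      rw [hE, ← sub_mul, abs_mul, abs_of_pos hM, ← mul_assoc]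
      exact mul_le_mul hEK (expInf_le_hoeffdingH hn (hξ n) (hA n) (fun i => h1 i) (hx0 n)) hM.le
        ((abs_nonneg _).trans hEK)
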